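/- Let $K_v$ be the complete graph on the vertices $0,1,\dots,v-1$. The linear length of an edge $\{i,j\}$ is $|i-j|$. A linear realization of a multiset $L$ of size $v-1$ is a Hamiltonian path in $K_v$ whose multiset of linear edge lengths is $L$. A multiset $L$ of size $v-1$ is called admissible if all its elements lie in $\{1,2,\dots,\lfloor v/2\rfloor\}$ and, for every divisor $d$ of $v$, at most $v-d$ of its elements (counted with multiplicity) are multiples of $d$. Theorem. Let $y>3$ and let $a,b,c\ge 0$ be integers. Let $L=\{1^a,3^b,y^c\}$ (that is, $a$ copies of $1$, $b$ copies of $3$ and $c$ copies of $y$) be an admissible multiset of size $v-1$, so that $v=a+b+c+1$. Write $v=3q+r$ with $0\le r<3$. Then $L$ has a linear realization in each of the following cases: 1. $a\ge y+1$; 2. $a\ge 7$ and $b\ge y-4$; 3. $a\ge 4$, $a+b\ge y+1$ and $c\equiv 0$ or $1 \pmod y$; 4. $a\ge 2$, $y=3t$ for an integer $t$, $v\ge 3t+6$, and either $r$ is even and $b\ge 3t$, or $r$ is odd and $b\ge 3t+1$. -/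

import Mathlib

namespace BHR

/-- The linear length `|i - j|` of an edge `s(i, j)` of the complete graph `K_v` on the vertices
`0, 1, …, v - 1`. -/
def linearLength {v : ℕ} (e : Sym2 (Fin v)) : ℕ :=
  Sym2.lift ⟨fun i j : Fin v => Nat.dist (i : ℕ) (j : ℕ), fun _ _ => Nat.dist_comm _ _⟩ e

/-- The multiset `L` of size `v - 1` meets the conditions of the Buratti–Horak–Rosa Conjecture:
its elements lie in `{1, …, ⌊v / 2⌋}`, and for each divisor `d` of `v` the number of multiples
of `d` in `L`, counted with multiplicity, is at most `v - d`. -/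
structure Admissible (v : ℕ) (L : Multiset ℕ) : Prop where
  size : L.card + 1 = v
  supp : ∀ z ∈ L, 1 ≤ z ∧ z ≤ v / 2
  divisors : ∀ d, d ∣ v → L.countP (fun z => d ∣ z) ≤ v - d

/-- The multiset of linear lengths of the edges of some Hamiltonian path of the complete graph
`K_v` on the vertices `0, 1, …, v - 1` is `L`. -/
def HasLinearRealization (v : ℕ) (L : Multiset ℕ) : Prop :=
  ∃ (s t : Fin v) (p : (⊤ : SimpleGraph (Fin v)).Walk s t),
    p.IsHamiltonian ∧ (p.edges : Multiset (Sym2 (Fin v))).map linearLength = L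

/-- The multiset `{1^a, x^b, y^c}`. -/
def tripleMultiset (a x b y c : ℕ) : Multiset ℕ :=
  Multiset.replicate a 1 + Multiset.replicate b x + Multiset.replicate c y

end BHR

/-! Two surgeries on a Hamiltonian path reduce the theorem to finitely many explicit paths.

The first changes the number of edges of a given length `x`. Suppose that the edges passing over
some point are exactly `x` parallel edges `(i, i + x)` with consecutive `i` (`Cut`). Opening a gap
of `x` vertices there turns each of them into two edges of length `x` and changes no other length
(`Cut.grow`); contracting these edges instead removes them (`Cut.shrink`). A path with cuts of
widths `1`, `3` and `y`, at suitably increasing places, therefore yields realizations for all larger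
`a`, for `b` in a residue class modulo `3` and for `c` in a residue class modulo `y`.

The second changes `y` itself. Arrange the vertices from `M` on in rows of length `y`, so that edges
of length `y` are vertical, and suppose that the shorter edges stay inside a row or below `M`,
except for `s` parallel edges of length `s` across `M` (`Site`). Putting `2 * s` new columns at the
left of the rows makes vertical edges have length `y + 2 * s`; each edge across `M` takes a detour
down one new column and up another, which visits all new vertices (`Site.grow`). For `s = 1` the
number of ones grows by `2` along with `y`; for `s = 3` the number of threes grows by `6` along with
`y`. Write `y = h + w` with `y + h` edges of length `y`, so that `h` stands for the residue of `c`.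
New columns with three vertices raise `h` by `2 * s`, those with two vertices raise `w` by `2 * s`.
Hence finitely many seeds reach every `y` and every required residue of `c`.

Sites of width `1` serve the case `a ≥ y + 1`. Sites of width `3`, with a fixed number of ones and a
fixed value of `b - y`, serve the cases with seven or two ones, and the third case when `b ≥ y - 3`.
For smaller `b` in the third case, seeds with sites of both widths give every splitting of `y + 1`
into ones and threes (`doubleSeeds_ready`). For each residue of `b` modulo `3` there is a separate
table of seeds, except that paths with two sites keep `b` exact. The tables are verified by
evaluation. -/

namespace BHR

/-! ### Hamiltonian paths as lists of natural numbers -/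

/-- The edges of the path that visits the entries of a list in order, each edge written as
the pair (smaller end, larger end). -/
def steps : List ℕ → List (ℕ × ℕ)
  | a :: b :: t => (min a b, max a b) :: steps (b :: t)
  | _ => []

/-- The length of an edge that is written as a pair (smaller end, larger end). -/
def len (e : ℕ × ℕ) : ℕ := e.2 - e.1

/-- `E` is the edge set of a Hamiltonian path on the vertices `0, …, v - 1`. -/
def IsPath (v : ℕ) (E : Multiset (ℕ × ℕ)) : Prop :=
  ∃ l : List ℕ, l.Perm (List.range v) ∧ (steps l : Multiset (ℕ × ℕ)) = E

theorem steps_append (l m : List ℕ) (x : ℕ) :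
    steps (l ++ x :: m) = steps (l ++ [x]) ++ steps (x :: m) := by
  induction l with
  | nil => simp [steps]
  | cons a t ih => cases t <;> simp_all [steps]

theorem steps_reverse (l : List ℕ) : (steps l.reverse).Perm (steps l) := by
  induction l with
  | nil => simp [steps]
  | cons a t ih =>
    cases t with
    | nil => simp [steps]
    | cons b t =>
      rw [List.reverse_cons, List.reverse_cons, List.append_assoc, List.singleton_append,
        steps_append, ← List.reverse_cons]
      refine (List.perm_append_comm.trans (ih.append_left _)).trans ?_
      simp [steps, min_comm, max_comm]

theorem mem_of_mem_steps {l : List ℕ} {e : ℕ × ℕ} (h : e ∈ steps l) : e.1 ∈ l ∧ e.2 ∈ l := by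
  induction l with
  | nil => simp [steps] at h
  | cons a t ih =>
    cases t with
    | nil => simp [steps] at h
    | cons b t =>
      rcases List.mem_cons.1 h with rfl | h
      · grind
      · grind

theorem lt_of_mem_steps {l : List ℕ} (hl : l.Nodup) {e : ℕ × ℕ} (h : e ∈ steps l) :
    e.1 < e.2 := by
  induction l with
  | nil => simp [steps] at h
  | cons a t ih =>
    cases t with
    | nil => simp [steps] at h
    | cons b t =>
      rcases List.mem_cons.1 h with rfl | h
      · have : a ≠ b := by grind
        grind
      · exact ih hl.of_cons h

theorem nodup_steps {l : List ℕ} (hl : l.Nodup) : (steps l).Nodup := by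
  induction l with
  | nil => simp [steps]
  | cons a t ih =>
    cases t with
    | nil => simp [steps]
    | cons b t =>
      refine List.nodup_cons.2 ⟨fun h => ?_, ih hl.of_cons⟩
      have := mem_of_mem_steps h
      grind

namespace IsPath

variable {v : ℕ} {E : Multiset (ℕ × ℕ)}

theorem nodup (h : IsPath v E) : E.Nodup := by
  obtain ⟨l, hl, rfl⟩ := h
  exact Multiset.coe_nodup.2 (nodup_steps (hl.nodup_iff.2 List.nodup_range))

theorem bounds (h : IsPath v E) {e : ℕ × ℕ} (he : e ∈ E) : e.1 < e.2 ∧ e.2 < v := by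
  obtain ⟨l, hl, rfl⟩ := h
  have hm := mem_of_mem_steps (Multiset.mem_coe.1 he)
  exact ⟨lt_of_mem_steps (hl.nodup_iff.2 List.nodup_range) (Multiset.mem_coe.1 he),
    List.mem_range.1 (hl.mem_iff.1 hm.2)⟩

end IsPath

theorem length_steps (l : List ℕ) : (steps l).length = l.length - 1 := by
  induction l with
  | nil => simp [steps]
  | cons a t ih => cases t <;> simp_all [steps]

/-- The bridge to walks in the complete graph: the entries, lifted to `Fin v`, are distinct, so
consecutive ones are adjacent and the list is the support of a walk. All constructions can thus be
made with lists of natural numbers. -/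
theorem IsPath.hasLinearRealization {v : ℕ} {E : Multiset (ℕ × ℕ)} (h : IsPath v E)
    (hv : v ≠ 0) : HasLinearRealization v (E.map len) := by
  obtain ⟨l, hl, rfl⟩ := h
  have hlt : ∀ x ∈ l, x < v := fun x hx => List.mem_range.1 (hl.mem_iff.1 hx)
  have hnd : l.Nodup := hl.nodup_iff.2 List.nodup_range
  obtain ⟨m, rfl⟩ : ∃ m : List (Fin v), m.map Fin.val = l :=
    ⟨l.attach.map fun x => (⟨x.1, hlt x.1 x.2⟩ : Fin v), by
      simp [Function.comp_def]⟩
  have hne : m ≠ [] := by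
    rintro rfl
    have := hl.length_eq
    simp at this
    exact hv this.symm
  have hm : m.Nodup := List.Nodup.of_map _ hnd
  have hc : m.IsChain (⊤ : SimpleGraph (Fin v)).Adj :=
    (List.Pairwise.isChain hm).imp fun _ _ hab => by simpa using hab
  refine ⟨_, _, SimpleGraph.Walk.ofSupport m hne hc, fun a => ?_, ?_⟩
  · rw [SimpleGraph.Walk.support_ofSupport]
    refine List.count_eq_one_of_mem hm ?_
    have : (a : ℕ) ∈ m.map Fin.val := hl.mem_iff.2 (List.mem_range.2 a.2)
    simpa [Fin.val_inj] using this
  · clear hl hlt hnd hv hm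
    induction m with
    | nil => exact absurd rfl hne
    | cons a t ih =>
      cases t with
      | nil => simp [steps]
      | cons b t =>
        have := ih (by simp) hc.of_cons
        rw [SimpleGraph.Walk.ofSupport_cons_cons]
        simp only [List.map_cons, steps]
        rw [← Multiset.cons_coe (min _ _, _), Multiset.map_cons, ← List.map_cons, ← this]
        refine (congrArg _ (Multiset.cons_coe _ _).symm).trans ?_
        rw [Multiset.map_cons]
        refine congrArg (· ::ₘ _) ?_
        change Nat.dist (a : ℕ) (b : ℕ) = max (a : ℕ) b - min (a : ℕ) b
        simp only [Nat.dist]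
        omega

/-! ### Substituting paths for edges, and contracting edges -/

/-- Substitute paths for the edges of a path: the vertices are moved by `f`, and the vertices
`ins e` are put between the ends of the edge `e`. -/
def substList (f : ℕ → ℕ) (ins : ℕ × ℕ → List ℕ) : List ℕ → List ℕ
  | a :: b :: t =>
      f a :: ((if a ≤ b then ins (a, b) else (ins (b, a)).reverse) ++ substList f ins (b :: t))
  | [a] => [f a]
  | [] => []

theorem substList_eq_cons (f : ℕ → ℕ) (ins : ℕ × ℕ → List ℕ) (a : ℕ) (t : List ℕ) :
    ∃ m, substList f ins (a :: t) = f a :: m := by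
  cases t <;> simp [substList]

theorem coe_substList (f : ℕ → ℕ) (ins : ℕ × ℕ → List ℕ) (l : List ℕ) :
    (substList f ins l : Multiset ℕ) =
      (l : Multiset ℕ).map f + (steps l : Multiset (ℕ × ℕ)).bind fun e => (ins e : Multiset ℕ) := by
  induction l with
  | nil => simp [substList, steps]
  | cons a t ih =>
    cases t with
    | nil => simp [substList, steps]
    | cons b t =>
      simp only [substList, steps]
      rw [← Multiset.cons_coe, ← Multiset.coe_add, ih, ← Multiset.cons_coe a, Multiset.map_cons,
        ← Multiset.cons_coe (min a b, max a b), Multiset.cons_bind]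
      have : ((if a ≤ b then ins (a, b) else (ins (b, a)).reverse : List ℕ) : Multiset ℕ) =
          (ins (min a b, max a b) : Multiset ℕ) := by
        split_ifs with h
        · rw [min_eq_left h, max_eq_right h]
        · rw [min_eq_right (by omega), max_eq_left (by omega)]
          simp
      rw [this, ← Multiset.singleton_add, ← Multiset.singleton_add]
      abel

theorem steps_substList (f : ℕ → ℕ) (ins : ℕ × ℕ → List ℕ) (l : List ℕ) :
    (steps (substList f ins l) : Multiset (ℕ × ℕ)) =
      (steps l : Multiset (ℕ × ℕ)).bind
        fun e => (steps (f e.1 :: (ins e ++ [f e.2])) : Multiset (ℕ × ℕ)) := by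
  induction l with
  | nil => simp [substList, steps]
  | cons a t ih =>
    cases t with
    | nil => simp [substList, steps]
    | cons b t =>
      obtain ⟨m, hm⟩ := substList_eq_cons f ins b t
      simp only [substList, steps]
      rw [← Multiset.cons_coe (min a b, max a b), Multiset.cons_bind, ← ih, hm,
        ← List.cons_append, steps_append, ← Multiset.coe_add]
      congr 1
      split_ifs with h
      · rw [min_eq_left h, max_eq_right h]
        simp
      -- An edge that is traversed downwards receives its inserted vertices in reverse order;
      -- reversal only permutes the unoriented edges.
      · rw [min_eq_right (by omega), max_eq_left (by omega)]
        refine Multiset.coe_eq_coe.2 ?_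
        refine (steps_reverse _).symm.trans ?_
        simp

/-- Order plays no role in the hypothesis: it is enough that the moved and the inserted vertices
together make up `0, …, v' - 1`, each once. -/
theorem IsPath.subst {v v' : ℕ} {E : Multiset (ℕ × ℕ)} (h : IsPath v E) (f : ℕ → ℕ)
    (ins : ℕ × ℕ → List ℕ)
    (hv : (Multiset.range v).map f + E.bind (fun e => (ins e : Multiset ℕ)) = Multiset.range v') :
    IsPath v' (E.bind fun e => (steps (f e.1 :: (ins e ++ [f e.2])) : Multiset (ℕ × ℕ))) := by
  obtain ⟨l, hl, rfl⟩ := h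
  refine ⟨substList f ins l, ?_, steps_substList f ins l⟩
  rw [← Multiset.coe_eq_coe, coe_substList, Multiset.coe_eq_coe.2 hl]
  exact hv

/-- Contract the edges of a path whose ends have the same image under `f`. -/
def contractList (f : ℕ → ℕ) : List ℕ → List ℕ
  | a :: b :: t => if f a = f b then contractList f (b :: t) else f a :: contractList f (b :: t)
  | [a] => [f a]
  | [] => []

theorem contractList_eq_cons (f : ℕ → ℕ) (a : ℕ) (t : List ℕ) :
    ∃ m, contractList f (a :: t) = f a :: m := by
  induction t generalizing a with
  | nil => simp [contractList]
  | cons b t ih =>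
    obtain ⟨m, hm⟩ := ih b
    by_cases h : f a = f b <;> simp [contractList, h, hm]

theorem coe_contractList (f : ℕ → ℕ) (l : List ℕ) :
    (contractList f l : Multiset ℕ) +
      ((steps l : Multiset (ℕ × ℕ)).filter fun e => f e.1 = f e.2).map (fun e => f e.1) =
      (l : Multiset ℕ).map f := by
  induction l with
  | nil => simp [contractList, steps]
  | cons a t ih =>
    cases t with
    | nil => simp [contractList, steps]
    | cons b t =>
      have key : f (min a b) = f (max a b) ↔ f a = f b := by
        rcases le_total a b with h | h <;> simp [h, eq_comm]
      simp only [contractList, steps]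
      rw [← Multiset.cons_coe (min a b, max a b), ← Multiset.cons_coe a, Multiset.map_cons, ← ih]
      by_cases h : f a = f b
      · have h' : f (min a b) = f a := by
          rcases le_total a b with h2 | h2 <;> simp [h2, h]
        rw [if_pos h, Multiset.filter_cons_of_pos (p := fun e : ℕ × ℕ => f e.1 = f e.2) _ (key.2 h),
          Multiset.map_cons, Multiset.add_cons, h']
      · rw [if_neg h, Multiset.filter_cons_of_neg (p := fun e : ℕ × ℕ => f e.1 = f e.2) _
            (fun hh => h (key.1 hh)), ← Multiset.cons_coe, Multiset.cons_add]

theorem steps_contractList {f : ℕ → ℕ} (l : List ℕ) (hf : ∀ e ∈ steps l, f e.1 ≤ f e.2) :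
    (steps (contractList f l) : Multiset (ℕ × ℕ)) =
      ((steps l : Multiset (ℕ × ℕ)).filter fun e => ¬ f e.1 = f e.2).map
        fun e => (f e.1, f e.2) := by
  induction l with
  | nil => simp [contractList, steps]
  | cons a t ih =>
    cases t with
    | nil => simp [contractList, steps]
    | cons b t =>
      have key : f (min a b) = f (max a b) ↔ f a = f b := by
        rcases le_total a b with h | h <;> simp [h, eq_comm]
      obtain ⟨m, hm⟩ := contractList_eq_cons f b t
      have hab : f (min a b) ≤ f (max a b) := hf _ List.mem_cons_self
      have ih' := ih fun e he => hf e (List.mem_cons_of_mem _ he)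
      simp only [contractList, steps]
      rw [← Multiset.cons_coe (min a b, max a b)]
      by_cases h : f a = f b
      · rw [if_pos h, Multiset.filter_cons_of_neg _ (fun hh => hh (key.2 h)), ih']
      · rw [if_neg h, Multiset.filter_cons_of_pos _ (fun hh => h (key.1 hh)), Multiset.map_cons,
          ← ih', hm]
        rcases le_total a b with h2 | h2 <;> simp_all [steps]

/-- A contracted edge merges two neighbours with the same image and so accounts for one surplus copy
of that image; `hv` says that there are no other repetitions. Monotonicity on edges keeps the pairs
in the form (smaller end, larger end). -/
theorem IsPath.contract {v v' : ℕ} {E : Multiset (ℕ × ℕ)} (h : IsPath v E) {f : ℕ → ℕ}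
    (hf : ∀ e ∈ E, f e.1 ≤ f e.2)
    (hv : (Multiset.range v).map f =
      Multiset.range v' + (E.filter fun e => f e.1 = f e.2).map fun e => f e.1) :
    IsPath v' ((E.filter fun e => ¬ f e.1 = f e.2).map fun e => (f e.1, f e.2)) := by
  obtain ⟨l, hl, rfl⟩ := h
  refine ⟨contractList f l, ?_, steps_contractList l fun e he => hf e (Multiset.mem_coe.2 he)⟩
  rw [← Multiset.coe_eq_coe]
  refine add_right_cancel ((coe_contractList f l).trans ?_)
  rw [Multiset.coe_eq_coe.2 hl]
  exact hv


/-! ### Cuts: changing the number of edges of length `x` by multiples of `x` -/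

theorem eq_range_of_card {n : ℕ} {A : Multiset ℕ} (hc : A.card = n) (hm : ∀ i < n, i ∈ A) :
    A = Multiset.range n := by
  refine (Multiset.eq_of_le_of_card_le ?_ ?_).symm
  · exact (Multiset.le_iff_subset (Multiset.nodup_range n)).2 fun i hi =>
      hm i (Multiset.mem_range.1 hi)
  · simp [hc]

theorem bind_ite {α β : Type*} (s : Multiset α) (p : α → Prop) [DecidablePred p]
    (t : Multiset β) : (s.bind fun e => if p e then t else 0) = (s.filter p).card • t := by
  induction s using Multiset.induction with
  | empty => simp
  | cons a s ih =>
    by_cases h : p a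
    · simp [h, ih, add_smul, add_comm]
    · simp [h, ih]

/-- The edges in `E` that join vertices on both sides of `B + x` are the `x` edges
`(i, i + x)` with `B ≤ i < B + x`. -/
structure Cut (x B : ℕ) (E : Multiset (ℕ × ℕ)) : Prop where
  out : ∀ e ∈ E, e.1 < B + x → B + x ≤ e.2 → B ≤ e.1 ∧ e.2 = e.1 + x
  inn : ∀ i, B ≤ i → i < B + x → (i, i + x) ∈ E

namespace Cut

variable {v x B : ℕ} {E : Multiset (ℕ × ℕ)}

theorem filter_eq (hc : Cut x B E) (hE : E.Nodup) :
    E.filter (fun e => e.1 < B + x ∧ B + x ≤ e.2) =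
      (Multiset.range x).map fun i => (B + i, B + i + x) := by
  refine (Multiset.Nodup.ext (hE.filter _) ((Multiset.nodup_range x).map ?_)).2 ?_
  · intro i j hij
    simpa using hij
  · rintro ⟨i, j⟩
    simp only [Multiset.mem_filter, Multiset.mem_map, Multiset.mem_range, Prod.mk.injEq]
    constructor
    · rintro ⟨he, h1, h2⟩
      have := hc.out _ he h1 h2
      exact ⟨i - B, by grind⟩
    · rintro ⟨k, hk, rfl, rfl⟩
      exact ⟨hc.inn _ (by omega) (by omega), by omega, by omega⟩

theorem card_filter (hc : Cut x B E) (hE : E.Nodup) :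
    (E.filter (fun e => e.1 < B + x ∧ B + x ≤ e.2)).card = x := by
  simp [hc.filter_eq hE]

theorem le (hc : Cut x B E) (h : IsPath v E) (hx : 0 < x) : B + 2 * x ≤ v := by
  have := h.bounds (hc.inn (B + x - 1) (by omega) (by omega))
  grind

/-- Vertices from `B + x` on move up by `x`, and each crossing edge is led from `i` through the
freed vertex `i + x` to `i + 2 * x`. Every other edge lies on one side and keeps its length. The
first halves of the new routes form the same cut again, so growth can be repeated; lower cuts are
not touched. -/
theorem grow (hc : Cut x B E) (h : IsPath v E) (hx : 0 < x) :
    ∃ E', IsPath (v + x) E' ∧ E'.map len = E.map len + Multiset.replicate x x ∧ Cut x B E' ∧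
      ∀ x' B', B' + x' ≤ B → x' ≤ x → Cut x' B' E → Cut x' B' E' := by
  classical
  have hv := hc.le h hx
  set f : ℕ → ℕ := fun z => if z < B + x then z else z + x with hf
  set ins : ℕ × ℕ → List ℕ := fun e => if e.1 < B + x ∧ B + x ≤ e.2 then [e.1 + x] else []
    with hins
  have hst : ∀ d ∈ E, (steps (f d.1 :: (ins d ++ [f d.2])) : Multiset (ℕ × ℕ)) =
      if d.1 < B + x ∧ B + x ≤ d.2 then {(d.1, d.1 + x), (d.1 + x, d.1 + x + x)}
      else {(f d.1, f d.2)} := by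
    rintro ⟨i, j⟩ hd
    have hb := h.bounds hd
    have ho := hc.out _ hd
    simp only at hb ho
    simp only [hins]
    split_ifs with hcr
    · have hj := (ho hcr.1 hcr.2).2
      have e1 : f i = i := by simp only [hf]; split_ifs <;> omega
      have e2 : f j = i + x + x := by simp only [hf]; split_ifs <;> omega
      rw [e1, e2]
      simp [steps]
      rfl
    · have : f i ≤ f j := by simp only [hf]; split_ifs <;> omega
      simp [steps, this]
  have hmem : ∀ e, e ∈ (E.bind fun e => (steps (f e.1 :: (ins e ++ [f e.2])) :
      Multiset (ℕ × ℕ))) ↔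
      (∃ d ∈ E, ¬ (d.1 < B + x ∧ B + x ≤ d.2) ∧ e = (f d.1, f d.2)) ∨
      ∃ i, B ≤ i ∧ i < B + x ∧ (e = (i, i + x) ∨ e = (i + x, i + x + x)) := by
    intro e
    rw [Multiset.bind_congr hst, Multiset.mem_bind]
    constructor
    · rintro ⟨d, hd, he⟩
      split_ifs at he with hcr
      · exact .inr ⟨d.1, (hc.out d hd hcr.1 hcr.2).1, hcr.1, by simpa using he⟩
      · exact .inl ⟨d, hd, hcr, by simpa using he⟩
    · rintro (⟨d, hd, hcr, rfl⟩ | ⟨i, h1, h2, he⟩)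
      · exact ⟨d, hd, by simp [hcr]⟩
      · refine ⟨_, hc.inn i h1 h2, ?_⟩
        rw [if_pos (by simp only; omega)]
        simpa using he
  refine ⟨_, h.subst f ins ?_, ?_, ⟨fun e he h1 h2 => ?_, fun i h1 h2 => ?_⟩,
    fun x' B' hB hx' hc' => ⟨fun e he h1 h2 => ?_, fun i h1 h2 => ?_⟩⟩
  · refine eq_range_of_card ?_ fun i hi => ?_
    · have e1 : ∀ e ∈ E, (ins e : Multiset ℕ).card =
          (if e.1 < B + x ∧ B + x ≤ e.2 then ({0} : Multiset ℕ) else 0).card := by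
        intro e _
        simp only [hins]
        split_ifs <;> rfl
      have e2 := congrArg Multiset.card
        (bind_ite E (fun e => e.1 < B + x ∧ B + x ≤ e.2) ({0} : Multiset ℕ))
      rw [hc.card_filter h.nodup, Multiset.card_bind] at e2
      rw [Multiset.card_add, Multiset.card_map, Multiset.card_range, Multiset.card_bind]
      simp only [Function.comp_def] at e2 ⊢
      rw [Multiset.map_congr rfl e1, e2]
      simp
    · rw [Multiset.mem_add, Multiset.mem_map, Multiset.mem_bind]
      by_cases h1 : i < B + x
      · exact .inl ⟨i, Multiset.mem_range.2 (by omega), by simp [hf, h1]⟩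
      by_cases h2 : i < B + x + x
      · refine .inr ⟨_, hc.inn (i - x) (by omega) (by omega), ?_⟩
        simp only [hins]
        rw [if_pos (by omega)]
        simp
        omega
      · refine .inl ⟨i - x, Multiset.mem_range.2 (by omega), ?_⟩
        simp only [hf]
        rw [if_neg (by omega)]
        omega
  · rw [Multiset.bind_congr hst, Multiset.map_bind]
    have : ∀ e ∈ E, Multiset.map len (if e.1 < B + x ∧ B + x ≤ e.2 then
        {(e.1, e.1 + x), (e.1 + x, e.1 + x + x)} else {(f e.1, f e.2)}) =
        {len e} + if e.1 < B + x ∧ B + x ≤ e.2 then {x} else 0 := by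
      intro e he
      have hb := h.bounds he
      split_ifs with hcr
      · obtain ⟨h1, h2⟩ := hc.out e he hcr.1 hcr.2
        simp [len, h2]
      · simp only [hf, len, Multiset.map_singleton, add_zero]
        congr 1
        split_ifs <;> omega
    rw [Multiset.bind_congr this, Multiset.bind_add, bind_ite, hc.card_filter h.nodup,
      Multiset.bind_singleton, Multiset.nsmul_singleton]
  · rcases (hmem e).1 he with ⟨d, hd, hcr, rfl⟩ | ⟨i, h3, h4, rfl | rfl⟩
    · simp only [hf] at h1 h2
      split_ifs at h1 h2 <;> omega
    · exact ⟨h3, rfl⟩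
    · simp only at h1 h2 ⊢; omega
  · exact (hmem _).2 (.inr ⟨i, h1, h2, .inl rfl⟩)
  · rcases (hmem e).1 he with ⟨d, hd, hcr, rfl⟩ | ⟨i, h3, h4, rfl | rfl⟩
    · have := hc'.out d hd
      have hb := h.bounds hd
      simp only [hf] at h1 h2 ⊢
      split_ifs at h1 h2 ⊢ <;> omega
    · simp only at h1 h2 ⊢; omega
    · simp only at h1 h2 ⊢; omega
  · refine (hmem _).2 (.inl ⟨_, hc'.inn i h1 h2, ?_, ?_⟩)
    · simp only; omega
    · simp only [hf]
      split_ifs <;> first | rfl | omega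

/-- The reverse of growth: moving the vertices from `B + x` on down by `x` identifies the ends of
the crossing edges and of no others. The cut itself may be destroyed, so only lower cuts are claimed
to survive. -/
theorem shrink (hc : Cut x B E) (h : IsPath v E) (hx : 0 < x) :
    ∃ v' E', IsPath v' E' ∧ E'.map len + Multiset.replicate x x = E.map len ∧
      ∀ x' B', B' + x' ≤ B → x' ≤ x → Cut x' B' E → Cut x' B' E' := by
  have hv := hc.le h hx
  set f : ℕ → ℕ := fun z => if z < B + x then z else z - x with hf
  have hmono : ∀ e ∈ E, f e.1 ≤ f e.2 := by
    intro e he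
    have := h.bounds he
    have := hc.out e he
    simp only [hf]
    split_ifs <;> omega
  have hiff : ∀ e ∈ E, f e.1 = f e.2 ↔ e.1 < B + x ∧ B + x ≤ e.2 := by
    intro e he
    have := h.bounds he
    have := hc.out e he
    simp only [hf]
    split_ifs <;> omega
  have hfil : (E.filter fun e => f e.1 = f e.2) = (Multiset.range x).map
      fun i => (B + i, B + i + x) := by
    rw [Multiset.filter_congr hiff, hc.filter_eq h.nodup]
  have hmem : ∀ e, e ∈ ((E.filter fun e => ¬ f e.1 = f e.2).map fun e => (f e.1, f e.2)) ↔
      ∃ d ∈ E, ¬ (d.1 < B + x ∧ B + x ≤ d.2) ∧ e = (f d.1, f d.2) := by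
    intro e
    simp only [Multiset.mem_map, Multiset.mem_filter]
    constructor
    · rintro ⟨d, ⟨hd, hn⟩, rfl⟩
      exact ⟨d, hd, fun hh => hn ((hiff d hd).2 hh), rfl⟩
    · rintro ⟨d, hd, hn, rfl⟩
      exact ⟨d, ⟨hd, fun hh => hn ((hiff d hd).1 hh)⟩, rfl⟩
  refine ⟨v - x, _, h.contract hmono ?_, ?_,
    fun x' B' hB hx' hc' => ⟨fun e he h1 h2 => ?_, fun i h1 h2 => ?_⟩⟩
  · symm
    -- The middle block of `x` vertices consists of the upper ends of the crossing edges; its image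
    -- is the only part covered twice.
    obtain ⟨w, rfl⟩ : ∃ w, v = (B + x) + (x + w) := ⟨v - (B + x) - x, by omega⟩
    have e1 : (B + x) + (x + w) - x = (B + x) + w := by omega
    rw [e1, Multiset.range_add (B + x) (x + w), Multiset.range_add (B + x) w, hfil,
      Multiset.range_add x w]
    simp only [Multiset.map_add, Multiset.map_map, Function.comp_def]
    have e2 : (Multiset.range (B + x)).map f = Multiset.range (B + x) := by
      conv_rhs => rw [← Multiset.map_id (Multiset.range (B + x))]
      refine Multiset.map_congr rfl fun i hi => ?_
      simp [hf, Multiset.mem_range.1 hi]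
    have e3 : (Multiset.range x).map (fun i => f (B + x + i)) =
        (Multiset.range x).map (fun i => f (B + i)) := by
      refine Multiset.map_congr rfl fun i hi => ?_
      have := Multiset.mem_range.1 hi
      simp only [hf]
      split_ifs <;> omega
    have e4 : (Multiset.range w).map (fun i => f (B + x + (x + i))) =
        (Multiset.range w).map (fun i => B + x + i) := by
      refine Multiset.map_congr rfl fun i hi => ?_
      simp only [hf]
      split_ifs <;> omega
    rw [e2, e3, e4]
    abel
  · rw [Multiset.map_map]
    have e1 : ((E.filter fun e => ¬ f e.1 = f e.2).map (len ∘ fun e => (f e.1, f e.2))) =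
        (E.filter fun e => ¬ f e.1 = f e.2).map len := by
      refine Multiset.map_congr rfl fun e he => ?_
      obtain ⟨he, hn⟩ := Multiset.mem_filter.1 he
      rw [hiff e he] at hn
      have := h.bounds he
      simp only [Function.comp_apply, len, hf]
      split_ifs <;> omega
    have e2 : (E.filter fun e => f e.1 = f e.2).map len = Multiset.replicate x x := by
      rw [hfil, Multiset.map_map]
      simp [len, Function.comp_def]
    rw [e1, ← e2, ← Multiset.map_add, add_comm, Multiset.filter_add_not]
  · obtain ⟨d, hd, hcr, rfl⟩ := (hmem e).1 he
    have := hc'.out d hd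
    simp only [hf] at h1 h2 ⊢
    split_ifs at h1 h2 ⊢ <;> omega
  · refine (hmem _).2 ⟨_, hc'.inn i h1 h2, ?_, ?_⟩
    · simp only; omega
    · simp only [hf]
      split_ifs <;> first | rfl | omega

theorem iterate_grow (hc : Cut x B E) (h : IsPath v E) (hx : 0 < x) (n : ℕ) :
    ∃ v' E', IsPath v' E' ∧ E'.map len = E.map len + Multiset.replicate (n * x) x ∧ Cut x B E' ∧
      ∀ x' B', B' + x' ≤ B → x' ≤ x → Cut x' B' E → Cut x' B' E' := by
  induction n with
  | zero => exact ⟨v, E, h, by simp, hc, fun _ _ _ _ hc' => hc'⟩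
  | succ n ih =>
    obtain ⟨v₁, E₁, h₁, hl₁, hc₁, hp₁⟩ := ih
    obtain ⟨E₂, h₂, hl₂, hc₂, hp₂⟩ := hc₁.grow h₁ hx
    refine ⟨_, E₂, h₂, ?_, hc₂, fun x' B' hB hx' hc' => hp₂ x' B' hB hx' (hp₁ x' B' hB hx' hc')⟩
    rw [hl₂, hl₁, add_assoc, ← Multiset.replicate_add, Nat.succ_mul]

/-- Along a cut of width `x`, the number of edges of length `x` can be changed to any
number in the same residue class modulo `x`. -/
theorem resize (hc : Cut x B E) (h : IsPath v E) (hx : 0 < x) {L : Multiset ℕ}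
    (hL : E.map len = L + Multiset.replicate x x) (n : ℕ) :
    ∃ v' E', IsPath v' E' ∧ E'.map len = L + Multiset.replicate (n * x) x ∧
      ∀ x' B', B' + x' ≤ B → x' ≤ x → Cut x' B' E → Cut x' B' E' := by
  -- One batch of `x` edges is present at the start: to keep none, contract it; to have `n + 1`
  -- batches, grow `n` times.
  cases n with
  | zero =>
    obtain ⟨v', E', h', hl', hp'⟩ := hc.shrink h hx
    refine ⟨v', E', h', ?_, hp'⟩
    rw [hL] at hl'
    simpa using add_right_cancel hl'
  | succ n =>
    obtain ⟨v', E', h', hl', -, hp'⟩ := hc.iterate_grow h hx n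
    refine ⟨v', E', h', ?_, hp'⟩
    rw [hl', hL, add_assoc, ← Multiset.replicate_add]
    congr 2
    ring

end Cut


/-! ### Sites: replacing `y` by `y + 2 * s` -/

/-- The edges in `E` of length less than `y` that join vertices on both sides of `M` are the `s`
edges `(i, i + s)` with `i < M ≤ i + s`; none joins vertices on both sides of `M + y` or of
`M + 2 * y`. The other edges have length `y`, and their larger ends are at least `M`. -/
structure Site (y s M : ℕ) (E : Multiset (ℕ × ℕ)) : Prop where
  out : ∀ e ∈ E, (e.2 = e.1 + y ∧ M ≤ e.2) ∨
    (e.2 < e.1 + y ∧ (e.1 < M → M ≤ e.2 → M ≤ e.1 + s ∧ e.2 = e.1 + s) ∧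
      (e.1 < M + y → e.2 < M + y) ∧ (e.1 < M + 2 * y → e.2 < M + 2 * y))
  inn : ∀ i, M ≤ i + s → i < M → (i, i + s) ∈ E

/-- The new place of a vertex when `2 * s` columns are put in at `M`, `M + y` and `M + 2 * y`. -/
def spread (y s M z : ℕ) : ℕ :=
  if z < M then z else if z < M + y then z + 2 * s else if z < M + 2 * y then z + 4 * s
  else z + 6 * s

/-- The vertices that are put between the ends of the edge `(u, u + s)` at a site; `t` tells
whether the columns at the site have three vertices or two. -/
def detour (y s : ℕ) (t : Bool) (u : ℕ) : List ℕ :=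
  [u + s, u + s + (y + 2 * s)] ++
    (if t then [u + s + 2 * (y + 2 * s), u + 2 * s + 2 * (y + 2 * s)] else []) ++
    [u + 2 * s + (y + 2 * s), u + 2 * s]

/-- The edges that replace the edge `(u, u + s)` at a site. -/
def detourSteps (y s : ℕ) (t : Bool) (u : ℕ) : List (ℕ × ℕ) :=
  [(u, u + s), (u + s, u + s + (y + 2 * s))] ++
    (if t then [(u + s + (y + 2 * s), u + s + 2 * (y + 2 * s)),
      (u + s + 2 * (y + 2 * s), u + 2 * s + 2 * (y + 2 * s)),
      (u + 2 * s + (y + 2 * s), u + 2 * s + 2 * (y + 2 * s))]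
    else [(u + s + (y + 2 * s), u + 2 * s + (y + 2 * s))]) ++
    [(u + 2 * s, u + 2 * s + (y + 2 * s)), (u + 2 * s, u + 3 * s)]

/-- The edges of `E'` are the edges of `E` with their ends moved by `spread y s M`, except that
the edges of length `s` at the site `M` have been replaced by detours through the new columns. -/
def Grown (y s M : ℕ) (t : Bool) (E E' : Multiset (ℕ × ℕ)) : Prop :=
  ∀ e, e ∈ E' ↔
    (∃ d ∈ E, ¬ (d.1 < M ∧ M ≤ d.2 ∧ d.2 = d.1 + s) ∧
      e = (spread y s M d.1, spread y s M d.2)) ∨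
    ∃ u, M ≤ u + s ∧ u < M ∧ e ∈ detourSteps y s t u

namespace Site

variable {v y s M : ℕ} {E : Multiset (ℕ × ℕ)}

theorem card_filter (hs : Site y s M E) (hE : E.Nodup) (hM : s ≤ M) :
    (E.filter (fun e => e.1 < M ∧ M ≤ e.2 ∧ e.2 = e.1 + s)).card = s := by
  have : E.filter (fun e => e.1 < M ∧ M ≤ e.2 ∧ e.2 = e.1 + s) =
      (Multiset.range s).map fun i => (M - s + i, M + i) := by
    refine (Multiset.Nodup.ext (hE.filter _) ((Multiset.nodup_range s).map ?_)).2 ?_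
    · intro i j hij
      simpa using hij
    · rintro ⟨i, j⟩
      simp only [Multiset.mem_filter, Multiset.mem_map, Multiset.mem_range, Prod.mk.injEq]
      constructor
      · rintro ⟨he, h1, h2, h3⟩
        exact ⟨j - M, by omega⟩
      · rintro ⟨k, hk, rfl, rfl⟩
        have := hs.inn (M - s + k) (by omega) (by omega)
        rw [show M - s + k + s = M + k by omega] at this
        exact ⟨this, by omega, by omega, by omega⟩
  simp [this]

theorem steps_detour (y s : ℕ) (t : Bool) (u : ℕ) :
    steps (u :: (detour y s t u ++ [u + 3 * s])) = detourSteps y s t u := by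
  cases t <;> simp [detour, detourSteps, steps] <;> omega

theorem map_len_detourSteps (y s : ℕ) (t : Bool) (u : ℕ) :
    (detourSteps y s t u : Multiset (ℕ × ℕ)).map len = {s} +
      (Multiset.replicate 2 s + Multiset.replicate (if t then 4 else 2) (y + 2 * s)) := by
  have e : ∀ a b c : ℕ, a + c = b → len (a, b) = c := fun a b c h => by simp only [len]; omega
  cases t
  · simp only [detourSteps, Multiset.map_coe, List.map_cons, List.map_nil,
      Bool.false_eq_true, if_false, List.cons_append, List.nil_append]
    rw [e _ _ s (by omega), e _ _ (y + 2 * s) (by omega), e _ _ s (by omega),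
      e _ _ (y + 2 * s) (by omega), e _ _ s (by omega)]
    simp only [← Multiset.cons_coe, Multiset.coe_nil, Multiset.replicate_succ,
      Multiset.replicate_zero, ← Multiset.singleton_add]
    abel
  · simp only [detourSteps, Multiset.map_coe, List.map_cons, List.map_nil,
      if_true, List.cons_append, List.nil_append]
    rw [e _ _ s (by omega), e _ _ (y + 2 * s) (by omega), e _ _ (y + 2 * s) (by omega),
      e _ _ s (by omega), e _ _ (y + 2 * s) (by omega), e _ _ (y + 2 * s) (by omega),
      e _ _ s (by omega)]
    simp only [← Multiset.cons_coe, Multiset.coe_nil, Multiset.replicate_succ,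
      Multiset.replicate_zero, ← Multiset.singleton_add]
    abel

/-- An edge of length `y` joins a vertex to the one below it in the next row, or a vertex before `M`
to one in the first row, so widening the rows by `2 * s` lengthens it by `2 * s`. The other edges do
not pass from row to row and keep their lengths, except that those across `M` become detours through
the new columns. The bounds on `v` ensure that columns of the chosen height leave no gap in the
vertex set. -/
theorem grow (hs : Site y s M E) (h : IsPath v E) (hM : s ≤ M) (hs0 : 0 < s) (hy : s < y)
    (t : Bool) (hv₁ : (if t then M + 2 * y else M + y) ≤ v)
    (hv₂ : v ≤ (if t then M + 3 * y else M + 2 * y)) :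
    ∃ E', IsPath (v + (if t then 6 * s else 4 * s)) E' ∧
      E'.map len = (E.map len).map (fun z => if z = y then y + 2 * s else z) +
        s • (Multiset.replicate 2 s + Multiset.replicate (if t then 4 else 2) (y + 2 * s)) ∧
      Grown y s M t E E' := by
  classical
  have hv₃ : v ≤ M + 3 * y := by cases t <;> simp at hv₂ <;> omega
  set f : ℕ → ℕ := spread y s M with hf
  set ins : ℕ × ℕ → List ℕ := fun e =>
    if e.1 < M ∧ M ≤ e.2 ∧ e.2 = e.1 + s then detour y s t e.1 else [] with hins
  have hst : ∀ d ∈ E, (steps (f d.1 :: (ins d ++ [f d.2])) : Multiset (ℕ × ℕ)) =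
      if d.1 < M ∧ M ≤ d.2 ∧ d.2 = d.1 + s then (detourSteps y s t d.1 : Multiset (ℕ × ℕ))
      else {(f d.1, f d.2)} := by
    rintro ⟨i, j⟩ hd
    have hb := h.bounds hd
    simp only at hb
    simp only [hins]
    split_ifs with hcr
    · have e1 : f i = i := by simp only [hf, spread]; split_ifs <;> omega
      have e2 : f j = i + 3 * s := by simp only [hf, spread]; split_ifs <;> omega
      rw [e1, e2]
      rw [steps_detour]
    · have : f i ≤ f j := by simp only [hf, spread]; split_ifs <;> omega
      simp [steps, this]
  refine ⟨_, h.subst f ins ?_, ?_, fun e => ?_⟩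
  · refine eq_range_of_card ?_ fun i hi => ?_
    · have e1 : ∀ e ∈ E, (ins e : Multiset ℕ).card =
          (if e.1 < M ∧ M ≤ e.2 ∧ e.2 = e.1 + s then
            (Multiset.replicate (if t then 6 else 4) 0 : Multiset ℕ) else 0).card := by
        intro e _
        simp only [hins]
        split_ifs <;> simp [detour, *]
      have e2 := congrArg Multiset.card
        (bind_ite E (fun e => e.1 < M ∧ M ≤ e.2 ∧ e.2 = e.1 + s)
          (Multiset.replicate (if t then 6 else 4) 0 : Multiset ℕ))
      rw [hs.card_filter h.nodup hM, Multiset.card_bind] at e2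
      rw [Multiset.card_add, Multiset.card_map, Multiset.card_range, Multiset.card_bind]
      simp only [Function.comp_def] at e2 ⊢
      rw [Multiset.map_congr rfl e1, e2]
      cases t <;> simp [mul_comm]
    · have old : ∀ z < v, f z = i → i ∈ (Multiset.range v).map f + E.bind
          (fun e => (ins e : Multiset ℕ)) := fun z hz hzi =>
        Multiset.mem_add.2 (.inl (Multiset.mem_map.2 ⟨z, Multiset.mem_range.2 hz, hzi⟩))
      have new : ∀ u, M ≤ u + s → u < M → i ∈ detour y s t u → i ∈ (Multiset.range v).map f +
          E.bind (fun e => (ins e : Multiset ℕ)) := fun u h1 h2 hu =>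
        Multiset.mem_add.2 (.inr (Multiset.mem_bind.2 ⟨_, hs.inn u h1 h2, by
          simp only [hins]
          rw [if_pos ⟨h2, h1, trivial⟩]
          simpa using hu⟩))
      have hfi : ∀ k z, z + k = i → (z < M ∧ k = 0 ∨ M ≤ z ∧ z < M + y ∧ k = 2 * s ∨
          M + y ≤ z ∧ z < M + 2 * y ∧ k = 4 * s ∨ M + 2 * y ≤ z ∧ k = 6 * s) → f z = i := by
        intro k z hz hk
        simp only [hf, spread]
        split_ifs <;> omega
      -- Locate `i` in the new arrangement: each widened row begins with `s` vertices on the way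
      -- down and `s` on the way up, followed by the old row.
      rcases lt_or_ge i M with h1 | h1
      · exact old i (by cases t <;> simp at hv₁ <;> omega) (hfi 0 i rfl (by omega))
      rcases lt_or_ge i (M + s) with h2 | h2
      · exact new (i - s) (by omega) (by omega) (by simp [detour]; omega)
      rcases lt_or_ge i (M + 2 * s) with h3 | h3
      · exact new (i - 2 * s) (by omega) (by omega) (by simp [detour]; omega)
      rcases lt_or_ge i (M + (y + 2 * s)) with h4 | h4
      · exact old (i - 2 * s) (by cases t <;> simp at hv₁ <;> omega)
          (hfi (2 * s) _ (by omega) (by omega))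
      rcases lt_or_ge i (M + s + (y + 2 * s)) with h5 | h5
      · exact new (i - s - (y + 2 * s)) (by omega) (by omega) (by simp [detour]; omega)
      rcases lt_or_ge i (M + 2 * s + (y + 2 * s)) with h6 | h6
      · exact new (i - 2 * s - (y + 2 * s)) (by omega) (by omega) (by simp [detour]; omega)
      cases t
      · simp only [Bool.false_eq_true, if_false] at hi hv₁ hv₂
        exact old (i - 4 * s) (by omega) (hfi (4 * s) _ (by omega) (by omega))
      · simp only [if_true] at hi hv₁ hv₂
        rcases lt_or_ge i (M + 2 * (y + 2 * s)) with h7 | h7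
        · exact old (i - 4 * s) (by omega) (hfi (4 * s) _ (by omega) (by omega))
        rcases lt_or_ge i (M + s + 2 * (y + 2 * s)) with h8 | h8
        · exact new (i - s - 2 * (y + 2 * s)) (by omega) (by omega) (by simp [detour]; omega)
        rcases lt_or_ge i (M + 2 * s + 2 * (y + 2 * s)) with h9 | h9
        · exact new (i - 2 * s - 2 * (y + 2 * s)) (by omega) (by omega) (by simp [detour]; omega)
        exact old (i - 6 * s) (by omega) (hfi (6 * s) _ (by omega) (by omega))
  · rw [Multiset.bind_congr hst, Multiset.map_bind]
    have : ∀ e ∈ E, Multiset.map len (if e.1 < M ∧ M ≤ e.2 ∧ e.2 = e.1 + s then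
        (detourSteps y s t e.1 : Multiset (ℕ × ℕ)) else {(f e.1, f e.2)}) =
        {if len e = y then y + 2 * s else len e} +
          if e.1 < M ∧ M ≤ e.2 ∧ e.2 = e.1 + s then
            Multiset.replicate 2 s + Multiset.replicate (if t then 4 else 2) (y + 2 * s)
          else 0 := by
      intro e he
      have hb := h.bounds he
      have ho := hs.out e he
      by_cases hcr : e.1 < M ∧ M ≤ e.2 ∧ e.2 = e.1 + s
      · have e1 : len e = s := by simp only [len]; omega
        rw [if_pos hcr, if_pos hcr, map_len_detourSteps, e1, if_neg (show ¬ s = y by omega)]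
      · rw [if_neg hcr, if_neg hcr, Multiset.map_singleton, add_zero]
        congr 1
        rcases ho with ⟨h1, h2⟩ | ⟨h1, h2⟩
        · rw [if_pos (by simp only [len]; omega)]
          simp only [hf, len, spread]
          split_ifs <;> omega
        · rw [if_neg (by simp only [len]; omega)]
          simp only [hf, len, spread]
          split_ifs <;> omega
    rw [Multiset.bind_congr this, Multiset.bind_add, bind_ite,
      hs.card_filter h.nodup hM, Multiset.bind_singleton, Multiset.map_map]
    rfl
  · rw [Multiset.bind_congr hst, Multiset.mem_bind]
    constructor
    · rintro ⟨d, hd, he⟩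
      split_ifs at he with hcr
      · exact .inr ⟨d.1, by omega, hcr.1, by simpa using he⟩
      · exact .inl ⟨d, hd, hcr, by simpa using he⟩
    · rintro (⟨d, hd, hcr, rfl⟩ | ⟨u, h1, h2, he⟩)
      · exact ⟨d, hd, by simp [hcr, hf]⟩
      · refine ⟨_, hs.inn u h1 h2, ?_⟩
        rw [if_pos ⟨h2, h1, rfl⟩]
        simpa using he

end Site


/-! ### Cuts and sites that survive growth at a site -/

theorem mem_detourSteps {y s u : ℕ} {t : Bool} {e : ℕ × ℕ} :
    e ∈ detourSteps y s t u ↔ e = (u, u + s) ∨ e = (u + s, u + s + (y + 2 * s)) ∨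
      e = (u + 2 * s, u + 2 * s + (y + 2 * s)) ∨ e = (u + 2 * s, u + 3 * s) ∨
      (t = false ∧ e = (u + s + (y + 2 * s), u + 2 * s + (y + 2 * s))) ∨
      (t = true ∧ (e = (u + s + (y + 2 * s), u + s + 2 * (y + 2 * s)) ∨
        e = (u + s + 2 * (y + 2 * s), u + 2 * s + 2 * (y + 2 * s)) ∨
        e = (u + 2 * s + (y + 2 * s), u + 2 * s + 2 * (y + 2 * s)))) := by
  cases t <;> simp [detourSteps] <;> tauto

namespace Grown

variable {v y s M x B N r : ℕ} {t : Bool} {E E' : Multiset (ℕ × ℕ)}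

/-- A short edge across `M` starts at `M - s` or later, whereas the edges of the cut start before `B
+ x ≤ M - s`; so the latter end before `M` and do not move. -/
theorem cut_low (hg : Grown y s M t E E') (hs : Site y s M E) (hB : B + x + s ≤ M) (hx : x < y)
    (hc : Cut x B E) : Cut x B E' := by
  refine ⟨fun e he h1 h2 => ?_, fun i h1 h2 => (hg _).2 (.inl ⟨_, hc.inn i h1 h2, ?_, ?_⟩)⟩
  · rcases (hg e).1 he with ⟨d, hd, hn, rfl⟩ | ⟨u, h3, h4, h5⟩
    · have hd1 := hc.out d hd
      have hd2 := hs.out d hd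
      simp only [spread] at h1 h2 ⊢
      split_ifs at h1 h2 ⊢ <;> omega
    · rcases mem_detourSteps.1 h5 with rfl | rfl | rfl | rfl | ⟨-, rfl⟩ | ⟨-, rfl | rfl | rfl⟩ <;>
        simp only at h1 h2 <;> omega
  · have := hs.out _ (hc.inn i h1 h2)
    simp only at this ⊢
    omega
  · have := hs.out _ (hc.inn i h1 h2)
    simp only at this
    simp only [spread, Prod.mk.injEq]
    split_ifs <;> omega

/-- As `M ≤ B + y ≤ M + y`, the crossing point moves up by `2 * s`, as much as the width grows. The
`2 * s` additional edges that the wider cut needs are the first vertical edges on the way down and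
the last on the way up, which the detours contain for both heights. -/
theorem cut (hg : Grown y s M t E E') (hs : Site y s M E) (hsM : s ≤ M) (hy : s < y)
    (hB : B ≤ M) (hB' : M ≤ B + y) (hc : Cut y B E) : Cut (y + 2 * s) B E' := by
  refine ⟨fun e he h1 h2 => ?_, fun i h1 h2 => ?_⟩
  · rcases (hg e).1 he with ⟨d, hd, hn, rfl⟩ | ⟨u, h3, h4, h5⟩
    · have hd1 := hc.out d hd
      have hd2 := hs.out d hd
      simp only [spread] at h1 h2 ⊢
      split_ifs at h1 h2 ⊢ <;> omega
    · have := hc.out _ (hs.inn u h3 h4)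
      simp only at this
      rcases mem_detourSteps.1 h5 with rfl | rfl | rfl | rfl | ⟨-, rfl⟩ | ⟨-, rfl | rfl | rfl⟩ <;>
        simp only [and_true] at h1 h2 ⊢ <;> omega
  · rcases lt_or_ge i M with h3 | h3
    · refine (hg _).2 (.inl ⟨_, hc.inn i h1 (by omega), by simp only; omega, ?_⟩)
      simp only [spread, Prod.mk.injEq]
      split_ifs <;> omega
    rcases lt_or_ge i (M + s) with h4 | h4
    · refine (hg _).2 (.inr ⟨i - s, by omega, by omega, mem_detourSteps.2 (.inr (.inl ?_))⟩)
      rw [show i - s + s = i by omega]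
    rcases lt_or_ge i (M + 2 * s) with h5 | h5
    · refine (hg _).2 (.inr ⟨i - 2 * s, by omega, by omega,
        mem_detourSteps.2 (.inr (.inr (.inl ?_)))⟩)
      rw [show i - 2 * s + 2 * s = i by omega]
    · refine (hg _).2 (.inl ⟨_, hc.inn (i - 2 * s) (by omega) (by omega), by simp only; omega, ?_⟩)
      simp only [spread, Prod.mk.injEq]
      split_ifs <;> omega

/-- Each detour begins with the edge `(u, u + s)`, and its other short edges stay inside a row. The
site is therefore reproduced at the same place, and growth can be iterated. -/
theorem site (hg : Grown y s M t E E') (hs : Site y s M E) (h : IsPath v E) (hv : v ≤ M + 3 * y)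
    (hy : s < y) : Site (y + 2 * s) s M E' := by
  refine ⟨fun e he => ?_, fun i h1 h2 => (hg _).2 (.inr ⟨i, h1, h2, mem_detourSteps.2 (.inl rfl)⟩)⟩
  rcases (hg e).1 he with ⟨d, hd, hn, rfl⟩ | ⟨u, h3, h4, h5⟩
  · have hd2 := hs.out d hd
    have hb := h.bounds hd
    simp only [spread]
    split_ifs <;> omega
  · rcases mem_detourSteps.1 h5 with rfl | rfl | rfl | rfl | ⟨-, rfl⟩ | ⟨-, rfl | rfl | rfl⟩ <;>
      simp only [true_and, and_true] <;> omega

/-- Because `M` lies between `N + s` and `N + y`, the columns put in at `M`, `M + y` and `M + 2 * y`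
fall one into each of the rows that start at `N`, `N + y` and `N + 2 * y`; the short edges across
`N` stay before `M`. This allows growth at sites of both widths in the same path. -/
theorem site_low (hg : Grown y s M t E E') (hs : Site y s M E) (h : IsPath v E)
    (hv : v ≤ M + 3 * y) (hy : s < y) (hr : r < y) (hN : N + s ≤ M) (hN' : M ≤ N + y)
    (hs' : Site y r N E) : Site (y + 2 * s) r N E' := by
  refine ⟨fun e he => ?_, fun i h1 h2 => (hg _).2 (.inl ⟨_, hs'.inn i h1 h2, ?_, ?_⟩)⟩
  · rcases (hg e).1 he with ⟨d, hd, hn, rfl⟩ | ⟨u, h3, h4, h5⟩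
    · have hd1 := hs'.out d hd
      have hd2 := hs.out d hd
      have hb := h.bounds hd
      simp only [spread]
      split_ifs <;> omega
    · have := hs'.out _ (hs.inn u h3 h4)
      simp only at this
      rcases mem_detourSteps.1 h5 with rfl | rfl | rfl | rfl | ⟨-, rfl⟩ | ⟨-, rfl | rfl | rfl⟩ <;>
        simp only [true_and] <;> omega
  · have := hs.out _ (hs'.inn i h1 h2)
    simp only at this ⊢
    omega
  · have := hs.out _ (hs'.inn i h1 h2)
    simp only at this
    simp only [spread, Prod.mk.injEq]
    split_ifs <;> omega

end Grown


/-! ### Iterated growth, with the cuts and lower sites carried along -/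

theorem count_tripleMultiset (z a x b y c : ℕ) : (tripleMultiset a x b y c).count z =
    (if 1 = z then a else 0) + (if x = z then b else 0) + (if y = z then c else 0) := by
  simp [tripleMultiset, Multiset.count_replicate]

theorem card_tripleMultiset (a x b y c : ℕ) : (tripleMultiset a x b y c).card = a + b + c := by
  simp [tripleMultiset]

/-- A path with edge lengths `1`, `3` and `y` that can be enlarged at a site of width `s`, and
along a cut of width `y` and the cuts in the list `lows`. The widths of the sites in the list `sites`,
which are lower, are `1`. -/
structure Frame (s y a b c R M v : ℕ) (lows : List (ℕ × ℕ)) (sites : List ℕ)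
    (E : Multiset (ℕ × ℕ)) : Prop where
  path : IsPath v E
  lens : E.map len = tripleMultiset a 3 b y c
  low : ∀ p ∈ lows, Cut p.1 p.2 E ∧ p.2 + p.1 + s ≤ M ∧ p.1 < y
  top : Cut y R E
  site : Site y s M E
  site_low : ∀ N ∈ sites, Site y 1 N E ∧ N + s ≤ M ∧ M ≤ N + y
  width : s = 1 ∨ s = 3
  le : s ≤ M
  lt : 3 < y
  top_le : R ≤ M
  le_top : M ≤ R + y

/-- The bounds on the number of vertices under which new columns at the site `M` have three
vertices (if `t` is true) or two vertices (otherwise). -/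
def Fits (t : Bool) (y M v : ℕ) : Prop :=
  (if t then M + 2 * y else M + y) ≤ v ∧ v ≤ if t then M + 3 * y else M + 2 * y

instance (t : Bool) (y M v : ℕ) : Decidable (Fits t y M v) :=
  inferInstanceAs (Decidable (_ ∧ _))

namespace Frame

variable {s y a b c R M v : ℕ} {lows : List (ℕ × ℕ)} {sites : List ℕ} {E : Multiset (ℕ × ℕ)}

theorem step (hF : Frame s y a b c R M v lows sites E) (t : Bool) (ht : Fits t y M v) :
    ∃ E', Frame s (y + 2 * s) (a + if s = 1 then 2 else 0) (b + if s = 3 then 6 else 0)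
      (c + s * if t then 4 else 2) R M (v + if t then 6 * s else 4 * s) lows sites E' := by
  have hw := hF.width
  have hlt := hF.lt
  have hs : s < y := by omega
  have hv : v ≤ M + 3 * y := by
    have := ht.2
    cases t <;> simp at this <;> omega
  obtain ⟨E', hp, hl, hg⟩ := hF.site.grow hF.path hF.le (by omega) hs t ht.1 ht.2
  refine ⟨E', hp, ?_, fun p hp => ?_, hg.cut hF.site hF.le hs hF.top_le hF.le_top hF.top,
    hg.site hF.site hF.path hv hs, fun N hN => ?_, hw, hF.le, by omega, hF.top_le, ?_⟩
  · have e1 : (tripleMultiset a 3 b y c).map (fun z => if z = y then y + 2 * s else z) =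
        tripleMultiset a 3 b (y + 2 * s) c := by
      simp only [tripleMultiset, Multiset.map_add, Multiset.map_replicate, if_true]
      rw [if_neg (by omega), if_neg (by omega)]
    rw [hl, hF.lens, e1]
    ext z
    simp only [count_tripleMultiset, Multiset.count_add, Multiset.count_nsmul,
      Multiset.count_replicate]
    rcases hw with rfl | rfl <;> cases t <;> simp <;> split_ifs <;> omega
  · obtain ⟨h1, h2, h3⟩ := hF.low p hp
    exact ⟨hg.cut_low hF.site h2 h3 h1, h2, by omega⟩
  · obtain ⟨h1, h2, h3⟩ := hF.site_low N hN
    exact ⟨hg.site_low hF.site hF.path hv hs (by omega) h2 h3 h1, h2, by omega⟩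
  · have := hF.le_top
    omega

theorem iterate (hF : Frame s y a b c R M v lows sites E) (t : Bool) (ht : Fits t y M v) (n : ℕ) :
    ∃ E', Frame s (y + 2 * s * n) (a + if s = 1 then 2 * n else 0)
      (b + if s = 3 then 6 * n else 0) (c + s * (if t then 4 else 2) * n) R M
      (v + (if t then 6 * s else 4 * s) * n) lows sites E' := by
  induction n with
  | zero => exact ⟨E, by simpa using hF⟩
  | succ n ih =>
    obtain ⟨E', hF'⟩ := ih
    -- `Fits` is inherited: in each step `v` grows by exactly as much as its upper bound and by at
    -- least as much as its lower bound.
    obtain ⟨E'', hF''⟩ := hF'.step t (by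
      obtain ⟨h1, h2⟩ := ht
      have e : s * n = s * n := rfl
      generalize hk : s * n = k at e
      cases t <;> simp only [Fits, mul_assoc, if_true, Bool.false_eq_true, if_false, hk]
        at h1 h2 ⊢ <;> omega)
    refine ⟨E'', ?_⟩
    convert hF'' using 1
    · ring
    · split_ifs <;> ring
    · split_ifs <;> ring
    · ring
    · ring

end Frame

/-! ### From paths with cuts to linear realizations -/

/-- A path with edge lengths `1`, `3` and `y` that can be enlarged along a cut of width `y` and
the cuts in the list `lows`. -/
def Ready (lows : List (ℕ × ℕ)) (y a b c : ℕ) : Prop :=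
  ∃ (v R : ℕ) (E : Multiset (ℕ × ℕ)), IsPath v E ∧ E.map len = tripleMultiset a 3 b y c ∧
    (∀ p ∈ lows, Cut p.1 p.2 E ∧ p.2 + p.1 ≤ R) ∧ Cut y R E

theorem IsPath.hasLinearRealization_of_map_len {v : ℕ} {E : Multiset (ℕ × ℕ)}
    {K : Multiset ℕ} (h : IsPath v E) (hK : E.map len = K) (hc : K.card ≠ 0) {w : ℕ}
    (hw : K.card + 1 = w) : HasLinearRealization w K := by
  have hcard : E.card = v - 1 := by
    obtain ⟨l, hl, rfl⟩ := h
    simp [length_steps, hl.length_eq]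
  have : K.card = v - 1 := by rw [← hK, Multiset.card_map, hcard]
  -- The truncated difference `v - 1` is nonzero by `hc`, which rules out `v = 0`.
  obtain rfl : v = w := by omega
  exact hK ▸ h.hasLinearRealization (by omega)

/-- The version for paths without a cut of width `3`, where `b` has to be exact from the start. -/
theorem Ready.hasLinearRealization_flat {y a b c : ℕ} (h : Ready [(1, 0)] y (a + 1) b (c + y))
    (hy : 0 < y) (n m v : ℕ) (ha : a ≠ 0) (hv : a + n + b + (c + m * y) + 1 = v) :
    HasLinearRealization v (tripleMultiset (a + n) 3 b y (c + m * y)) := by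
  obtain ⟨v₀, R, E, hp, hl, hlow, hR⟩ := h
  obtain ⟨v₁, E₁, hp₁, hl₁, hc₁⟩ := hR.resize hp hy (L := tripleMultiset (a + 1) 3 b y c)
    (by rw [hl]; simp only [tripleMultiset, Multiset.replicate_add]; abel) m
  obtain ⟨v₂, E₂, hp₂, hl₂, -⟩ := (hc₁ 1 0 (by simpa using (hlow (1, 0) (by simp)).2) (by omega)
    (hlow (1, 0) (by simp)).1).resize hp₁ one_pos (L := tripleMultiset a 3 b y (c + m * y))
    (by rw [hl₁]; simp only [tripleMultiset, Multiset.replicate_add]; abel) n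
  refine hp₂.hasLinearRealization_of_map_len ?_ ?_ ?_
  · rw [hl₂]
    simp only [tripleMultiset, Multiset.replicate_add, mul_one]
    abel
  · rw [card_tripleMultiset]; omega
  · rw [card_tripleMultiset]; omega

/-- The cuts are resized from the top down, since a change at a cut preserves only those below it.
The surplus in `a + 1`, `b + 3` and `c + y` is the batch at each cut that resizing may remove, so
that `n`, `k` and `m` may be `0`. -/
theorem Ready.hasLinearRealization {C y a b c : ℕ}
    (h : Ready [(1, 0), (3, C)] y (a + 1) (b + 3) (c + y)) (hC : 1 ≤ C)
    (hy : 3 < y) (n k m v : ℕ) (ha : a ≠ 0) (hv : a + n + (b + k * 3) + (c + m * y) + 1 = v) :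
    HasLinearRealization v (tripleMultiset (a + n) 3 (b + k * 3) y (c + m * y)) := by
  obtain ⟨v₀, R, E, hp, hl, hlow, hR⟩ := h
  have h1 := hlow (1, 0) (by simp)
  have h3 := hlow (3, C) (by simp)
  obtain ⟨v₁, E₁, hp₁, hl₁, hc₁⟩ := hR.resize hp (by omega)
    (L := tripleMultiset (a + 1) 3 (b + 3) y c)
    (by rw [hl]; simp only [tripleMultiset, Multiset.replicate_add]; abel) m
  obtain ⟨v₂, E₂, hp₂, hl₂, hc₂⟩ := (hc₁ 3 C h3.2 (by omega) h3.1).resize hp₁ (by omega)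
    (L := tripleMultiset (a + 1) 3 b y (c + m * y))
    (by rw [hl₁]; simp only [tripleMultiset, Multiset.replicate_add]; abel) k
  obtain ⟨v₃, E₃, hp₃, hl₃, -⟩ := (hc₂ 1 0 hC (by omega)
    (hc₁ 1 0 h1.2 (by omega) h1.1)).resize hp₂ one_pos
    (L := tripleMultiset a 3 (b + k * 3) y (c + m * y))
    (by rw [hl₂]; simp only [tripleMultiset, Multiset.replicate_add]; abel) n
  refine hp₃.hasLinearRealization_of_map_len ?_ ?_ ?_
  · rw [hl₃]
    simp only [tripleMultiset, Multiset.replicate_add, mul_one]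
    abel
  · rw [card_tripleMultiset]; omega
  · rw [card_tripleMultiset]; omega


/-! ### Decidable versions of the conditions on paths -/

/-- The number whose binary digits `1` are at the places given by the entries of a list. -/
def mask : List ℕ → ℕ
  | [] => 0
  | x :: t => 2 ^ x ||| mask t

theorem testBit_mask {l : List ℕ} {i : ℕ} : (mask l).testBit i = true ↔ i ∈ l := by
  induction l with
  | nil => simp [mask]
  | cons x t ih =>
    simp only [mask, Nat.testBit_or, Bool.or_eq_true, Nat.testBit_two_pow, decide_eq_true_eq, ih,
      List.mem_cons, @eq_comm _ x i]

/-- Every edge `(i, i + x)` with `B ≤ i < B + x` is in the list. -/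
def EdgesFrom (x B : ℕ) (E : List (ℕ × ℕ)) : Prop :=
  (mask ((E.filter fun e => e.2 = e.1 + x).map Prod.fst) >>> B) % 2 ^ x = 2 ^ x - 1

theorem EdgesFrom.mem {x B i : ℕ} {E : List (ℕ × ℕ)} (h : EdgesFrom x B E) (h1 : B ≤ i)
    (h2 : i < B + x) : (i, i + x) ∈ E := by
  have := congrArg (fun m : ℕ => m.testBit (i - B)) h
  simp only [Nat.testBit_mod_two_pow, Nat.testBit_two_pow_sub_one, Nat.testBit_shiftRight,
    show i - B < x by omega, show B + (i - B) = i by omega, decide_true, Bool.true_and] at this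
  obtain ⟨e, he, rfl⟩ := List.mem_map.1 (testBit_mask.1 this)
  obtain ⟨he, hx⟩ := List.mem_filter.1 he
  rw [← of_decide_eq_true hx]
  exact he

/-- The list visits each of `0, …, v - 1` once. -/
def PathCheck (v : ℕ) (l : List ℕ) : Prop :=
  l.length = v ∧ mask l = 2 ^ v - 1

/-- The entries of the list are `a` ones, `b` threes and `c` copies of `y`. -/
def LensCheck (a b y c : ℕ) (L : List ℕ) : Prop :=
  L.length = a + b + c ∧ L.count 1 = a ∧ L.count 3 = b ∧ L.count y = c

/-- The condition `Cut` for a list of edges. -/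
def CutCheck (x B : ℕ) (E : List (ℕ × ℕ)) : Prop :=
  (∀ e ∈ E, e.1 < B + x → B + x ≤ e.2 → B ≤ e.1 ∧ e.2 = e.1 + x) ∧ EdgesFrom x B E

/-- The condition `Site` for a list of edges. -/
def SiteCheck (y s M : ℕ) (E : List (ℕ × ℕ)) : Prop :=
  (∀ e ∈ E, (e.2 = e.1 + y ∧ M ≤ e.2) ∨
    (e.2 < e.1 + y ∧ (e.1 < M → M ≤ e.2 → M ≤ e.1 + s ∧ e.2 = e.1 + s) ∧
      (e.1 < M + y → e.2 < M + y) ∧ (e.1 < M + 2 * y → e.2 < M + 2 * y))) ∧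
    s ≤ M ∧ EdgesFrom s (M - s) E

instance (x B E) : Decidable (EdgesFrom x B E) := inferInstanceAs (Decidable (_ = _))
instance (v l) : Decidable (PathCheck v l) := inferInstanceAs (Decidable (_ ∧ _))
instance (a b y c L) : Decidable (LensCheck a b y c L) := inferInstanceAs (Decidable (_ ∧ _))
instance (x B E) : Decidable (CutCheck x B E) := inferInstanceAs (Decidable (_ ∧ _))
instance (y s M E) : Decidable (SiteCheck y s M E) := inferInstanceAs (Decidable (_ ∧ _))

/-- The mask `2 ^ v - 1` shows that every vertex occurs, and length `v` then leaves no room for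
repetitions. Comparing two numbers is much cheaper for the kernel than testing for a permutation. -/
theorem PathCheck.isPath {v : ℕ} {l : List ℕ} (h : PathCheck v l) :
    IsPath v (steps l : Multiset (ℕ × ℕ)) := by
  refine ⟨l, (List.Subperm.perm_of_length_le
    (List.subperm_of_subset List.nodup_range fun i hi => ?_) ?_).symm, rfl⟩
  · rw [← testBit_mask, h.2, Nat.testBit_two_pow_sub_one]
    exact decide_eq_true (List.mem_range.1 hi)
  · simp [h.1]

/-- The values `1`, `3` and `y` are distinct and their counts add up to the length of the list, so
no other value occurs. -/
theorem LensCheck.map_len {a b y c : ℕ} {E : List (ℕ × ℕ)} (h : LensCheck a b y c (E.map len))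
    (hy : 3 < y) : (E : Multiset (ℕ × ℕ)).map len = tripleMultiset a 3 b y c := by
  obtain ⟨h0, h1, h3, h4⟩ := h
  symm
  refine Multiset.eq_of_le_of_card_le (Multiset.le_iff_count.2 fun z => ?_) ?_
  · rw [count_tripleMultiset, Multiset.map_coe, Multiset.coe_count]
    split_ifs with e1 e2 e3 <;> subst_vars <;> omega
  · rw [card_tripleMultiset, Multiset.map_coe, Multiset.coe_card, h0]

theorem CutCheck.cut {x B : ℕ} {E : List (ℕ × ℕ)} (h : CutCheck x B E) :
    Cut x B (E : Multiset (ℕ × ℕ)) :=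
  ⟨h.1, fun _ h1 h2 => h.2.mem h1 h2⟩

theorem SiteCheck.site {y s M : ℕ} {E : List (ℕ × ℕ)} (h : SiteCheck y s M E) :
    Site y s M (E : Multiset (ℕ × ℕ)) :=
  ⟨h.1, fun _ h1 h2 => h.2.2.mem (by omega) (by have := h.2.1; omega)⟩

/-! ### Families of paths in arithmetic progressions -/

/-- The pair `(i, j)` is reached from `(h, w)` by adding multiples of `m` to `h`, if `p` holds,
and multiples of `n` to `w`, if `q` holds; if `i` and `j` lie in the last period below the
bounds `S` and `T`, then `p` and `q` are required. -/
def Covers (m n S T h w : ℕ) (p q : Prop) (i j : ℕ) : Prop :=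
  h ≤ i ∧ (i - h) % m = 0 ∧ (i = h ∧ i + m < S ∨ p) ∧
    w ≤ j ∧ (j - w) % n = 0 ∧ (j = w ∧ j + n < T ∨ q)

instance (m n S T h w p q i j) [Decidable p] [Decidable q] :
    Decidable (Covers m n S T h w p q i j) := inferInstanceAs (Decidable (_ ∧ _))

/-- The representative of `i` modulo `m` in the last period below `S`, for `i` not below `S`. -/
def reduceBelow (m S i : ℕ) : ℕ := if i < S then i else S - m + (i - S) % m

/-- An `i` beyond `S` is tested at its representative in the last period, where `i + m < S` fails,
so that `p` is forced and the seed may be grown past `S`; likewise for `j`. This is how a finite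
table covers all pairs. -/
theorem exists_of_covers_reduceBelow {m n S T h w i j : ℕ} {p q : Prop} (hm : 0 < m) (hn : 0 < n)
    (hS : m ≤ S) (hT : n ≤ T)
    (hc : Covers m n S T h w p q (reduceBelow m S i) (reduceBelow n T j)) :
    ∃ k l, i = h + m * k ∧ j = w + n * l ∧ (k = 0 ∨ p) ∧ (l = 0 ∨ q) := by
  have key : ∀ {m S h i : ℕ} {p : Prop}, 0 < m → m ≤ S → h ≤ reduceBelow m S i →
      (reduceBelow m S i - h) % m = 0 →
      (reduceBelow m S i = h ∧ reduceBelow m S i + m < S ∨ p) →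
      ∃ k, i = h + m * k ∧ (k = 0 ∨ p) := by
    intro m S h i p hm hS h1 h2 h3
    obtain ⟨k, hk⟩ := Nat.dvd_of_mod_eq_zero h2
    by_cases hi : i < S
    · simp only [reduceBelow, hi, if_true] at h1 hk h3
      refine ⟨k, by omega, ?_⟩
      rcases h3 with ⟨h3, -⟩ | h3
      · left
        have : m * k = 0 := by omega
        simpa [hm.ne'] using this
      · exact .inr h3
    · simp only [reduceBelow, hi, if_false] at h1 hk h3
      refine ⟨k + (1 + (i - S) / m), ?_, .inr (h3.resolve_left fun h4 => ?_)⟩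
      · have := Nat.mod_add_div (i - S) m
        rw [mul_add, mul_add]
        omega
      · have := h4.2
        omega
  obtain ⟨h1, h2, h3, h4, h5, h6⟩ := hc
  obtain ⟨k, hk, hk'⟩ := key hm hS h1 h2 h3
  obtain ⟨l, hl, hl'⟩ := key hn hT h4 h5 h6
  exact ⟨k, l, hk, hl, hk', hl'⟩

/-! ### Seeds with one site -/

/-- A path for `y = h + w`, with a cut of width `3` at `C`, a cut of width `y` at `R`, and,
if `M ≠ 0`, a site `M`. It has `y + h` edges of length `y`. -/
structure Seed where
  h : ℕ
  w : ℕ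
  C : ℕ
  R : ℕ
  M : ℕ
  path : List ℕ

namespace Seed

/-- The conditions on a seed with `a` edges of length `1` and `b` edges of length `3` whose site
has width `s`. -/
def Valid (s a b : ℕ) (σ : Seed) : Prop :=
  PathCheck (a + b + (σ.h + σ.w + σ.h) + 1) σ.path ∧
    LensCheck a b (σ.h + σ.w) (σ.h + σ.w + σ.h) ((steps σ.path).map len) ∧
    CutCheck 1 0 (steps σ.path) ∧ CutCheck 3 σ.C (steps σ.path) ∧
    CutCheck (σ.h + σ.w) σ.R (steps σ.path) ∧ 3 < σ.h + σ.w ∧ 1 ≤ σ.C ∧ σ.C + 3 ≤ σ.R ∧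
    (σ.M ≠ 0 → SiteCheck (σ.h + σ.w) s σ.M (steps σ.path) ∧ σ.C + 3 + s ≤ σ.M ∧ σ.R ≤ σ.M ∧
      σ.M ≤ σ.R + (σ.h + σ.w))

instance (s a b σ) : Decidable (Valid s a b σ) := inferInstanceAs (Decidable (_ ∧ _))

/-- The seed can be enlarged by columns with three vertices (if `t` is true) or two vertices
(otherwise). -/
def Grows (t : Bool) (σ : Seed) : Prop :=
  σ.M ≠ 0 ∧ Fits t (σ.h + σ.w) σ.M σ.path.length

instance (t σ) : Decidable (Grows t σ) := inferInstanceAs (Decidable (_ ∧ _))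

/-- Each step adds `2 * s` to `y`. It adds `4 * s` edges of length `y` if the columns have three
vertices, which raises `h`, and `2 * s` if they have two, which raises `w`. -/
theorem Valid.ready {s a b : ℕ} {σ : Seed} (hσ : σ.Valid s a b) (hs : s = 1 ∨ s = 3) {k l : ℕ}
    (hk : k = 0 ∨ σ.Grows true) (hl : l = 0 ∨ σ.Grows false) :
    Ready [(1, 0), (3, σ.C)] (σ.h + σ.w + 2 * s * (k + l))
      (a + if s = 1 then 2 * (k + l) else 0) (b + if s = 3 then 6 * (k + l) else 0)
      (σ.h + σ.w + σ.h + 4 * s * k + 2 * s * l) := by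
  obtain ⟨hp, hL, h1, h3, hR, hy, hC, hCR, hM⟩ := hσ
  by_cases hM0 : σ.M = 0
  · obtain rfl : k = 0 := hk.resolve_right fun h => h.1 hM0
    obtain rfl : l = 0 := hl.resolve_right fun h => h.1 hM0
    refine ⟨_, σ.R, _, hp.isPath, ?_, ?_, ?_⟩
    · simpa using hL.map_len hy
    · simp only [List.mem_cons, List.not_mem_nil, or_false]
      rintro p (rfl | rfl)
      · exact ⟨h1.cut, by simp only; omega⟩
      · exact ⟨h3.cut, hCR⟩
    · simpa using hR.cut
  · obtain ⟨hsite, hCM, hRM, hMR⟩ := hM hM0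
    have hF : Frame s (σ.h + σ.w) a b (σ.h + σ.w + σ.h) σ.R σ.M
        (a + b + (σ.h + σ.w + σ.h) + 1) [(1, 0), (3, σ.C)] [] (steps σ.path) := by
      refine ⟨hp.isPath, hL.map_len hy, ?_, hR.cut, hsite.site, by simp, hs, by omega, hy, hRM, hMR⟩
      simp only [List.mem_cons, List.not_mem_nil, or_false]
      rintro p (rfl | rfl)
      · exact ⟨h1.cut, by simp only; omega, by simp only; omega⟩
      · exact ⟨h3.cut, hCM, hy⟩
    rw [← hp.1] at hF
    -- Columns with two vertices come first. If both heights fit, then `v = M + 2 * y`; columns with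
    -- two vertices preserve this equality, whereas those with three would break it.
    have hF₁ : ∃ E v, Frame s (σ.h + σ.w + 2 * s * l) (a + if s = 1 then 2 * l else 0)
        (b + if s = 3 then 6 * l else 0) (σ.h + σ.w + σ.h + s * 2 * l) σ.R σ.M v
        [(1, 0), (3, σ.C)] [] E ∧ v = σ.path.length + 4 * s * l := by
      rcases hl with rfl | hl
      · exact ⟨_, _, by simpa using hF, by simp⟩
      · obtain ⟨E, hE⟩ := hF.iterate false hl.2 l
        exact ⟨E, _, by simpa using hE, by simp⟩
    obtain ⟨E₁, v₁, hF₁, hv₁⟩ := hF₁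
    have hF₂ : ∃ E v, Frame s (σ.h + σ.w + 2 * s * l + 2 * s * k)
        ((a + if s = 1 then 2 * l else 0) + if s = 1 then 2 * k else 0)
        ((b + if s = 3 then 6 * l else 0) + if s = 3 then 6 * k else 0)
        (σ.h + σ.w + σ.h + s * 2 * l + s * 4 * k) σ.R σ.M v [(1, 0), (3, σ.C)] [] E := by
      rcases hk with rfl | hk
      · exact ⟨_, _, by simpa using hF₁⟩
      · have ht : Fits true (σ.h + σ.w + 2 * s * l) σ.M v₁ := by
          have h5 := hk.2
          have h6 : l = 0 ∨ Fits false (σ.h + σ.w) σ.M σ.path.length := hl.imp id (·.2)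
          simp only [Fits, if_true, Bool.false_eq_true, if_false] at h5 h6 ⊢
          rw [hv₁, mul_assoc, mul_assoc]
          rcases h6 with rfl | h6
          · simpa using h5
          · generalize s * l = z
            omega
        obtain ⟨E, hE⟩ := hF₁.iterate true ht k
        exact ⟨E, _, by simpa using hE⟩
    obtain ⟨E₂, v₂, hF₂⟩ := hF₂
    refine ⟨v₂, σ.R, E₂, hF₂.path, ?_, ?_, ?_⟩
    · rw [hF₂.lens]
      congr 1
      · split_ifs <;> ring
      · split_ifs <;> ring
      · ring
      · ring
    · simp only [List.mem_cons, List.not_mem_nil, or_false]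
      rintro p (rfl | rfl)
      · exact ⟨(hF₂.low _ (by simp)).1, by simp only; omega⟩
      · exact ⟨(hF₂.low _ (by simp)).1, hCR⟩
    · have := hF₂.top
      rwa [show σ.h + σ.w + 2 * s * l + 2 * s * k = σ.h + σ.w + 2 * s * (k + l) by ring] at this

end Seed


/-- The functions `α` and `β` prescribe the numbers of ones and threes for each `y`. By `hα` and
`hβ` they change exactly as growth changes these numbers, so a grown seed belongs to the same
family. -/
theorem exists_ready_of_seeds {s S : ℕ} (hs : s = 1 ∨ s = 3) (hS : 2 * s ≤ S) {α β : ℕ → ℕ}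
    (hα : ∀ y k, 3 < y → α (y + 2 * s * k) = α y + if s = 1 then 2 * k else 0)
    (hβ : ∀ y k, 3 < y → β (y + 2 * s * k) = β y + if s = 3 then 6 * k else 0)
    {ok : ℕ → ℕ → Prop} {l : List Seed}
    (hl : ∀ σ ∈ l, σ.Valid s (α (σ.h + σ.w)) (β (σ.h + σ.w)))
    (hc : ∀ i < S, ∀ j < S, ok i j → ∃ σ ∈ l,
      Covers (2 * s) (2 * s) S S σ.h σ.w (σ.Grows true) (σ.Grows false) i j)
    (hok : ∀ i j, ok i j → ok (reduceBelow (2 * s) S i) (reduceBelow (2 * s) S j))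
    {i j : ℕ} (hij : ok i j) :
    ∃ C, 1 ≤ C ∧ Ready [(1, 0), (3, C)] (i + j) (α (i + j)) (β (i + j)) (i + j + i) := by
  have hs0 : 0 < 2 * s := by omega
  have hlt : ∀ i, reduceBelow (2 * s) S i < S := by
    intro i
    have := Nat.mod_lt (i - S) hs0
    simp only [reduceBelow]
    split_ifs <;> omega
  obtain ⟨σ, hσ, hcov⟩ := hc _ (hlt i) _ (hlt j) (hok i j hij)
  obtain ⟨k, m, rfl, rfl, hk, hm⟩ := exists_of_covers_reduceBelow hs0 hs0 hS hS hcov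
  have hv := hl σ hσ
  have h3 : 3 < σ.h + σ.w := hv.2.2.2.2.2.1
  refine ⟨σ.C, hv.2.2.2.2.2.2.1, ?_⟩
  have key := hv.ready hs hk hm
  rw [← hα _ _ h3, ← hβ _ _ h3] at key
  have e : σ.h + 2 * s * k + (σ.w + 2 * s * m) = σ.h + σ.w + 2 * s * (k + m) := by ring
  rw [e]
  convert key using 1
  ring

/-! ### Seeds with two sites -/

/-- A path for `y = a + b - 1`, with a cut of width `y` at `R`, a site `N` of width `1` and,
if `M ≠ 0`, a site `M` of width `3`. It has `a + 1` edges of length `1` and `b` edges of length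
`3`. -/
structure DoubleSeed where
  a : ℕ
  b : ℕ
  y : ℕ
  R : ℕ
  N : ℕ
  M : ℕ
  path : List ℕ

namespace DoubleSeed

/-- The conditions on a seed with `y + ε` edges of length `y`. -/
def Valid (ε : ℕ) (σ : DoubleSeed) : Prop :=
  PathCheck (σ.a + 1 + σ.b + (σ.y + ε) + 1) σ.path ∧
    LensCheck (σ.a + 1) σ.b σ.y (σ.y + ε) ((steps σ.path).map len) ∧
    CutCheck 1 0 (steps σ.path) ∧ CutCheck σ.y σ.R (steps σ.path) ∧ σ.y + 1 = σ.a + σ.b ∧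
    3 < σ.y ∧ 1 ≤ σ.R ∧ SiteCheck σ.y 1 σ.N (steps σ.path) ∧ 2 ≤ σ.N ∧ σ.R ≤ σ.N ∧
    σ.N ≤ σ.R + σ.y ∧ Fits false σ.y σ.N σ.path.length ∧
    (σ.M ≠ 0 → SiteCheck σ.y 3 σ.M (steps σ.path) ∧ σ.N + 3 ≤ σ.M ∧ σ.M ≤ σ.N + σ.y ∧
      σ.M ≤ σ.R + σ.y ∧ Fits false σ.y σ.M σ.path.length)

instance (ε σ) : Decidable (Valid ε σ) := inferInstanceAs (Decidable (_ ∧ _))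

/-- Growth at the site of width `3` raises `y` and the number of threes by `6`; growth at the site
of width `1` raises `y` and the number of ones by `2`. The upper site is used first because a frame
carries along only the sites below its own. All columns have two vertices, so the number of edges of
length `y` keeps its excess `ε` over `y`. -/
theorem Valid.ready {ε : ℕ} {σ : DoubleSeed} (hσ : σ.Valid ε) (k : ℕ) {l : ℕ}
    (hl : l = 0 ∨ σ.M ≠ 0) :
    Ready [(1, 0)] (σ.y + 2 * k + 6 * l) (σ.a + 1 + 2 * k) (σ.b + 6 * l)
      (σ.y + ε + 2 * k + 6 * l) := by
  obtain ⟨hp, hL, h1, hR, -, hy, hR1, hN, hN2, hRN, hNR, hNf, hM⟩ := hσ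
  have hF : ∃ E v, Frame 1 (σ.y + 6 * l) (σ.a + 1) (σ.b + 6 * l) (σ.y + ε + 6 * l) σ.R σ.N v
      [(1, 0)] [] E ∧ Fits false (σ.y + 6 * l) σ.N v := by
    rcases hl with rfl | hl
    · refine ⟨steps σ.path, _, ⟨hp.isPath, hL.map_len hy, ?_, hR.cut, hN.site, by simp, .inl rfl,
        by omega, hy, hRN, hNR⟩, ?_⟩
      · simp only [List.mem_cons, List.not_mem_nil, or_false]
        rintro p rfl
        exact ⟨h1.cut, by simp only; omega, by simp only; omega⟩
      · rw [← hp.1]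
        exact hNf
    · obtain ⟨hM3, hNM, hMN, hMR, hMf⟩ := hM hl
      have hF : Frame 3 σ.y (σ.a + 1) σ.b (σ.y + ε) σ.R σ.M
          (σ.a + 1 + σ.b + (σ.y + ε) + 1) [(1, 0)] [σ.N] (steps σ.path) := by
        refine ⟨hp.isPath, hL.map_len hy, ?_, hR.cut, hM3.site, ?_, .inr rfl,
          by omega, hy, by omega, hMR⟩
        · simp only [List.mem_cons, List.not_mem_nil, or_false]
          rintro p rfl
          exact ⟨h1.cut, by simp only; omega, by simp only; omega⟩
        · simp only [List.mem_cons, List.not_mem_nil, or_false]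
          rintro n rfl
          exact ⟨hN.site, hNM, hMN⟩
      rw [← hp.1] at hF
      obtain ⟨E, hE⟩ := hF.iterate false hMf l
      simp only [Nat.reduceMul, OfNat.ofNat_ne_one, if_false, if_true, Bool.false_eq_true,
        add_zero] at hE
      have hEN := hE.site_low σ.N (by simp)
      refine ⟨E, _, ⟨hE.path, hE.lens, ?_, hE.top, hEN.1, by simp, .inl rfl, by omega, hE.lt, hRN,
        by omega⟩, ?_⟩
      · simp only [List.mem_cons, List.not_mem_nil, or_false]
        rintro p rfl
        exact ⟨(hE.low _ (by simp)).1, by simp only; omega, by simp only; omega⟩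
      · simp only [Fits, Bool.false_eq_true, if_false] at hNf ⊢
        omega
  obtain ⟨E, v, hF, hf⟩ := hF
  obtain ⟨E', hE'⟩ := hF.iterate false hf k
  simp only [mul_one, if_true, OfNat.one_ne_ofNat, if_false, Bool.false_eq_true, add_zero,
    one_mul] at hE'
  refine ⟨_, σ.R, E', hE'.path, ?_, ?_, ?_⟩
  · rw [hE'.lens, add_right_comm σ.y, add_right_comm (σ.y + ε)]
  · simp only [List.mem_cons, List.not_mem_nil, or_false]
    rintro p rfl
    exact ⟨(hE'.low _ (by simp)).1, by simp only; omega⟩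
  · rw [add_right_comm]
    exact hE'.top

end DoubleSeed

/-- The table is indexed by the numbers of ones and threes, with periods `2` and `6`; they determine
`y`. Every seed can grow at its site of width `1`, hence the condition `True`. -/
theorem ready_of_doubleSeeds {S T ε : ℕ} (hS : 2 ≤ S) (hT : 6 ≤ T) {ok : ℕ → ℕ → Prop}
    {l : List DoubleSeed} (hl : ∀ σ ∈ l, σ.Valid ε)
    (hc : ∀ i < S, ∀ j < T, ok i j → ∃ σ ∈ l, Covers 2 6 S T σ.a σ.b True (σ.M ≠ 0) i j)
    (hok : ∀ i j, ok i j → ok (reduceBelow 2 S i) (reduceBelow 6 T j))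
    {y i j : ℕ} (hij : ok i j) (hy : y + 1 = i + j) :
    Ready [(1, 0)] y (i + 1) j (y + ε) := by
  have hlt : ∀ m S i, 0 < m → m ≤ S → reduceBelow m S i < S := by
    intro m S i hm hS
    have := Nat.mod_lt (i - S) hm
    simp only [reduceBelow]
    split_ifs <;> omega
  obtain ⟨σ, hσ, hcov⟩ := hc _ (hlt 2 S i (by omega) hS) _ (hlt 6 T j (by omega) hT) (hok i j hij)
  obtain ⟨k, m, rfl, rfl, -, hm⟩ := exists_of_covers_reduceBelow (by omega) (by omega) hS hT hcov
  have hv := hl σ hσ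
  have h1 : σ.y + 1 = σ.a + σ.b := hv.2.2.2.2.1
  have key := hv.ready k hm
  rw [show σ.y + 2 * k + 6 * m = y by omega, show σ.y + ε + 2 * k + 6 * m = y + ε by omega] at key
  convert key using 1
  ring


/-! ### Tables of seeds -/

/-- Seeds with `y + 2` edges of length `1` and `3` edges of length `3`. -/
def manyOnesSeeds0 : List Seed := [
⟨0, 4, 1, 6, 8, [0, 1, 4, 5, 2, 3, 6, 10, 11, 7, 8, 12, 13, 9]⟩,
⟨1, 3, 1, 7, 9, [0, 1, 4, 5, 2, 3, 6, 10, 14, 13, 9, 8, 12, 11, 7]⟩,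
⟨2, 2, 2, 8, 8, [0, 1, 2, 5, 9, 13, 12, 8, 7, 4, 3, 6, 10, 14, 15, 11]⟩,
⟨3, 1, 1, 6, 9, [0, 1, 4, 5, 2, 3, 6, 10, 14, 13, 9, 8, 12, 16, 15, 11, 7]⟩,
⟨0, 5, 1, 6, 8, [0, 1, 4, 5, 2, 3, 6, 11, 12, 7, 8, 13, 14, 9, 10, 15]⟩,
⟨1, 4, 1, 6, 8, [0, 1, 4, 5, 2, 3, 6, 11, 16, 15, 10, 9, 14, 13, 8, 7, 12]⟩,
⟨2, 3, 1, 6, 8, [0, 1, 4, 5, 2, 3, 6, 11, 16, 15, 10, 9, 14, 13, 8, 7, 12, 17]⟩,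
⟨3, 2, 2, 5, 9, [0, 1, 2, 5, 10, 15, 14, 9, 8, 13, 18, 17, 16, 11, 6, 3, 4, 7, 12]⟩,
⟨4, 1, 3, 6, 10, [0, 1, 2, 3, 6, 11, 16, 17, 12, 7, 4, 5, 8, 13, 18, 19, 14, 9, 10, 15]⟩]

/-- Seeds with `y + 2` edges of length `1` and `4` edges of length `3`. -/
def manyOnesSeeds1 : List Seed := [
⟨0, 4, 1, 7, 7, [0, 1, 4, 5, 2, 3, 6, 7, 11, 14, 10, 9, 13, 12, 8]⟩,
⟨1, 3, 2, 8, 8, [0, 1, 2, 5, 9, 13, 14, 10, 11, 15, 12, 8, 7, 4, 3, 6]⟩,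
⟨2, 2, 3, 9, 9, [0, 1, 2, 3, 6, 10, 14, 15, 11, 7, 4, 5, 8, 9, 13, 16, 12]⟩,
⟨3, 1, 2, 7, 10, [0, 1, 2, 5, 8, 12, 16, 17, 13, 9, 10, 14, 15, 11, 7, 4, 3, 6]⟩,
⟨0, 5, 1, 7, 7, [0, 1, 4, 5, 2, 3, 6, 7, 12, 13, 8, 11, 16, 15, 10, 9, 14]⟩,
⟨1, 4, 2, 6, 10, [0, 1, 2, 5, 8, 13, 14, 9, 10, 15, 16, 17, 12, 7, 4, 3, 6, 11]⟩,
⟨2, 3, 3, 9, 9, [0, 1, 2, 3, 6, 11, 16, 17, 12, 7, 4, 5, 8, 9, 14, 15, 10, 13, 18]⟩,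
⟨3, 2, 3, 6, 10, [0, 1, 2, 5, 8, 13, 18, 19, 14, 9, 10, 15, 16, 17, 12, 7, 4, 3, 6, 11]⟩,
⟨4, 1, 3, 7, 11, [0, 1, 2, 3, 6, 9, 14, 19, 18, 13, 8, 5, 4, 7, 12, 17, 16, 11, 10, 15, 20]⟩]

/-- Seeds with `y + 2` edges of length `1` and `5` edges of length `3`. -/
def manyOnesSeeds2 : List Seed := [
⟨0, 4, 1, 8, 10, [0, 1, 4, 7, 6, 3, 2, 5, 8, 12, 13, 9, 10, 14, 15, 11]⟩,
⟨1, 3, 3, 9, 9, [0, 1, 2, 5, 8, 9, 13, 16, 12, 11, 15, 14, 10, 6, 3, 4, 7]⟩,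
⟨2, 2, 1, 8, 10, [0, 1, 4, 7, 6, 3, 2, 5, 8, 12, 16, 17, 13, 9, 10, 14, 15, 11]⟩,
⟨3, 1, 2, 8, 11, [0, 1, 2, 5, 8, 12, 16, 15, 11, 10, 14, 18, 17, 13, 9, 6, 3, 4, 7]⟩,
⟨0, 5, 2, 8, 8, [0, 1, 2, 5, 6, 3, 4, 7, 8, 13, 16, 11, 12, 17, 14, 9, 10, 15]⟩,
⟨1, 4, 2, 5, 9, [0, 1, 2, 5, 10, 13, 8, 9, 14, 15, 18, 17, 16, 11, 6, 3, 4, 7, 12]⟩,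
⟨2, 3, 1, 8, 10, [0, 1, 4, 7, 6, 3, 2, 5, 8, 13, 18, 17, 12, 11, 16, 15, 10, 9, 14, 19]⟩,
⟨3, 2, 2, 7, 11, [0, 1, 2, 5, 8, 13, 18, 17, 16, 11, 10, 15, 20, 19, 14, 9, 6, 3, 4, 7, 12]⟩,
⟨4, 1, 3, 8, 12, [0, 1, 2, 3, 6, 9, 14, 19, 20, 15, 10, 7, 4, 5, 8, 13, 18, 17, 12, 11, 16, 21]⟩]

/-- Seeds with eight edges of length `1` and `y - 1` edges of length `3`. -/
def eightOnesSeeds0 : List Seed := [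
⟨0, 7, 2, 8, 8, [0, 1, 2, 5, 8, 15, 16, 9, 6, 3, 4, 7, 10, 17, 18, 11, 12, 19, 20, 13, 14, 21]⟩,
⟨1, 6, 1, 8, 10, [0, 1, 4, 5, 2, 3, 6, 7, 10, 17, 18, 11, 8, 15, 22, 21, 14, 13, 20, 19, 12, 9,
    16]⟩,
⟨2, 5, 2, 8, 10, [0, 1, 2, 5, 6, 3, 4, 7, 10, 17, 18, 11, 8, 15, 22, 21, 14, 13, 20, 19, 12, 9,
    16, 23]⟩,
⟨3, 4, 1, 7, 11, [0, 1, 4, 5, 2, 3, 6, 7, 14, 21, 20, 13, 10, 17, 24, 23, 22, 15, 8, 11, 18, 19,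
    12, 9, 16]⟩,
⟨4, 3, 3, 8, 12, [0, 1, 2, 3, 6, 7, 4, 5, 8, 15, 22, 21, 14, 11, 18, 25, 24, 17, 10, 13, 20, 19,
    12, 9, 16, 23]⟩,
⟨5, 2, 1, 6, 10, [0, 1, 4, 5, 2, 3, 6, 13, 20, 21, 22, 23, 16, 9, 12, 19, 26, 25, 18, 11, 8, 15,
    14, 7, 10, 17, 24]⟩,
⟨6, 1, 1, 6, 10, [0, 1, 4, 5, 2, 3, 6, 13, 14, 7, 10, 17, 24, 25, 18, 11, 8, 15, 22, 21, 20, 27,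
    26, 19, 12, 9, 16, 23]⟩,
⟨0, 8, 2, 8, 8, [0, 1, 2, 5, 8, 16, 17, 9, 6, 3, 4, 7, 10, 18, 19, 11, 12, 20, 23, 15, 14, 22, 21,
    13]⟩,
⟨1, 7, 1, 8, 9, [0, 1, 4, 5, 2, 3, 6, 9, 17, 20, 12, 13, 21, 22, 14, 15, 23, 24, 16, 8, 11, 19,
    18, 10, 7]⟩,
⟨2, 6, 2, 8, 10, [0, 1, 2, 5, 6, 3, 4, 7, 10, 18, 19, 11, 8, 16, 24, 23, 15, 14, 22, 25, 17, 9,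
    12, 20, 21, 13]⟩,
⟨3, 5, 3, 9, 11, [0, 1, 2, 3, 6, 14, 22, 23, 15, 16, 24, 21, 13, 10, 18, 26, 25, 17, 9, 12, 20,
    19, 11, 8, 5, 4, 7]⟩,
⟨4, 4, 1, 10, 12, [0, 1, 4, 5, 2, 3, 6, 7, 15, 23, 24, 16, 8, 9, 12, 20, 21, 13, 10, 18, 26, 27,
    19, 11, 14, 22, 25, 17]⟩,
⟨5, 3, 3, 8, 13, [0, 1, 2, 3, 6, 9, 17, 25, 26, 18, 10, 13, 21, 22, 14, 11, 19, 27, 28, 20, 12,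
    15, 23, 24, 16, 8, 5, 4, 7]⟩,
⟨6, 2, 1, 6, 10, [0, 1, 4, 5, 2, 3, 6, 14, 22, 23, 24, 25, 17, 9, 12, 20, 28, 27, 19, 11, 8, 16,
    15, 7, 10, 18, 26, 29, 21, 13]⟩,
⟨7, 1, 1, 9, 9, [0, 1, 4, 12, 20, 28, 29, 30, 22, 14, 13, 21, 18, 10, 7, 15, 23, 24, 16, 8, 11,
    19, 27, 26, 25, 17, 9, 6, 3, 2, 5]⟩,
⟨0, 9, 2, 8, 8, [0, 1, 2, 5, 8, 17, 18, 9, 6, 3, 4, 7, 10, 19, 20, 11, 12, 21, 24, 15, 16, 25, 22,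
    13, 14, 23]⟩,
⟨1, 8, 1, 5, 11, [0, 1, 4, 7, 16, 17, 8, 11, 20, 21, 12, 9, 18, 19, 10, 13, 22, 23, 26, 25, 24,
    15, 6, 3, 2, 5, 14]⟩,
⟨2, 7, 2, 8, 10, [0, 1, 2, 5, 6, 3, 4, 7, 10, 19, 20, 11, 8, 17, 26, 25, 16, 13, 22, 23, 14, 15,
    24, 27, 18, 9, 12, 21]⟩,
⟨3, 6, 3, 9, 11, [0, 1, 2, 3, 6, 15, 24, 27, 28, 19, 10, 13, 22, 23, 14, 17, 26, 25, 16, 7, 4, 5,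
    8, 11, 20, 21, 12, 9, 18]⟩,
⟨4, 5, 1, 8, 12, [0, 1, 4, 7, 6, 3, 2, 5, 8, 17, 26, 25, 16, 15, 24, 23, 14, 11, 20, 29, 28, 19,
    10, 13, 22, 21, 12, 9, 18, 27]⟩,
⟨5, 4, 1, 7, 13, [0, 1, 4, 5, 2, 3, 6, 7, 16, 25, 22, 13, 10, 19, 28, 27, 18, 9, 8, 17, 26, 29,
    30, 21, 12, 15, 24, 23, 14, 11, 20]⟩,
⟨6, 3, 3, 8, 14, [0, 1, 2, 3, 6, 9, 18, 27, 28, 19, 10, 7, 4, 5, 8, 17, 26, 25, 16, 13, 22, 31,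
    30, 21, 12, 15, 24, 23, 14, 11, 20, 29]⟩,
⟨7, 2, 1, 4, 10, [0, 1, 4, 13, 16, 7, 10, 19, 28, 29, 20, 11, 8, 17, 14, 5, 2, 3, 6, 15, 24, 25,
    26, 27, 18, 9, 12, 21, 30, 31, 22, 23, 32]⟩,
⟨8, 1, 1, 4, 10, [0, 1, 4, 13, 14, 5, 2, 3, 6, 15, 18, 9, 12, 21, 30, 31, 22, 23, 32, 33, 24, 27,
    26, 17, 8, 11, 20, 29, 28, 19, 10, 7, 16, 25]⟩,
⟨0, 10, 2, 8, 8, [0, 1, 2, 5, 8, 18, 19, 9, 6, 3, 4, 7, 10, 20, 21, 11, 12, 22, 25, 15, 16, 26,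
    23, 13, 14, 24, 27, 17]⟩,
⟨1, 9, 1, 8, 9, [0, 1, 4, 5, 2, 3, 6, 9, 19, 22, 12, 13, 23, 26, 16, 15, 25, 24, 14, 17, 27, 28,
    18, 8, 11, 21, 20, 10, 7]⟩,
⟨2, 8, 2, 8, 10, [0, 1, 2, 5, 6, 3, 4, 7, 10, 20, 21, 11, 8, 18, 28, 25, 15, 14, 24, 27, 17, 16,
    26, 29, 19, 9, 12, 22, 23, 13]⟩,
⟨3, 7, 2, 9, 11, [0, 1, 4, 7, 8, 11, 21, 22, 12, 9, 19, 29, 30, 20, 10, 13, 23, 24, 14, 17, 27,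
    28, 18, 15, 25, 26, 16, 6, 3, 2, 5]⟩,
⟨4, 6, 1, 8, 12, [0, 1, 4, 7, 6, 3, 2, 5, 8, 18, 28, 29, 19, 9, 12, 22, 23, 13, 10, 20, 30, 31,
    21, 11, 14, 24, 27, 17, 16, 26, 25, 15]⟩,
⟨5, 5, 3, 8, 13, [0, 1, 2, 3, 6, 9, 19, 29, 32, 22, 12, 15, 25, 24, 14, 11, 21, 31, 30, 20, 10,
    13, 23, 26, 16, 17, 27, 28, 18, 8, 5, 4, 7]⟩,
⟨6, 4, 2, 8, 14, [0, 1, 2, 5, 8, 18, 28, 29, 19, 9, 6, 3, 4, 7, 10, 20, 30, 31, 21, 11, 14, 24,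
    25, 15, 12, 22, 32, 33, 23, 13, 16, 26, 27, 17]⟩,
⟨7, 3, 3, 8, 15, [0, 1, 2, 3, 6, 9, 19, 29, 28, 18, 8, 5, 4, 7, 10, 20, 30, 27, 17, 14, 24, 34,
    33, 23, 13, 16, 26, 25, 15, 12, 22, 32, 31, 21, 11]⟩,
⟨8, 2, 4, 10, 12, [0, 1, 2, 3, 4, 7, 17, 27, 30, 20, 10, 13, 23, 33, 32, 22, 12, 9, 6, 5, 8, 18,
    28, 31, 21, 11, 14, 24, 34, 35, 25, 15, 16, 26, 29, 19]⟩,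
⟨9, 1, 1, 9, 11, [0, 1, 4, 14, 24, 34, 33, 23, 13, 10, 20, 19, 9, 12, 22, 32, 31, 21, 11, 8, 5, 2,
    3, 6, 16, 26, 36, 35, 25, 15, 18, 28, 29, 30, 27, 17, 7]⟩,
⟨0, 11, 1, 8, 8, [0, 1, 4, 7, 10, 21, 20, 9, 6, 3, 2, 5, 8, 19, 22, 11, 14, 25, 24, 13, 12, 23,
    26, 15, 16, 27, 28, 17, 18, 29]⟩,
⟨1, 10, 1, 7, 9, [0, 1, 4, 5, 2, 3, 6, 9, 20, 23, 12, 15, 26, 27, 16, 13, 24, 25, 14, 17, 28, 29,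
    30, 19, 8, 11, 22, 21, 10, 7, 18]⟩,
⟨2, 9, 2, 8, 10, [0, 1, 2, 5, 6, 3, 4, 7, 10, 21, 24, 13, 16, 27, 28, 17, 14, 25, 26, 15, 18, 29,
    30, 19, 8, 11, 22, 23, 12, 9, 20, 31]⟩,
⟨3, 8, 2, 9, 11, [0, 1, 4, 7, 18, 29, 28, 17, 6, 3, 2, 5, 8, 11, 22, 25, 14, 15, 26, 27, 16, 19,
    30, 31, 32, 21, 10, 13, 24, 23, 12, 9, 20]⟩,
⟨4, 7, 1, 8, 12, [0, 1, 4, 7, 6, 3, 2, 5, 8, 19, 30, 31, 20, 9, 12, 23, 24, 13, 10, 21, 32, 33,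
    22, 11, 14, 25, 28, 17, 16, 27, 26, 15, 18, 29]⟩,
⟨5, 6, 2, 11, 13, [0, 1, 2, 5, 16, 27, 24, 13, 10, 7, 4, 3, 6, 17, 28, 31, 20, 9, 8, 19, 30, 29,
    18, 21, 32, 33, 34, 23, 12, 15, 26, 25, 14, 11, 22]⟩,
⟨6, 5, 1, 8, 14, [0, 1, 4, 7, 10, 21, 32, 31, 20, 9, 6, 3, 2, 5, 8, 19, 30, 29, 18, 17, 28, 27,
    16, 13, 24, 35, 34, 23, 12, 15, 26, 25, 14, 11, 22, 33]⟩,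
⟨7, 4, 3, 7, 15, [0, 1, 2, 3, 6, 9, 20, 31, 34, 23, 12, 15, 26, 27, 16, 13, 24, 35, 32, 21, 10,
    11, 22, 33, 36, 25, 14, 17, 28, 29, 30, 19, 8, 5, 4, 7, 18]⟩,
⟨8, 3, 1, 8, 16, [0, 1, 4, 7, 10, 21, 32, 31, 20, 9, 6, 3, 2, 5, 8, 19, 30, 29, 18, 15, 26, 37,
    36, 25, 14, 17, 28, 27, 16, 13, 24, 35, 34, 23, 12, 11, 22, 33]⟩,
⟨9, 2, 2, 16, 16, [0, 1, 2, 5, 6, 3, 4, 7, 8, 19, 30, 29, 18, 15, 26, 37, 34, 23, 12, 11, 22, 33,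
    36, 25, 14, 17, 28, 31, 20, 9, 10, 21, 32, 35, 24, 13, 16, 27, 38]⟩,
⟨10, 1, 1, 4, 10, [0, 1, 4, 15, 16, 5, 2, 3, 6, 17, 20, 9, 12, 23, 34, 35, 24, 13, 14, 25, 36, 37,
    26, 29, 18, 7, 10, 21, 32, 33, 22, 11, 8, 19, 30, 27, 38, 39, 28, 31]⟩,
⟨0, 12, 1, 8, 8, [0, 1, 4, 7, 10, 22, 21, 9, 6, 3, 2, 5, 8, 20, 23, 11, 12, 24, 25, 13, 16, 28,
    29, 17, 14, 26, 27, 15, 18, 30, 31, 19]⟩,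
⟨1, 11, 1, 8, 9, [0, 1, 4, 7, 10, 22, 23, 11, 8, 20, 32, 31, 19, 16, 28, 27, 15, 18, 30, 29, 17,
    14, 26, 25, 13, 12, 24, 21, 9, 6, 3, 2, 5]⟩,
⟨2, 10, 1, 10, 10, [0, 1, 4, 7, 10, 22, 23, 11, 8, 20, 32, 33, 21, 18, 30, 31, 19, 16, 28, 27, 15,
    14, 26, 29, 17, 5, 2, 3, 6, 9, 12, 24, 25, 13]⟩,
⟨3, 9, 2, 11, 11, [0, 1, 2, 5, 17, 29, 32, 20, 21, 33, 30, 18, 6, 3, 4, 7, 8, 11, 23, 26, 14, 15,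
    27, 28, 16, 19, 31, 34, 22, 10, 13, 25, 24, 12, 9]⟩,
⟨4, 8, 1, 8, 12, [0, 1, 4, 7, 6, 3, 2, 5, 8, 20, 32, 33, 21, 9, 12, 24, 27, 15, 16, 28, 25, 13,
    10, 22, 34, 35, 23, 11, 14, 26, 29, 17, 18, 30, 31, 19]⟩,
⟨5, 7, 2, 8, 13, [0, 1, 2, 5, 8, 20, 32, 29, 17, 16, 28, 27, 15, 12, 24, 36, 35, 23, 11, 14, 26,
    25, 13, 10, 22, 34, 31, 19, 18, 30, 33, 21, 9, 6, 3, 4, 7]⟩,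
⟨6, 6, 1, 8, 14, [0, 1, 4, 7, 10, 22, 34, 35, 23, 11, 14, 26, 27, 15, 12, 24, 36, 37, 25, 13, 16,
    28, 29, 17, 18, 30, 33, 21, 9, 6, 3, 2, 5, 8, 20, 32, 31, 19]⟩,
⟨7, 5, 3, 8, 15, [0, 1, 2, 3, 6, 9, 21, 33, 34, 22, 10, 7, 4, 5, 8, 20, 32, 29, 17, 14, 26, 38,
    37, 25, 13, 16, 28, 31, 19, 18, 30, 27, 15, 12, 24, 36, 35, 23, 11]⟩,
⟨8, 4, 1, 8, 16, [0, 1, 4, 7, 10, 22, 34, 35, 23, 11, 12, 24, 36, 37, 25, 13, 16, 28, 29, 17, 14,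
    26, 38, 39, 27, 15, 18, 30, 33, 21, 9, 6, 3, 2, 5, 8, 20, 32, 31, 19]⟩,
⟨9, 3, 1, 8, 17, [0, 1, 4, 7, 10, 22, 34, 35, 23, 11, 12, 24, 36, 33, 21, 9, 6, 3, 2, 5, 8, 20,
    32, 31, 19, 16, 28, 40, 39, 27, 15, 18, 30, 29, 17, 14, 26, 38, 37, 25, 13]⟩,
⟨10, 2, 1, 8, 10, [0, 1, 4, 16, 28, 40, 39, 36, 35, 23, 11, 8, 20, 21, 9, 12, 24, 27, 15, 14, 26,
    38, 41, 29, 17, 5, 2, 3, 6, 18, 30, 33, 32, 31, 19, 7, 10, 22, 34, 37, 25, 13]⟩,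
⟨11, 1, 5, 11, 15, [0, 1, 2, 3, 6, 9, 21, 33, 36, 24, 12, 15, 27, 39, 40, 28, 16, 13, 25, 37, 34,
    22, 10, 7, 4, 5, 8, 20, 32, 31, 19, 18, 30, 42, 41, 29, 17, 14, 26, 38, 35, 23, 11]⟩,
⟨5, 8, 4, 11, 13, [0, 1, 2, 3, 4, 7, 20, 33, 32, 19, 16, 29, 26, 13, 10, 23, 36, 37, 34, 21, 8, 5,
    6, 9, 22, 35, 38, 25, 12, 15, 28, 31, 18, 17, 30, 27, 14, 11, 24]⟩,
⟨7, 6, 1, 11, 15, [0, 1, 4, 5, 2, 3, 6, 7, 20, 33, 30, 17, 14, 27, 40, 39, 36, 23, 10, 11, 24, 37,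
    34, 21, 8, 9, 22, 35, 38, 25, 12, 15, 28, 31, 18, 19, 32, 29, 16, 13, 26]⟩,
⟨7, 8, 4, 11, 15, [0, 1, 2, 3, 4, 7, 22, 37, 36, 21, 18, 33, 30, 15, 12, 27, 42, 39, 24, 9, 6, 5,
    8, 23, 38, 41, 44, 29, 14, 17, 32, 35, 20, 19, 34, 31, 16, 13, 28, 43, 40, 25, 10, 11, 26]⟩]

/-- Seeds with eight edges of length `1` and `y` edges of length `3`. -/
def eightOnesSeeds1 : List Seed := [
⟨0, 7, 3, 9, 9, [0, 1, 2, 3, 6, 9, 16, 17, 10, 7, 4, 5, 8, 11, 18, 19, 12, 15, 22, 21, 14, 13,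
    20]⟩,
⟨1, 6, 1, 6, 10, [0, 1, 4, 5, 2, 3, 6, 13, 14, 7, 10, 17, 20, 21, 22, 23, 16, 9, 12, 19, 18, 11,
    8, 15]⟩,
⟨2, 5, 3, 9, 11, [0, 1, 2, 3, 6, 7, 4, 5, 8, 11, 18, 21, 14, 15, 22, 23, 16, 9, 12, 19, 20, 13,
    10, 17, 24]⟩,
⟨3, 4, 1, 8, 12, [0, 1, 4, 5, 2, 3, 6, 7, 8, 15, 22, 19, 12, 9, 16, 23, 24, 25, 18, 11, 14, 21,
    20, 13, 10, 17]⟩,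
⟨4, 3, 4, 9, 13, [0, 1, 2, 3, 4, 7, 8, 5, 6, 9, 16, 23, 24, 17, 10, 13, 20, 21, 14, 11, 18, 25,
    22, 15, 12, 19, 26]⟩,
⟨5, 2, 1, 6, 10, [0, 1, 4, 5, 2, 3, 6, 13, 14, 7, 10, 17, 24, 27, 20, 21, 22, 23, 16, 9, 12, 19,
    26, 25, 18, 11, 8, 15]⟩,
⟨6, 1, 1, 10, 10, [0, 1, 4, 5, 2, 3, 6, 7, 10, 17, 24, 25, 28, 21, 14, 13, 20, 27, 26, 19, 12, 9,
    16, 23, 22, 15, 8, 11, 18]⟩,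
⟨0, 8, 1, 9, 9, [0, 1, 4, 7, 10, 18, 17, 9, 6, 3, 2, 5, 8, 11, 19, 20, 12, 13, 21, 22, 14, 15, 23,
    24, 16]⟩,
⟨1, 7, 2, 9, 10, [0, 1, 2, 5, 8, 11, 19, 20, 12, 9, 17, 25, 24, 16, 15, 23, 22, 14, 13, 21, 18,
    10, 7, 4, 3, 6]⟩,
⟨2, 6, 1, 9, 11, [0, 1, 4, 7, 6, 3, 2, 5, 8, 11, 19, 20, 12, 9, 17, 25, 26, 18, 10, 13, 21, 22,
    14, 15, 23, 24, 16]⟩,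
⟨3, 5, 3, 10, 12, [0, 1, 2, 5, 8, 9, 12, 20, 21, 13, 10, 18, 26, 27, 19, 11, 14, 22, 25, 17, 16,
    24, 23, 15, 7, 4, 3, 6]⟩,
⟨4, 4, 2, 9, 13, [0, 1, 2, 5, 8, 7, 4, 3, 6, 9, 17, 25, 26, 18, 10, 13, 21, 22, 14, 11, 19, 27,
    28, 20, 12, 15, 23, 24, 16]⟩,
⟨5, 3, 3, 9, 14, [0, 1, 2, 3, 6, 9, 17, 25, 24, 16, 13, 21, 29, 28, 20, 12, 15, 23, 22, 14, 11,
    19, 27, 26, 18, 10, 7, 4, 5, 8]⟩,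
⟨6, 2, 1, 9, 9, [0, 1, 4, 5, 2, 3, 6, 9, 17, 25, 26, 29, 30, 22, 14, 13, 21, 18, 10, 7, 15, 23,
    24, 16, 8, 11, 19, 27, 28, 20, 12]⟩,
⟨7, 1, 1, 8, 10, [0, 1, 4, 7, 10, 18, 26, 27, 28, 20, 12, 9, 17, 25, 24, 16, 8, 11, 19, 22, 14,
    15, 23, 31, 30, 29, 21, 13, 5, 2, 3, 6]⟩,
⟨0, 9, 3, 9, 9, [0, 1, 2, 3, 6, 9, 18, 19, 10, 7, 4, 5, 8, 11, 20, 23, 14, 15, 24, 21, 12, 13, 22,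
    25, 16, 17, 26]⟩,
⟨1, 8, 2, 8, 10, [0, 1, 2, 5, 6, 3, 4, 7, 10, 19, 22, 13, 16, 25, 24, 15, 14, 23, 26, 27, 18, 9,
    12, 21, 20, 11, 8, 17]⟩,
⟨2, 7, 1, 9, 11, [0, 1, 4, 7, 6, 3, 2, 5, 8, 11, 20, 21, 12, 9, 18, 27, 28, 19, 10, 13, 22, 23,
    14, 17, 26, 25, 16, 15, 24]⟩,
⟨3, 6, 1, 6, 12, [0, 1, 4, 7, 16, 25, 24, 23, 14, 11, 20, 19, 10, 13, 22, 21, 12, 9, 18, 27, 28,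
    29, 26, 17, 8, 5, 2, 3, 6, 15]⟩,
⟨4, 5, 1, 9, 13, [0, 1, 4, 7, 8, 5, 2, 3, 6, 9, 18, 27, 26, 17, 16, 25, 24, 15, 12, 21, 30, 29,
    20, 11, 14, 23, 22, 13, 10, 19, 28]⟩,
⟨5, 4, 3, 9, 14, [0, 1, 2, 3, 6, 9, 18, 27, 28, 19, 10, 7, 4, 5, 8, 17, 26, 23, 14, 11, 20, 29,
    30, 31, 22, 13, 16, 25, 24, 15, 12, 21]⟩,
⟨6, 3, 3, 9, 15, [0, 1, 2, 3, 6, 9, 18, 27, 26, 17, 14, 23, 32, 31, 22, 13, 16, 25, 24, 15, 12,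
    21, 30, 29, 20, 11, 8, 5, 4, 7, 10, 19, 28]⟩,
⟨7, 2, 1, 5, 10, [0, 1, 4, 13, 22, 25, 16, 7, 10, 19, 28, 29, 20, 11, 8, 17, 18, 9, 12, 21, 30,
    31, 32, 33, 24, 27, 26, 23, 14, 5, 2, 3, 6, 15]⟩,
⟨8, 1, 1, 4, 10, [0, 1, 4, 13, 14, 5, 2, 3, 6, 15, 16, 7, 10, 19, 28, 29, 30, 21, 12, 9, 18, 27,
    24, 33, 34, 25, 22, 31, 32, 23, 20, 11, 8, 17, 26]⟩,
⟨0, 10, 1, 9, 9, [0, 1, 4, 7, 10, 20, 19, 9, 6, 3, 2, 5, 8, 11, 21, 22, 12, 13, 23, 24, 14, 17,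
    27, 28, 18, 15, 25, 26, 16]⟩,
⟨1, 9, 2, 9, 10, [0, 1, 2, 5, 8, 11, 21, 22, 12, 9, 19, 29, 28, 18, 17, 27, 24, 14, 15, 25, 26,
    16, 13, 23, 20, 10, 7, 4, 3, 6]⟩,
⟨2, 8, 1, 9, 11, [0, 1, 4, 7, 6, 3, 2, 5, 8, 11, 21, 22, 12, 9, 19, 29, 30, 20, 10, 13, 23, 24,
    14, 17, 27, 28, 18, 15, 25, 26, 16]⟩,
⟨3, 7, 1, 10, 12, [0, 1, 4, 7, 6, 3, 2, 5, 15, 25, 24, 14, 11, 21, 31, 28, 18, 19, 29, 26, 16, 17,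
    27, 30, 20, 10, 13, 23, 22, 12, 9, 8]⟩,
⟨4, 6, 1, 9, 13, [0, 1, 4, 7, 8, 5, 2, 3, 6, 9, 19, 29, 30, 20, 10, 13, 23, 24, 14, 11, 21, 31,
    32, 22, 12, 15, 25, 28, 18, 17, 27, 26, 16]⟩,
⟨5, 5, 1, 9, 14, [0, 1, 4, 7, 10, 20, 30, 31, 21, 11, 14, 24, 25, 15, 12, 22, 32, 33, 23, 13, 16,
    26, 27, 17, 18, 28, 29, 19, 9, 6, 3, 2, 5, 8]⟩,
⟨6, 4, 4, 9, 15, [0, 1, 2, 3, 4, 7, 10, 20, 30, 29, 19, 9, 6, 5, 8, 11, 21, 31, 34, 24, 14, 17,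
    27, 26, 16, 13, 23, 33, 32, 22, 12, 15, 25, 28, 18]⟩,
⟨7, 3, 2, 9, 16, [0, 1, 2, 5, 8, 11, 21, 31, 30, 20, 10, 7, 4, 3, 6, 9, 19, 29, 28, 18, 15, 25,
    35, 34, 24, 14, 17, 27, 26, 16, 13, 23, 33, 32, 22, 12]⟩,
⟨8, 2, 2, 10, 11, [0, 1, 4, 7, 8, 11, 21, 31, 32, 33, 36, 26, 16, 6, 3, 2, 5, 15, 25, 35, 34, 24,
    14, 17, 27, 30, 20, 10, 13, 23, 22, 12, 9, 19, 29, 28, 18]⟩,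
⟨9, 1, 2, 6, 12, [0, 1, 2, 5, 15, 25, 35, 32, 22, 12, 9, 19, 29, 30, 31, 21, 11, 14, 24, 34, 37,
    36, 33, 23, 13, 10, 20, 17, 7, 4, 3, 6, 16, 26, 27, 28, 18, 8]⟩,
⟨0, 11, 3, 9, 9, [0, 1, 2, 3, 6, 9, 20, 23, 12, 13, 24, 21, 10, 7, 4, 5, 8, 11, 22, 25, 14, 15,
    26, 29, 18, 19, 30, 27, 16, 17, 28]⟩,
⟨1, 10, 1, 6, 10, [0, 1, 4, 5, 2, 3, 6, 17, 20, 9, 12, 23, 26, 15, 14, 25, 24, 13, 16, 27, 30, 31,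
    28, 29, 18, 7, 10, 21, 22, 11, 8, 19]⟩,
⟨2, 9, 1, 9, 11, [0, 1, 4, 7, 6, 3, 2, 5, 8, 11, 22, 23, 12, 9, 20, 31, 30, 19, 16, 27, 26, 15,
    18, 29, 28, 17, 14, 25, 24, 13, 10, 21, 32]⟩,
⟨3, 8, 1, 5, 12, [0, 1, 4, 15, 26, 29, 28, 25, 14, 11, 22, 19, 8, 7, 18, 17, 6, 3, 2, 5, 16, 27,
    30, 33, 32, 31, 20, 9, 12, 23, 24, 13, 10, 21]⟩,
⟨4, 7, 1, 9, 13, [0, 1, 4, 7, 8, 5, 2, 3, 6, 9, 20, 31, 32, 21, 10, 13, 24, 25, 14, 11, 22, 33,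
    34, 23, 12, 15, 26, 29, 18, 17, 28, 27, 16, 19, 30]⟩,
⟨5, 6, 3, 6, 14, [0, 1, 2, 5, 8, 19, 18, 7, 4, 3, 6, 17, 28, 27, 16, 13, 24, 35, 32, 29, 30, 33,
    22, 11, 14, 25, 26, 15, 12, 23, 34, 31, 20, 9, 10, 21]⟩,
⟨6, 5, 1, 9, 15, [0, 1, 4, 7, 10, 21, 32, 33, 22, 11, 8, 5, 2, 3, 6, 9, 20, 31, 30, 19, 18, 29,
    28, 17, 14, 25, 36, 35, 24, 13, 16, 27, 26, 15, 12, 23, 34]⟩,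
⟨7, 4, 3, 8, 16, [0, 1, 2, 3, 6, 9, 20, 31, 34, 23, 12, 11, 22, 33, 30, 29, 18, 15, 26, 37, 36,
    25, 14, 17, 28, 27, 16, 13, 24, 35, 32, 21, 10, 7, 4, 5, 8, 19]⟩,
⟨8, 3, 1, 9, 17, [0, 1, 4, 7, 10, 21, 32, 33, 22, 11, 8, 5, 2, 3, 6, 9, 20, 31, 30, 19, 16, 27,
    38, 37, 26, 15, 18, 29, 28, 17, 14, 25, 36, 35, 24, 13, 12, 23, 34]⟩,
⟨9, 2, 1, 6, 11, [0, 1, 4, 7, 18, 17, 6, 3, 2, 5, 16, 27, 38, 35, 24, 13, 10, 21, 20, 9, 12, 23,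
    34, 37, 26, 15, 14, 25, 36, 33, 22, 11, 8, 19, 30, 31, 32, 29, 28, 39]⟩,
⟨10, 1, 2, 6, 11, [0, 1, 4, 7, 18, 29, 40, 37, 36, 39, 28, 17, 6, 3, 2, 5, 16, 27, 38, 35, 34, 33,
    22, 11, 8, 19, 30, 31, 20, 9, 12, 23, 26, 15, 14, 25, 24, 13, 10, 21, 32]⟩,
⟨0, 12, 3, 9, 9, [0, 1, 2, 3, 6, 9, 21, 24, 12, 13, 25, 22, 10, 7, 4, 5, 8, 11, 23, 26, 14, 15,
    27, 30, 18, 19, 31, 28, 16, 17, 29, 32, 20]⟩,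
⟨1, 11, 1, 9, 10, [0, 1, 4, 7, 10, 22, 25, 13, 14, 26, 27, 15, 18, 30, 31, 19, 16, 28, 29, 17, 20,
    32, 33, 21, 9, 12, 24, 23, 11, 8, 5, 2, 3, 6]⟩,
⟨2, 10, 1, 9, 11, [0, 1, 4, 7, 6, 3, 2, 5, 8, 11, 23, 24, 12, 9, 21, 33, 34, 22, 10, 13, 25, 28,
    16, 19, 31, 32, 20, 17, 29, 30, 18, 15, 27, 26, 14]⟩,
⟨3, 9, 4, 10, 12, [0, 1, 2, 3, 6, 9, 12, 24, 27, 15, 16, 28, 25, 13, 10, 22, 34, 35, 23, 11, 14,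
    26, 29, 17, 20, 32, 33, 21, 18, 30, 31, 19, 7, 4, 5, 8]⟩,
⟨4, 8, 1, 9, 13, [0, 1, 4, 7, 8, 5, 2, 3, 6, 9, 21, 33, 34, 22, 10, 13, 25, 28, 16, 17, 29, 26,
    14, 11, 23, 35, 36, 24, 12, 15, 27, 30, 18, 19, 31, 32, 20]⟩,
⟨5, 7, 1, 9, 14, [0, 1, 4, 7, 10, 22, 34, 35, 23, 11, 14, 26, 27, 15, 12, 24, 36, 37, 25, 13, 16,
    28, 31, 19, 18, 30, 29, 17, 20, 32, 33, 21, 9, 6, 3, 2, 5, 8]⟩,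
⟨6, 6, 1, 9, 15, [0, 1, 4, 7, 10, 22, 34, 33, 21, 9, 6, 3, 2, 5, 8, 11, 23, 35, 36, 24, 12, 15,
    27, 28, 16, 13, 25, 37, 38, 26, 14, 17, 29, 32, 20, 19, 31, 30, 18]⟩,
⟨7, 5, 1, 9, 16, [0, 1, 4, 7, 10, 22, 34, 33, 21, 9, 6, 3, 2, 5, 8, 11, 23, 35, 32, 20, 19, 31,
    30, 18, 15, 27, 39, 38, 26, 14, 17, 29, 28, 16, 13, 25, 37, 36, 24, 12]⟩,
⟨8, 4, 1, 9, 17, [0, 1, 4, 7, 10, 22, 34, 31, 19, 16, 28, 40, 39, 27, 15, 18, 30, 29, 17, 14, 26,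
    38, 37, 25, 13, 12, 24, 36, 35, 23, 11, 8, 5, 2, 3, 6, 9, 21, 33, 32, 20]⟩,
⟨9, 3, 1, 9, 18, [0, 1, 4, 7, 10, 22, 34, 33, 21, 9, 6, 3, 2, 5, 8, 11, 23, 35, 32, 20, 17, 29,
    41, 40, 28, 16, 19, 31, 30, 18, 15, 27, 39, 38, 26, 14, 13, 25, 37, 36, 24, 12]⟩,
⟨10, 2, 4, 7, 15, [0, 1, 2, 3, 6, 9, 21, 33, 36, 24, 12, 15, 27, 39, 42, 41, 40, 28, 16, 13, 25,
    37, 34, 22, 10, 11, 23, 35, 38, 26, 14, 17, 29, 32, 20, 8, 5, 4, 7, 19, 31, 30, 18]⟩,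
⟨11, 1, 4, 14, 18, [0, 1, 4, 7, 10, 22, 34, 35, 23, 11, 8, 5, 2, 3, 6, 9, 21, 33, 32, 20, 17, 29,
    41, 40, 28, 16, 19, 31, 43, 42, 30, 18, 15, 27, 39, 36, 24, 12, 13, 25, 37, 38, 26, 14]⟩,
⟨5, 8, 5, 12, 14, [0, 1, 2, 3, 4, 5, 8, 21, 34, 37, 24, 11, 14, 27, 30, 17, 20, 33, 36, 23, 10, 7,
    6, 9, 22, 35, 38, 39, 26, 13, 16, 29, 32, 19, 18, 31, 28, 15, 12, 25]⟩]

/-- Seeds with eight edges of length `1` and `y + 1` edges of length `3`. -/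
def eightOnesSeeds2 : List Seed := [
⟨0, 7, 4, 10, 10, [0, 1, 2, 3, 4, 7, 10, 17, 18, 11, 8, 5, 6, 9, 12, 19, 22, 15, 16, 23, 20, 13,
    14, 21]⟩,
⟨1, 6, 1, 7, 11, [0, 1, 4, 5, 2, 3, 6, 7, 14, 17, 10, 13, 20, 21, 24, 23, 22, 15, 8, 11, 18, 19,
    12, 9, 16]⟩,
⟨2, 5, 2, 10, 12, [0, 1, 2, 5, 8, 7, 4, 3, 6, 9, 12, 19, 20, 13, 10, 17, 24, 23, 16, 15, 22, 21,
    14, 11, 18, 25]⟩,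
⟨3, 4, 2, 9, 13, [0, 1, 2, 5, 6, 3, 4, 7, 8, 9, 16, 23, 26, 19, 12, 15, 22, 25, 24, 17, 10, 13,
    20, 21, 14, 11, 18]⟩,
⟨4, 3, 3, 10, 14, [0, 1, 2, 3, 6, 9, 8, 5, 4, 7, 10, 17, 24, 23, 16, 13, 20, 27, 26, 19, 12, 15,
    22, 21, 14, 11, 18, 25]⟩,
⟨5, 2, 1, 6, 10, [0, 1, 4, 5, 2, 3, 6, 13, 14, 7, 10, 17, 18, 11, 8, 15, 22, 23, 16, 9, 12, 19,
    26, 25, 28, 21, 20, 27, 24]⟩,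
⟨6, 1, 1, 6, 10, [0, 1, 4, 5, 2, 3, 6, 13, 14, 7, 10, 17, 24, 25, 18, 11, 8, 15, 16, 9, 12, 19,
    26, 29, 22, 23, 20, 27, 28, 21]⟩,
⟨0, 8, 4, 10, 10, [0, 1, 2, 3, 4, 7, 10, 18, 19, 11, 8, 5, 6, 9, 12, 20, 23, 15, 16, 24, 21, 13,
    14, 22, 25, 17]⟩,
⟨1, 7, 2, 10, 11, [0, 1, 2, 5, 8, 11, 19, 22, 14, 15, 23, 24, 16, 17, 25, 26, 18, 10, 13, 21, 20,
    12, 9, 6, 3, 4, 7]⟩,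
⟨2, 6, 1, 10, 12, [0, 1, 4, 7, 8, 5, 2, 3, 6, 9, 12, 20, 21, 13, 10, 18, 26, 27, 19, 11, 14, 22,
    23, 15, 16, 24, 25, 17]⟩,
⟨3, 5, 1, 11, 13, [0, 1, 4, 5, 2, 3, 6, 9, 8, 16, 24, 25, 17, 18, 26, 23, 15, 12, 20, 28, 27, 19,
    11, 14, 22, 21, 13, 10, 7]⟩,
⟨4, 4, 2, 10, 14, [0, 1, 2, 5, 8, 9, 6, 3, 4, 7, 10, 18, 26, 27, 19, 11, 14, 22, 23, 15, 12, 20,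
    28, 29, 21, 13, 16, 24, 25, 17]⟩,
⟨5, 3, 5, 10, 15, [0, 1, 2, 3, 4, 5, 8, 11, 19, 27, 30, 22, 14, 17, 25, 24, 16, 13, 21, 29, 28,
    20, 12, 15, 23, 26, 18, 10, 7, 6, 9]⟩,
⟨6, 2, 3, 8, 12, [0, 1, 2, 3, 6, 7, 4, 5, 8, 16, 19, 11, 14, 22, 30, 29, 21, 13, 10, 18, 26, 27,
    24, 25, 17, 9, 12, 20, 28, 31, 23, 15]⟩,
⟨7, 1, 1, 9, 9, [0, 1, 4, 7, 10, 18, 26, 25, 28, 27, 19, 11, 8, 16, 24, 32, 31, 23, 15, 14, 22,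
    30, 29, 21, 13, 12, 20, 17, 9, 6, 3, 2, 5]⟩,
⟨0, 9, 1, 10, 10, [0, 1, 4, 7, 10, 19, 20, 11, 8, 5, 2, 3, 6, 9, 12, 21, 22, 13, 14, 23, 24, 15,
    18, 27, 26, 17, 16, 25]⟩,
⟨1, 8, 3, 9, 11, [0, 1, 2, 3, 6, 7, 4, 5, 8, 11, 20, 23, 14, 17, 26, 27, 28, 19, 10, 13, 22, 25,
    16, 15, 24, 21, 12, 9, 18]⟩,
⟨2, 7, 1, 10, 12, [0, 1, 4, 7, 8, 5, 2, 3, 6, 9, 12, 21, 22, 13, 10, 19, 28, 29, 20, 11, 14, 23,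
    24, 15, 18, 27, 26, 17, 16, 25]⟩,
⟨3, 6, 2, 8, 13, [0, 1, 2, 5, 8, 17, 20, 11, 14, 23, 22, 13, 10, 19, 28, 27, 26, 29, 30, 21, 12,
    15, 24, 25, 16, 7, 4, 3, 6, 9, 18]⟩,
⟨4, 5, 2, 10, 14, [0, 1, 2, 5, 8, 9, 6, 3, 4, 7, 10, 19, 28, 29, 20, 11, 14, 23, 24, 15, 12, 21,
    30, 27, 18, 17, 26, 25, 16, 13, 22, 31]⟩,
⟨5, 4, 6, 9, 15, [0, 1, 4, 3, 2, 5, 6, 9, 18, 27, 24, 15, 12, 21, 30, 29, 20, 11, 8, 7, 10, 19,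
    28, 31, 32, 23, 14, 17, 26, 25, 16, 13, 22]⟩,
⟨6, 3, 3, 10, 16, [0, 1, 2, 3, 6, 9, 12, 21, 30, 29, 20, 11, 8, 5, 4, 7, 10, 19, 28, 27, 18, 15,
    24, 33, 32, 23, 14, 17, 26, 25, 16, 13, 22, 31]⟩,
⟨7, 2, 1, 6, 11, [0, 1, 4, 7, 16, 15, 6, 3, 2, 5, 14, 23, 26, 17, 8, 11, 20, 29, 30, 31, 32, 33,
    24, 27, 18, 9, 12, 21, 22, 13, 10, 19, 28, 25, 34]⟩,
⟨8, 1, 2, 5, 11, [0, 1, 4, 7, 16, 25, 24, 23, 14, 5, 2, 3, 6, 15, 18, 9, 12, 21, 30, 33, 34, 35,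
    26, 17, 8, 11, 20, 29, 32, 31, 22, 13, 10, 19, 28, 27]⟩,
⟨0, 10, 1, 10, 10, [0, 1, 4, 7, 10, 20, 21, 11, 8, 5, 2, 3, 6, 9, 12, 22, 23, 13, 14, 24, 25, 15,
    18, 28, 29, 19, 16, 26, 27, 17]⟩,
⟨1, 9, 2, 10, 11, [0, 1, 2, 5, 8, 11, 21, 24, 14, 17, 27, 26, 16, 15, 25, 28, 18, 19, 29, 30, 20,
    10, 13, 23, 22, 12, 9, 6, 3, 4, 7]⟩,
⟨2, 8, 1, 10, 12, [0, 1, 4, 7, 8, 5, 2, 3, 6, 9, 12, 22, 23, 13, 10, 20, 30, 31, 21, 11, 14, 24,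
    25, 15, 18, 28, 29, 19, 16, 26, 27, 17]⟩,
⟨3, 7, 1, 11, 13, [0, 1, 4, 7, 8, 5, 2, 3, 6, 16, 26, 25, 15, 12, 22, 32, 29, 19, 20, 30, 27, 17,
    18, 28, 31, 21, 11, 14, 24, 23, 13, 10, 9]⟩,
⟨4, 6, 2, 10, 14, [0, 1, 2, 5, 8, 9, 6, 3, 4, 7, 10, 20, 30, 33, 23, 13, 16, 26, 25, 15, 12, 22,
    32, 31, 21, 11, 14, 24, 27, 17, 18, 28, 29, 19]⟩,
⟨5, 5, 1, 10, 15, [0, 1, 4, 7, 10, 20, 30, 29, 19, 18, 28, 27, 17, 14, 24, 34, 33, 23, 13, 16, 26,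
    25, 15, 12, 22, 32, 31, 21, 11, 8, 5, 2, 3, 6, 9]⟩,
⟨6, 4, 2, 10, 16, [0, 1, 2, 5, 8, 11, 21, 31, 30, 20, 10, 7, 4, 3, 6, 9, 12, 22, 32, 33, 23, 13,
    16, 26, 27, 17, 14, 24, 34, 35, 25, 15, 18, 28, 29, 19]⟩,
⟨7, 3, 2, 10, 17, [0, 1, 2, 5, 8, 11, 21, 31, 32, 22, 12, 9, 6, 3, 4, 7, 10, 20, 30, 29, 19, 16,
    26, 36, 35, 25, 15, 18, 28, 27, 17, 14, 24, 34, 33, 23, 13]⟩,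
⟨8, 2, 2, 8, 8, [0, 1, 4, 7, 10, 20, 30, 29, 19, 9, 6, 3, 2, 5, 8, 18, 28, 31, 21, 11, 12, 22, 23,
    13, 16, 26, 36, 37, 27, 17, 14, 24, 34, 33, 32, 35, 25, 15]⟩,
⟨9, 1, 1, 6, 11, [0, 1, 4, 14, 24, 34, 31, 21, 11, 8, 18, 19, 9, 12, 22, 32, 35, 38, 37, 27, 26,
    36, 33, 23, 13, 10, 20, 30, 29, 28, 25, 15, 5, 2, 3, 6, 16, 17, 7]⟩,
⟨0, 11, 1, 10, 10, [0, 1, 4, 7, 10, 21, 22, 11, 8, 5, 2, 3, 6, 9, 12, 23, 24, 13, 16, 27, 28, 17,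
    14, 25, 26, 15, 18, 29, 30, 19, 20, 31]⟩,
⟨1, 10, 1, 5, 11, [0, 1, 4, 7, 18, 21, 10, 13, 24, 25, 14, 15, 26, 29, 32, 31, 30, 27, 28, 17, 6,
    3, 2, 5, 16, 19, 8, 11, 22, 23, 12, 9, 20]⟩,
⟨2, 9, 1, 10, 12, [0, 1, 4, 7, 8, 5, 2, 3, 6, 9, 12, 23, 24, 13, 10, 21, 32, 31, 20, 17, 28, 27,
    16, 19, 30, 29, 18, 15, 26, 25, 14, 11, 22, 33]⟩,
⟨3, 8, 4, 8, 13, [0, 1, 2, 3, 4, 7, 18, 29, 26, 15, 12, 23, 20, 9, 6, 5, 8, 19, 30, 33, 34, 31,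
    32, 21, 10, 13, 24, 27, 16, 17, 28, 25, 14, 11, 22]⟩,
⟨4, 7, 2, 10, 14, [0, 1, 2, 5, 8, 9, 6, 3, 4, 7, 10, 21, 32, 35, 24, 13, 16, 27, 28, 17, 20, 31,
    30, 19, 18, 29, 26, 15, 12, 23, 34, 33, 22, 11, 14, 25]⟩,
⟨5, 6, 2, 13, 15, [0, 1, 4, 7, 18, 29, 28, 17, 14, 25, 36, 35, 32, 21, 10, 11, 22, 33, 34, 23, 20,
    31, 30, 19, 8, 5, 2, 3, 6, 9, 12, 15, 26, 27, 16, 13, 24]⟩,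
⟨6, 5, 1, 10, 16, [0, 1, 4, 7, 10, 21, 32, 31, 20, 19, 30, 29, 18, 15, 26, 37, 36, 25, 14, 17, 28,
    27, 16, 13, 24, 35, 34, 23, 12, 9, 6, 3, 2, 5, 8, 11, 22, 33]⟩,
⟨7, 4, 1, 10, 17, [0, 1, 4, 7, 10, 21, 32, 31, 20, 9, 6, 3, 2, 5, 8, 11, 22, 33, 30, 19, 16, 27,
    38, 37, 26, 15, 18, 29, 28, 17, 14, 25, 36, 35, 34, 23, 12, 13, 24]⟩,
⟨8, 3, 1, 10, 18, [0, 1, 4, 7, 10, 21, 32, 31, 20, 17, 28, 39, 38, 27, 16, 19, 30, 29, 18, 15, 26,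
    37, 36, 25, 14, 13, 24, 35, 34, 23, 12, 9, 6, 3, 2, 5, 8, 11, 22, 33]⟩,
⟨9, 2, 1, 8, 14, [0, 1, 4, 7, 18, 29, 26, 15, 12, 23, 34, 31, 30, 33, 22, 11, 14, 25, 36, 37, 38,
    27, 16, 13, 24, 35, 32, 21, 10, 9, 20, 19, 8, 5, 2, 3, 6, 17, 28, 39, 40]⟩,
⟨10, 1, 1, 6, 10, [0, 1, 4, 15, 26, 37, 40, 41, 30, 19, 8, 11, 22, 25, 14, 13, 24, 23, 12, 9, 20,
    31, 28, 17, 6, 3, 2, 5, 16, 27, 38, 39, 36, 33, 34, 35, 32, 21, 10, 7, 18, 29]⟩,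
⟨0, 12, 1, 10, 10, [0, 1, 4, 7, 10, 22, 23, 11, 8, 5, 2, 3, 6, 9, 12, 24, 27, 15, 14, 26, 25, 13,
    16, 28, 29, 17, 20, 32, 33, 21, 18, 30, 31, 19]⟩,
⟨1, 11, 2, 10, 11, [0, 1, 2, 5, 8, 11, 23, 26, 14, 17, 29, 28, 16, 15, 27, 30, 18, 21, 33, 32, 20,
    19, 31, 34, 22, 10, 13, 25, 24, 12, 9, 6, 3, 4, 7]⟩,
⟨2, 10, 1, 10, 12, [0, 1, 4, 7, 8, 5, 2, 3, 6, 9, 12, 24, 25, 13, 10, 22, 34, 35, 23, 11, 14, 26,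
    29, 17, 20, 32, 33, 21, 18, 30, 31, 19, 16, 28, 27, 15]⟩,
⟨3, 9, 2, 13, 13, [0, 1, 4, 7, 19, 31, 32, 20, 23, 35, 36, 24, 21, 33, 34, 22, 10, 13, 25, 28, 16,
    17, 29, 30, 18, 6, 3, 2, 5, 8, 11, 14, 26, 27, 15, 12, 9]⟩,
⟨4, 8, 2, 10, 14, [0, 1, 2, 5, 8, 9, 6, 3, 4, 7, 10, 22, 34, 37, 25, 13, 16, 28, 27, 15, 12, 24,
    36, 35, 23, 11, 14, 26, 29, 17, 20, 32, 33, 21, 18, 30, 31, 19]⟩,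
⟨5, 7, 1, 10, 15, [0, 1, 4, 7, 10, 22, 34, 33, 21, 18, 30, 31, 19, 20, 32, 29, 17, 14, 26, 38, 37,
    25, 13, 16, 28, 27, 15, 12, 24, 36, 35, 23, 11, 8, 5, 2, 3, 6, 9]⟩,
⟨6, 6, 1, 10, 16, [0, 1, 4, 7, 10, 22, 34, 35, 23, 11, 8, 5, 2, 3, 6, 9, 12, 24, 36, 37, 25, 13,
    16, 28, 29, 17, 14, 26, 38, 39, 27, 15, 18, 30, 33, 21, 20, 32, 31, 19]⟩,
⟨7, 5, 1, 10, 17, [0, 1, 4, 7, 10, 22, 34, 35, 23, 11, 8, 5, 2, 3, 6, 9, 12, 24, 36, 33, 21, 20,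
    32, 31, 19, 16, 28, 40, 39, 27, 15, 18, 30, 29, 17, 14, 26, 38, 37, 25, 13]⟩,
⟨8, 4, 2, 10, 18, [0, 1, 2, 5, 8, 11, 23, 35, 34, 22, 10, 7, 4, 3, 6, 9, 12, 24, 36, 37, 25, 13,
    14, 26, 38, 41, 29, 17, 20, 32, 31, 19, 16, 28, 40, 39, 27, 15, 18, 30, 33, 21]⟩,
⟨9, 3, 1, 10, 19, [0, 1, 4, 7, 10, 22, 34, 35, 23, 11, 8, 5, 2, 3, 6, 9, 12, 24, 36, 33, 21, 18,
    30, 42, 41, 29, 17, 20, 32, 31, 19, 16, 28, 40, 39, 27, 15, 14, 26, 38, 37, 25, 13]⟩,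
⟨10, 2, 2, 10, 10, [0, 1, 2, 5, 17, 29, 41, 42, 43, 40, 28, 16, 19, 31, 30, 18, 21, 33, 32, 20, 8,
    11, 23, 35, 38, 26, 14, 15, 27, 39, 36, 24, 12, 9, 6, 3, 4, 7, 10, 22, 34, 37, 25, 13]⟩,
⟨11, 1, 4, 10, 19, [0, 1, 2, 5, 8, 7, 4, 3, 6, 9, 12, 24, 36, 33, 21, 18, 30, 42, 41, 29, 17, 20,
    32, 44, 43, 31, 19, 16, 28, 40, 37, 25, 13, 10, 22, 34, 35, 23, 11, 14, 26, 38, 39, 27, 15]⟩,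
⟨5, 8, 6, 11, 15, [0, 1, 2, 3, 4, 5, 6, 9, 22, 35, 38, 25, 12, 15, 28, 31, 18, 21, 34, 37, 40, 27,
    14, 17, 30, 33, 20, 19, 32, 29, 16, 13, 26, 39, 36, 23, 10, 7, 8, 11, 24]⟩]

/-- Seeds with five edges of length `1` and `y` edges of length `3`. -/
def fiveOnesSeeds0 : List Seed := [
⟨0, 4, 1, 6, 0, [0, 1, 4, 5, 2, 3, 6, 10, 13, 9, 8, 12, 11, 7]⟩,
⟨1, 3, 2, 6, 0, [0, 1, 2, 5, 8, 12, 11, 7, 4, 3, 6, 10, 14, 13, 9]⟩,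
⟨0, 5, 1, 6, 0, [0, 1, 4, 7, 12, 11, 6, 3, 2, 5, 8, 13, 14, 9, 10, 15]⟩,
⟨1, 4, 1, 6, 0, [0, 1, 4, 7, 12, 13, 8, 5, 2, 3, 6, 11, 16, 15, 10, 9, 14]⟩,
⟨0, 6, 1, 6, 0, [0, 1, 4, 7, 13, 14, 8, 5, 2, 3, 6, 12, 15, 9, 10, 16, 17, 11]⟩,
⟨1, 5, 1, 6, 0, [0, 1, 4, 7, 13, 16, 10, 9, 15, 14, 8, 5, 2, 3, 6, 12, 18, 17, 11]⟩,
⟨0, 7, 1, 6, 10, [0, 1, 4, 5, 2, 3, 6, 13, 16, 9, 12, 19, 18, 11, 8, 15, 14, 7, 10, 17]⟩,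
⟨1, 6, 1, 7, 10, [0, 1, 4, 5, 2, 3, 6, 13, 20, 17, 10, 7, 14, 15, 8, 11, 18, 19, 12, 9, 16]⟩,
⟨0, 8, 1, 6, 10, [0, 1, 4, 5, 2, 3, 6, 14, 17, 9, 12, 20, 19, 11, 8, 16, 15, 7, 10, 18, 21, 13]⟩,
⟨1, 7, 1, 6, 11, [0, 1, 4, 5, 2, 3, 6, 14, 22, 19, 11, 8, 16, 17, 9, 12, 20, 21, 13, 10, 18, 15,
    7]⟩,
⟨0, 9, 1, 6, 12, [0, 1, 4, 7, 16, 17, 8, 5, 2, 3, 6, 15, 18, 9, 12, 21, 22, 13, 10, 19, 20, 11,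
    14, 23]⟩,
⟨1, 8, 1, 7, 8, [0, 1, 4, 13, 22, 21, 12, 15, 24, 23, 14, 11, 20, 17, 8, 5, 2, 3, 6, 9, 18, 19,
    10, 7, 16]⟩,
⟨0, 10, 1, 4, 10, [0, 1, 4, 14, 15, 5, 2, 3, 6, 16, 19, 9, 12, 22, 25, 24, 21, 11, 8, 18, 17, 7,
    10, 20, 23, 13]⟩,
⟨1, 9, 1, 6, 11, [0, 1, 4, 7, 17, 18, 8, 11, 21, 24, 14, 15, 25, 22, 12, 9, 19, 20, 10, 13, 23,
    26, 16, 6, 3, 2, 5]⟩,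
⟨0, 11, 1, 6, 14, [0, 1, 4, 7, 18, 21, 10, 9, 20, 17, 6, 3, 2, 5, 8, 19, 22, 11, 14, 25, 26, 15,
    12, 23, 24, 13, 16, 27]⟩,
⟨1, 10, 1, 7, 8, [0, 1, 4, 15, 26, 23, 12, 13, 24, 27, 16, 17, 28, 25, 14, 11, 22, 19, 8, 5, 2, 3,
    6, 9, 20, 21, 10, 7, 18]⟩,
⟨0, 12, 1, 6, 12, [0, 1, 4, 7, 19, 22, 10, 13, 25, 24, 12, 9, 21, 18, 6, 3, 2, 5, 8, 20, 23, 11,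
    14, 26, 29, 17, 16, 28, 27, 15]⟩,
⟨1, 11, 2, 6, 15, [0, 1, 4, 7, 19, 20, 8, 11, 23, 26, 14, 17, 29, 28, 16, 13, 25, 22, 10, 9, 21,
    24, 12, 15, 27, 30, 18, 6, 3, 2, 5]⟩]

/-- Seeds with five edges of length `1` and `y + 1` edges of length `3`. -/
def fiveOnesSeeds1 : List Seed := [
⟨0, 4, 2, 7, 0, [0, 1, 2, 5, 8, 12, 11, 7, 4, 3, 6, 9, 13, 14, 10]⟩,
⟨1, 3, 2, 7, 0, [0, 1, 2, 5, 8, 12, 13, 9, 6, 3, 4, 7, 11, 15, 14, 10]⟩,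
⟨0, 5, 1, 7, 7, [0, 1, 4, 7, 12, 13, 8, 5, 2, 3, 6, 9, 14, 15, 10, 11, 16]⟩,
⟨1, 4, 1, 8, 9, [0, 1, 4, 5, 2, 3, 6, 9, 14, 15, 10, 7, 12, 17, 16, 11, 8, 13]⟩,
⟨0, 6, 1, 7, 7, [0, 1, 4, 7, 13, 14, 8, 5, 2, 3, 6, 9, 15, 18, 12, 11, 17, 16, 10]⟩,
⟨1, 5, 1, 7, 0, [0, 1, 4, 7, 13, 19, 18, 12, 11, 17, 14, 8, 5, 2, 3, 6, 9, 15, 16, 10]⟩,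
⟨0, 7, 1, 7, 7, [0, 1, 4, 7, 14, 15, 8, 5, 2, 3, 6, 9, 16, 19, 12, 11, 18, 17, 10, 13, 20]⟩,
⟨1, 6, 1, 8, 9, [0, 1, 4, 7, 10, 17, 16, 9, 6, 3, 2, 5, 12, 19, 20, 13, 14, 21, 18, 11, 8, 15]⟩,
⟨0, 8, 1, 7, 9, [0, 1, 4, 5, 2, 3, 6, 9, 17, 20, 12, 13, 21, 18, 10, 7, 15, 16, 8, 11, 19, 22,
    14]⟩,
⟨1, 7, 3, 7, 12, [0, 1, 2, 5, 8, 16, 19, 11, 14, 22, 21, 13, 10, 18, 17, 9, 12, 20, 23, 15, 7, 4,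
    3, 6]⟩,
⟨0, 9, 1, 7, 13, [0, 1, 4, 7, 16, 17, 8, 5, 2, 3, 6, 9, 18, 21, 12, 15, 24, 23, 14, 11, 20, 19,
    10, 13, 22]⟩,
⟨1, 8, 1, 6, 10, [0, 1, 4, 5, 2, 3, 6, 15, 18, 9, 12, 21, 24, 25, 16, 7, 10, 19, 22, 13, 14, 23,
    20, 11, 8, 17]⟩,
⟨0, 10, 4, 7, 13, [0, 1, 2, 3, 6, 9, 19, 22, 12, 15, 25, 24, 14, 11, 21, 18, 8, 5, 4, 7, 17, 20,
    10, 13, 23, 26, 16]⟩,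
⟨1, 9, 2, 8, 12, [0, 1, 4, 7, 6, 3, 2, 5, 15, 25, 22, 12, 9, 19, 20, 10, 13, 23, 26, 16, 17, 27,
    24, 14, 11, 21, 18, 8]⟩,
⟨1, 11, 1, 8, 12, [0, 1, 4, 7, 19, 31, 30, 18, 15, 27, 24, 12, 9, 21, 22, 10, 13, 25, 28, 16, 17,
    29, 26, 14, 11, 23, 20, 8, 5, 2, 3, 6]⟩]

/-- Seeds with five edges of length `1` and `y + 2` edges of length `3`. -/
def fiveOnesSeeds2 : List Seed := [
⟨0, 4, 2, 8, 8, [0, 1, 2, 5, 8, 12, 13, 9, 6, 3, 4, 7, 10, 14, 15, 11]⟩,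
⟨1, 3, 3, 8, 0, [0, 1, 2, 3, 6, 9, 13, 16, 12, 8, 5, 4, 7, 10, 14, 15, 11]⟩,
⟨0, 5, 1, 7, 9, [0, 1, 4, 5, 2, 3, 6, 9, 14, 17, 16, 11, 8, 13, 12, 7, 10, 15]⟩,
⟨1, 4, 1, 7, 9, [0, 1, 4, 5, 2, 3, 6, 9, 14, 17, 18, 13, 8, 11, 16, 15, 10, 7, 12]⟩,
⟨0, 6, 1, 8, 8, [0, 1, 4, 7, 10, 16, 15, 9, 6, 3, 2, 5, 8, 14, 17, 11, 12, 18, 19, 13]⟩,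
⟨1, 5, 1, 9, 9, [0, 1, 4, 7, 10, 16, 17, 11, 8, 14, 20, 19, 13, 12, 18, 15, 9, 6, 3, 2, 5]⟩,
⟨0, 7, 1, 8, 12, [0, 1, 4, 7, 6, 3, 2, 5, 8, 15, 18, 11, 14, 21, 20, 13, 10, 17, 16, 9, 12, 19]⟩,
⟨1, 6, 1, 6, 10, [0, 1, 4, 5, 2, 3, 6, 13, 14, 7, 10, 17, 20, 21, 18, 11, 8, 15, 22, 19, 12, 9,
    16]⟩,
⟨0, 8, 1, 6, 10, [0, 1, 4, 5, 2, 3, 6, 14, 17, 9, 12, 20, 23, 22, 19, 11, 8, 16, 15, 7, 10, 18,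
    21, 13]⟩,
⟨1, 7, 1, 9, 9, [0, 1, 4, 7, 10, 18, 19, 11, 8, 16, 24, 21, 13, 14, 22, 23, 15, 12, 20, 17, 9, 6,
    3, 2, 5]⟩,
⟨0, 9, 1, 8, 14, [0, 1, 4, 7, 10, 19, 18, 9, 6, 3, 2, 5, 8, 17, 20, 11, 14, 23, 24, 15, 12, 21,
    22, 13, 16, 25]⟩,
⟨1, 8, 1, 8, 14, [0, 1, 4, 5, 2, 3, 6, 9, 18, 21, 12, 15, 24, 25, 16, 13, 22, 19, 10, 7, 8, 17,
    26, 23, 14, 11, 20]⟩,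
⟨1, 9, 1, 9, 15, [0, 1, 4, 7, 10, 20, 19, 9, 6, 3, 2, 5, 8, 18, 28, 25, 15, 12, 22, 23, 13, 16,
    26, 27, 17, 14, 24, 21, 11]⟩]

/-- Seeds with three edges of length `1` and `y + 3` edges of length `3`, for `y` a multiple of
`3`. -/
def threeOnesSeeds0 : List Seed := [
⟨0, 6, 1, 7, 7, [0, 1, 4, 7, 13, 16, 10, 11, 17, 14, 8, 5, 2, 3, 6, 9, 15, 18, 12]⟩,
⟨1, 5, 1, 7, 0, [0, 1, 4, 7, 13, 19, 16, 10, 11, 17, 14, 8, 5, 2, 3, 6, 9, 15, 18, 12]⟩,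
⟨2, 4, 1, 7, 0, [0, 1, 4, 7, 13, 19, 16, 10, 11, 17, 20, 14, 8, 5, 2, 3, 6, 9, 15, 18, 12]⟩,
⟨3, 3, 1, 7, 0, [0, 1, 4, 7, 13, 19, 16, 10, 11, 17, 20, 14, 8, 5, 2, 3, 6, 9, 15, 21, 18, 12]⟩,
⟨4, 2, 1, 7, 0, [0, 1, 4, 7, 13, 19, 22, 16, 10, 11, 17, 20, 14, 8, 5, 2, 3, 6, 9, 15, 21, 18,
    12]⟩,
⟨5, 1, 1, 7, 0, [0, 1, 4, 7, 13, 19, 22, 16, 10, 11, 17, 23, 20, 14, 8, 5, 2, 3, 6, 9, 15, 21, 18,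
    12]⟩,
⟨0, 9, 1, 7, 7, [0, 1, 4, 7, 16, 19, 10, 13, 22, 23, 14, 11, 20, 17, 8, 5, 2, 3, 6, 9, 18, 21, 12,
    15, 24]⟩,
⟨1, 8, 1, 8, 9, [0, 1, 4, 7, 10, 19, 22, 13, 16, 25, 24, 15, 12, 21, 18, 9, 6, 3, 2, 5, 14, 23,
    20, 11, 8, 17]⟩,
⟨2, 7, 1, 8, 9, [0, 1, 4, 7, 10, 19, 22, 13, 16, 25, 24, 15, 12, 21, 18, 9, 6, 3, 2, 5, 14, 23,
    26, 17, 8, 11, 20]⟩,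
⟨3, 6, 2, 10, 13, [0, 1, 4, 7, 16, 25, 22, 13, 10, 19, 20, 11, 14, 23, 26, 17, 8, 5, 2, 3, 6, 9,
    18, 27, 24, 15, 12, 21]⟩,
⟨4, 5, 1, 9, 11, [0, 1, 4, 7, 16, 25, 28, 19, 10, 13, 22, 21, 12, 9, 18, 27, 24, 15, 6, 3, 2, 5,
    8, 11, 20, 23, 14, 17, 26]⟩,
⟨5, 4, 1, 10, 11, [0, 1, 4, 7, 16, 25, 22, 13, 10, 19, 28, 27, 18, 15, 24, 21, 12, 9, 6, 3, 2, 5,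
    14, 23, 26, 17, 8, 11, 20, 29]⟩,
⟨6, 3, 1, 7, 13, [0, 1, 4, 7, 16, 25, 22, 13, 10, 19, 28, 29, 20, 11, 14, 23, 26, 17, 8, 5, 2, 3,
    6, 9, 18, 27, 24, 15, 12, 21, 30]⟩,
⟨7, 2, 1, 8, 9, [0, 1, 4, 7, 10, 19, 28, 31, 22, 13, 16, 25, 24, 15, 12, 21, 30, 27, 18, 9, 6, 3,
    2, 5, 14, 23, 26, 17, 8, 11, 20, 29]⟩,
⟨8, 1, 1, 4, 10, [0, 1, 4, 13, 22, 25, 16, 7, 10, 19, 28, 31, 30, 21, 12, 9, 18, 27, 24, 15, 6, 3,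
    2, 5, 14, 17, 8, 11, 20, 29, 32, 23, 26]⟩,
⟨1, 11, 1, 8, 14, [0, 1, 4, 7, 10, 22, 25, 13, 16, 28, 31, 19, 18, 30, 27, 15, 12, 24, 21, 9, 6,
    3, 2, 5, 17, 29, 26, 14, 11, 23, 20, 8]⟩,
⟨2, 10, 2, 8, 9, [0, 1, 4, 7, 10, 22, 25, 13, 16, 28, 31, 19, 18, 30, 27, 15, 12, 24, 21, 9, 6, 3,
    2, 5, 17, 29, 32, 20, 8, 11, 23, 26, 14]⟩,
⟨3, 9, 3, 9, 16, [0, 1, 4, 7, 19, 31, 28, 16, 13, 25, 22, 10, 11, 23, 26, 14, 17, 29, 32, 20, 8,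
    5, 2, 3, 6, 9, 21, 33, 30, 18, 15, 27, 24, 12]⟩,
⟨4, 8, 1, 9, 11, [0, 1, 4, 7, 19, 31, 34, 22, 10, 13, 25, 28, 16, 15, 27, 24, 12, 9, 21, 33, 30,
    18, 6, 3, 2, 5, 8, 11, 23, 26, 14, 17, 29, 32, 20]⟩,
⟨5, 7, 1, 11, 12, [0, 1, 4, 16, 28, 25, 13, 10, 7, 19, 31, 34, 22, 21, 33, 30, 18, 15, 27, 24, 12,
    9, 6, 3, 2, 5, 17, 29, 26, 14, 11, 23, 35, 32, 20, 8]⟩,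
⟨7, 5, 1, 8, 14, [0, 1, 4, 7, 10, 22, 34, 37, 25, 13, 16, 28, 31, 19, 18, 30, 27, 15, 12, 24, 36,
    33, 21, 9, 6, 3, 2, 5, 17, 29, 26, 14, 11, 23, 35, 32, 20, 8]⟩,
⟨8, 4, 1, 7, 15, [0, 1, 4, 7, 19, 31, 28, 16, 13, 25, 37, 34, 22, 10, 11, 23, 35, 38, 26, 14, 17,
    29, 32, 20, 8, 5, 2, 3, 6, 9, 21, 33, 36, 24, 12, 15, 27, 30, 18]⟩,
⟨9, 3, 1, 7, 16, [0, 1, 4, 7, 19, 31, 28, 16, 13, 25, 37, 34, 22, 10, 11, 23, 35, 38, 26, 14, 17,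
    29, 32, 20, 8, 5, 2, 3, 6, 9, 21, 33, 30, 18, 15, 27, 39, 36, 24, 12]⟩,
⟨10, 2, 2, 10, 11, [0, 1, 4, 7, 19, 31, 34, 22, 10, 13, 25, 37, 40, 28, 16, 15, 27, 39, 36, 24,
    12, 9, 21, 33, 30, 18, 6, 3, 2, 5, 8, 11, 23, 35, 38, 26, 14, 17, 29, 32, 20]⟩,
⟨11, 1, 1, 12, 12, [0, 1, 4, 16, 28, 40, 37, 25, 13, 10, 7, 19, 31, 34, 22, 21, 33, 30, 18, 15,
    27, 39, 36, 24, 12, 9, 6, 3, 2, 5, 17, 29, 41, 38, 26, 14, 11, 23, 35, 32, 20, 8]⟩,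
⟨5, 10, 1, 4, 16, [0, 1, 4, 19, 34, 31, 16, 13, 28, 25, 10, 7, 22, 37, 40, 39, 24, 9, 12, 27, 30,
    15, 18, 33, 36, 21, 6, 3, 2, 5, 20, 23, 8, 11, 26, 41, 38, 35, 32, 17, 14, 29]⟩,
⟨7, 8, 1, 12, 15, [0, 1, 4, 19, 34, 31, 16, 13, 28, 43, 40, 25, 10, 7, 22, 37, 36, 21, 18, 33, 30,
    15, 12, 27, 42, 39, 24, 9, 6, 3, 2, 5, 8, 11, 26, 41, 38, 23, 20, 35, 32, 17, 14, 29]⟩,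
⟨9, 6, 1, 6, 16, [0, 1, 4, 19, 34, 31, 16, 13, 28, 43, 40, 37, 22, 7, 10, 25, 26, 11, 8, 23, 38,
    41, 44, 29, 14, 17, 32, 35, 20, 5, 2, 3, 6, 21, 36, 33, 18, 15, 30, 45, 42, 39, 24, 9, 12,
    27]⟩,
⟨11, 10, 1, 13, 18, [0, 1, 4, 7, 28, 49, 46, 25, 22, 43, 40, 19, 16, 37, 58, 55, 34, 13, 10, 31,
    52, 51, 30, 9, 12, 33, 54, 57, 36, 15, 18, 39, 42, 21, 24, 45, 48, 27, 6, 3, 2, 5, 8, 29, 50,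
    47, 26, 23, 44, 41, 20, 17, 38, 59, 56, 53, 32, 11, 14, 35]⟩,
⟨13, 8, 1, 11, 20, [0, 1, 4, 25, 46, 43, 22, 19, 40, 61, 58, 37, 16, 13, 34, 55, 52, 31, 10, 7,
    28, 49, 48, 27, 24, 45, 42, 21, 18, 39, 60, 57, 36, 15, 12, 33, 54, 51, 30, 9, 6, 3, 2, 5, 8,
    29, 50, 47, 26, 23, 44, 41, 20, 17, 38, 59, 56, 53, 32, 11, 14, 35]⟩]

/-- Seeds with three edges of length `1` and `y + 4` edges of length `3`, for `y` a multiple of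
`3`. -/
def threeOnesSeeds1 : List Seed := [
⟨0, 6, 1, 8, 8, [0, 1, 4, 7, 10, 16, 19, 13, 12, 18, 15, 9, 6, 3, 2, 5, 8, 14, 17, 11]⟩,
⟨1, 5, 1, 8, 0, [0, 1, 4, 7, 10, 16, 19, 13, 12, 18, 15, 9, 6, 3, 2, 5, 8, 14, 20, 17, 11]⟩,
⟨2, 4, 1, 8, 0, [0, 1, 4, 7, 10, 16, 19, 13, 12, 18, 21, 15, 9, 6, 3, 2, 5, 8, 14, 20, 17, 11]⟩,
⟨3, 3, 1, 8, 0, [0, 1, 4, 7, 10, 16, 22, 19, 13, 12, 18, 21, 15, 9, 6, 3, 2, 5, 8, 14, 20, 17,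
    11]⟩,
⟨4, 2, 1, 8, 0, [0, 1, 4, 7, 10, 16, 22, 19, 13, 12, 18, 21, 15, 9, 6, 3, 2, 5, 8, 14, 20, 23, 17,
    11]⟩,
⟨5, 1, 1, 8, 0, [0, 1, 4, 7, 10, 16, 22, 19, 13, 12, 18, 24, 21, 15, 9, 6, 3, 2, 5, 8, 14, 20, 23,
    17, 11]⟩,
⟨0, 9, 1, 8, 8, [0, 1, 4, 7, 10, 19, 22, 13, 16, 25, 24, 15, 12, 21, 18, 9, 6, 3, 2, 5, 8, 17, 20,
    11, 14, 23]⟩,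
⟨1, 8, 2, 6, 12, [0, 1, 4, 7, 16, 19, 10, 13, 22, 25, 26, 23, 14, 11, 20, 17, 8, 5, 2, 3, 6, 15,
    24, 21, 12, 9, 18]⟩,
⟨2, 7, 1, 9, 10, [0, 1, 4, 7, 10, 19, 22, 13, 16, 25, 26, 17, 14, 23, 20, 11, 8, 5, 2, 3, 6, 15,
    24, 27, 18, 9, 12, 21]⟩,
⟨3, 6, 1, 11, 12, [0, 1, 4, 7, 16, 25, 22, 13, 10, 19, 28, 27, 18, 15, 24, 21, 12, 9, 6, 3, 2, 5,
    8, 17, 26, 23, 14, 11, 20]⟩,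
⟨4, 5, 1, 10, 12, [0, 1, 4, 7, 16, 25, 28, 19, 10, 13, 22, 23, 14, 11, 20, 29, 26, 17, 8, 5, 2, 3,
    6, 9, 12, 21, 24, 15, 18, 27]⟩,
⟨5, 4, 2, 8, 12, [0, 1, 4, 7, 16, 25, 22, 13, 10, 19, 28, 29, 26, 23, 14, 11, 20, 17, 8, 5, 2, 3,
    6, 15, 24, 27, 18, 9, 12, 21, 30]⟩,
⟨6, 3, 1, 8, 14, [0, 1, 4, 7, 10, 19, 28, 25, 16, 13, 22, 31, 30, 21, 12, 15, 24, 27, 18, 9, 6, 3,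
    2, 5, 8, 17, 26, 23, 14, 11, 20, 29]⟩,
⟨7, 2, 1, 4, 10, [0, 1, 4, 13, 16, 7, 10, 19, 28, 31, 22, 25, 26, 23, 32, 29, 20, 11, 8, 17, 14,
    5, 2, 3, 6, 15, 24, 27, 18, 9, 12, 21, 30]⟩,
⟨8, 1, 1, 4, 10, [0, 1, 4, 13, 16, 7, 10, 19, 28, 31, 22, 25, 26, 17, 8, 11, 20, 29, 32, 23, 14,
    5, 2, 3, 6, 15, 18, 9, 12, 21, 30, 33, 24, 27]⟩,
⟨1, 11, 1, 9, 15, [0, 1, 4, 7, 10, 22, 25, 13, 16, 28, 31, 19, 20, 32, 29, 17, 14, 26, 23, 11, 8,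
    5, 2, 3, 6, 18, 30, 27, 15, 12, 24, 21, 9]⟩,
⟨2, 10, 2, 9, 10, [0, 1, 4, 7, 10, 22, 25, 13, 16, 28, 31, 19, 20, 32, 29, 17, 14, 26, 23, 11, 8,
    5, 2, 3, 6, 18, 30, 33, 21, 9, 12, 24, 27, 15]⟩,
⟨3, 9, 1, 9, 17, [0, 1, 4, 7, 10, 22, 34, 31, 19, 16, 28, 25, 13, 12, 24, 27, 15, 18, 30, 33, 21,
    9, 6, 3, 2, 5, 8, 20, 32, 29, 17, 14, 26, 23, 11]⟩,
⟨4, 8, 1, 10, 12, [0, 1, 4, 7, 19, 31, 34, 22, 10, 13, 25, 28, 16, 17, 29, 26, 14, 11, 23, 35, 32,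
    20, 8, 5, 2, 3, 6, 9, 12, 24, 27, 15, 18, 30, 33, 21]⟩,
⟨5, 7, 1, 12, 13, [0, 1, 4, 16, 28, 25, 13, 10, 7, 19, 31, 34, 22, 23, 35, 32, 20, 17, 29, 26, 14,
    11, 8, 5, 2, 3, 6, 18, 30, 27, 15, 12, 24, 36, 33, 21, 9]⟩,
⟨7, 5, 1, 8, 15, [0, 1, 4, 7, 10, 22, 34, 37, 25, 13, 16, 28, 31, 19, 18, 30, 27, 15, 12, 24, 36,
    33, 21, 9, 6, 3, 2, 5, 8, 20, 32, 29, 17, 14, 26, 38, 35, 23, 11]⟩,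
⟨8, 4, 3, 10, 16, [0, 1, 4, 7, 19, 31, 28, 16, 13, 25, 37, 34, 22, 10, 11, 23, 35, 38, 26, 14, 17,
    29, 32, 20, 8, 5, 2, 3, 6, 9, 12, 24, 36, 39, 27, 15, 18, 30, 33, 21]⟩,
⟨9, 3, 1, 8, 17, [0, 1, 4, 7, 10, 22, 34, 31, 19, 16, 28, 40, 37, 25, 13, 12, 24, 36, 39, 27, 15,
    18, 30, 33, 21, 9, 6, 3, 2, 5, 8, 20, 32, 29, 17, 14, 26, 38, 35, 23, 11]⟩,
⟨10, 2, 1, 10, 12, [0, 1, 4, 7, 19, 31, 34, 22, 10, 13, 25, 37, 40, 28, 16, 17, 29, 41, 38, 26,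
    14, 11, 23, 35, 32, 20, 8, 5, 2, 3, 6, 9, 12, 24, 36, 39, 27, 15, 18, 30, 33, 21]⟩,
⟨11, 1, 2, 13, 13, [0, 1, 4, 7, 10, 13, 25, 37, 40, 28, 16, 19, 31, 34, 22, 23, 35, 32, 20, 8, 11,
    14, 26, 38, 41, 29, 17, 5, 2, 3, 6, 18, 30, 42, 39, 27, 15, 12, 24, 36, 33, 21, 9]⟩,
⟨5, 10, 1, 11, 18, [0, 1, 4, 7, 22, 37, 40, 25, 10, 13, 28, 31, 16, 19, 34, 35, 20, 17, 32, 29,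
    14, 11, 26, 41, 38, 23, 8, 5, 2, 3, 6, 9, 12, 27, 42, 39, 24, 21, 36, 33, 18, 15, 30]⟩,
⟨7, 8, 1, 7, 15, [0, 1, 4, 19, 34, 31, 16, 13, 28, 25, 10, 7, 22, 37, 40, 43, 42, 27, 12, 15, 30,
    33, 18, 21, 36, 39, 24, 9, 6, 3, 2, 5, 20, 35, 32, 17, 14, 29, 44, 41, 38, 23, 8, 11, 26]⟩,
⟨9, 6, 1, 7, 17, [0, 1, 4, 7, 22, 37, 34, 19, 16, 31, 46, 43, 40, 25, 10, 13, 28, 27, 12, 9, 24,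
    39, 42, 45, 30, 15, 18, 33, 36, 21, 6, 3, 2, 5, 20, 35, 32, 17, 14, 29, 44, 41, 38, 23, 8, 11,
    26]⟩,
⟨11, 10, 1, 8, 19, [0, 1, 4, 7, 28, 49, 52, 31, 10, 13, 34, 55, 58, 37, 16, 19, 40, 43, 22, 25,
    46, 47, 26, 23, 44, 41, 20, 17, 38, 59, 56, 35, 14, 11, 32, 53, 50, 29, 8, 5, 2, 3, 6, 9, 30,
    51, 48, 27, 24, 45, 42, 21, 18, 39, 60, 57, 54, 33, 12, 15, 36]⟩]

/-- Seeds with three edges of length `1` and `y + 5` edges of length `3`, for `y` a multiple of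
`3`. -/
def threeOnesSeeds2 : List Seed := [
⟨0, 6, 1, 9, 9, [0, 1, 4, 7, 10, 16, 19, 13, 12, 18, 15, 9, 6, 3, 2, 5, 8, 11, 17, 20, 14]⟩,
⟨1, 5, 1, 9, 0, [0, 1, 4, 7, 10, 16, 19, 13, 12, 18, 21, 15, 9, 6, 3, 2, 5, 8, 11, 17, 20, 14]⟩,
⟨2, 4, 1, 9, 0, [0, 1, 4, 7, 10, 16, 22, 19, 13, 12, 18, 21, 15, 9, 6, 3, 2, 5, 8, 11, 17, 20,
    14]⟩,
⟨3, 3, 1, 9, 0, [0, 1, 4, 7, 10, 16, 22, 19, 13, 12, 18, 21, 15, 9, 6, 3, 2, 5, 8, 11, 17, 23, 20,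
    14]⟩,
⟨4, 2, 1, 9, 0, [0, 1, 4, 7, 10, 16, 22, 19, 13, 12, 18, 24, 21, 15, 9, 6, 3, 2, 5, 8, 11, 17, 23,
    20, 14]⟩,
⟨5, 1, 1, 9, 0, [0, 1, 4, 7, 10, 16, 22, 25, 19, 13, 12, 18, 24, 21, 15, 9, 6, 3, 2, 5, 8, 11, 17,
    23, 20, 14]⟩,
⟨0, 9, 1, 9, 9, [0, 1, 4, 7, 10, 19, 22, 13, 16, 25, 24, 15, 12, 21, 18, 9, 6, 3, 2, 5, 8, 11, 20,
    23, 14, 17, 26]⟩,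
⟨1, 8, 1, 7, 13, [0, 1, 4, 7, 16, 19, 10, 13, 22, 25, 26, 23, 14, 11, 20, 17, 8, 5, 2, 3, 6, 9,
    18, 27, 24, 15, 12, 21]⟩,
⟨2, 7, 1, 10, 11, [0, 1, 4, 7, 16, 25, 22, 13, 10, 19, 28, 27, 18, 15, 24, 21, 12, 9, 6, 3, 2, 5,
    8, 11, 20, 23, 14, 17, 26]⟩,
⟨3, 6, 1, 11, 11, [0, 1, 4, 7, 10, 13, 22, 25, 16, 19, 28, 27, 18, 15, 24, 21, 12, 9, 6, 3, 2, 5,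
    14, 23, 26, 17, 8, 11, 20, 29]⟩,
⟨4, 5, 1, 11, 13, [0, 1, 4, 7, 10, 13, 22, 25, 16, 19, 28, 29, 20, 11, 14, 23, 26, 17, 8, 5, 2, 3,
    6, 9, 18, 27, 30, 21, 12, 15, 24]⟩,
⟨5, 4, 1, 14, 15, [0, 1, 4, 7, 10, 19, 28, 25, 16, 13, 22, 31, 30, 21, 12, 15, 24, 27, 18, 9, 6,
    3, 2, 5, 8, 11, 20, 29, 26, 17, 14, 23]⟩,
⟨6, 3, 1, 9, 15, [0, 1, 4, 7, 10, 19, 28, 25, 16, 13, 22, 31, 30, 21, 12, 15, 24, 27, 18, 9, 6, 3,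
    2, 5, 8, 11, 20, 29, 26, 17, 14, 23, 32]⟩,
⟨7, 2, 1, 4, 10, [0, 1, 4, 13, 16, 7, 10, 19, 28, 31, 22, 25, 26, 23, 32, 29, 20, 11, 8, 17, 14,
    5, 2, 3, 6, 15, 24, 27, 18, 9, 12, 21, 30, 33]⟩,
⟨8, 1, 1, 9, 11, [0, 1, 4, 7, 16, 25, 28, 19, 10, 13, 22, 31, 34, 33, 30, 21, 12, 9, 18, 27, 24,
    15, 6, 3, 2, 5, 8, 11, 20, 29, 32, 23, 14, 17, 26]⟩,
⟨1, 11, 1, 10, 16, [0, 1, 4, 7, 10, 22, 25, 13, 16, 28, 31, 19, 20, 32, 29, 17, 14, 26, 23, 11, 8,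
    5, 2, 3, 6, 9, 21, 33, 30, 18, 15, 27, 24, 12]⟩,
⟨2, 10, 1, 11, 11, [0, 1, 4, 7, 10, 13, 25, 28, 16, 19, 31, 34, 22, 21, 33, 30, 18, 15, 27, 24,
    12, 9, 6, 3, 2, 5, 17, 29, 32, 20, 8, 11, 23, 26, 14]⟩,
⟨3, 9, 1, 11, 12, [0, 1, 4, 7, 10, 13, 25, 28, 16, 19, 31, 34, 22, 21, 33, 30, 18, 15, 27, 24, 12,
    9, 6, 3, 2, 5, 17, 29, 26, 14, 11, 23, 35, 32, 20, 8]⟩,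
⟨4, 8, 1, 12, 13, [0, 1, 4, 7, 10, 13, 25, 28, 16, 19, 31, 34, 22, 23, 35, 32, 20, 8, 11, 14, 26,
    29, 17, 5, 2, 3, 6, 9, 21, 33, 36, 24, 12, 15, 27, 30, 18]⟩,
⟨5, 7, 1, 14, 14, [0, 1, 4, 7, 10, 13, 16, 28, 31, 19, 22, 34, 37, 25, 24, 36, 33, 21, 9, 12, 15,
    27, 30, 18, 6, 3, 2, 5, 17, 29, 26, 14, 11, 23, 35, 32, 20, 8]⟩,
⟨7, 5, 1, 9, 16, [0, 1, 4, 7, 10, 22, 34, 37, 25, 13, 16, 28, 31, 19, 20, 32, 29, 17, 14, 26, 38,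
    35, 23, 11, 8, 5, 2, 3, 6, 9, 21, 33, 30, 18, 15, 27, 39, 36, 24, 12]⟩,
⟨8, 4, 1, 9, 17, [0, 1, 4, 7, 10, 22, 34, 31, 19, 16, 28, 40, 37, 25, 13, 12, 24, 36, 39, 27, 15,
    18, 30, 33, 21, 9, 6, 3, 2, 5, 8, 11, 23, 35, 38, 26, 14, 17, 29, 32, 20]⟩,
⟨9, 3, 1, 9, 18, [0, 1, 4, 7, 10, 22, 34, 31, 19, 16, 28, 40, 37, 25, 13, 12, 24, 36, 39, 27, 15,
    18, 30, 33, 21, 9, 6, 3, 2, 5, 8, 11, 23, 35, 32, 20, 17, 29, 41, 38, 26, 14]⟩,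
⟨10, 2, 1, 7, 7, [0, 1, 4, 7, 19, 31, 34, 22, 10, 13, 25, 37, 40, 28, 16, 17, 29, 41, 38, 26, 14,
    11, 23, 35, 32, 20, 8, 5, 2, 3, 6, 9, 21, 33, 36, 39, 42, 30, 18, 15, 27, 24, 12]⟩,
⟨11, 1, 2, 14, 14, [0, 1, 4, 7, 10, 13, 16, 28, 40, 43, 31, 19, 22, 34, 37, 25, 24, 36, 33, 21, 9,
    12, 15, 27, 39, 42, 30, 18, 6, 3, 2, 5, 17, 29, 41, 38, 26, 14, 11, 23, 35, 32, 20, 8]⟩,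
⟨3, 12, 2, 5, 17, [0, 1, 4, 7, 22, 25, 10, 13, 28, 31, 16, 19, 34, 37, 40, 39, 24, 9, 12, 27, 30,
    15, 18, 33, 36, 21, 6, 3, 2, 5, 20, 23, 8, 11, 26, 41, 38, 35, 32, 17, 14, 29]⟩,
⟨7, 8, 1, 10, 16, [0, 1, 4, 19, 34, 31, 16, 13, 28, 25, 10, 7, 22, 37, 40, 43, 44, 41, 38, 23, 8,
    11, 26, 29, 14, 17, 32, 35, 20, 5, 2, 3, 6, 21, 36, 33, 18, 15, 30, 45, 42, 39, 24, 9, 12,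
    27]⟩,
⟨11, 4, 1, 10, 20, [0, 1, 4, 7, 10, 25, 40, 43, 28, 13, 16, 31, 46, 49, 34, 19, 22, 37, 36, 21,
    18, 33, 48, 45, 30, 15, 12, 27, 42, 39, 24, 9, 6, 3, 2, 5, 8, 23, 38, 35, 20, 17, 32, 47, 44,
    41, 26, 11, 14, 29]⟩,
⟨9, 12, 1, 11, 18, [0, 1, 4, 7, 28, 49, 46, 25, 22, 43, 40, 19, 16, 37, 58, 55, 52, 31, 10, 13,
    34, 33, 12, 9, 30, 51, 54, 57, 36, 15, 18, 39, 42, 21, 24, 45, 48, 27, 6, 3, 2, 5, 8, 29, 50,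
    47, 26, 23, 44, 41, 20, 17, 38, 59, 56, 53, 32, 11, 14, 35]⟩]

/-- Seeds with two sites and `y` edges of length `y`. -/
def doubleSeeds0 : List DoubleSeed := [
⟨4, 1, 4, 3, 3, 0, [0, 1, 2, 3, 7, 10, 6, 5, 9, 8, 4]⟩,
⟨5, 0, 4, 3, 3, 0, [0, 1, 2, 3, 7, 8, 4, 5, 9, 10, 6]⟩,
⟨4, 2, 5, 3, 3, 0, [0, 1, 2, 3, 8, 11, 6, 7, 12, 9, 4, 5, 10]⟩,
⟨5, 1, 5, 2, 4, 0, [0, 1, 2, 7, 8, 3, 4, 9, 12, 11, 6, 5, 10]⟩,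
⟨6, 0, 5, 3, 3, 0, [0, 1, 2, 3, 8, 9, 4, 5, 10, 11, 6, 7, 12]⟩,
⟨4, 3, 6, 3, 3, 0, [0, 1, 2, 3, 9, 12, 6, 7, 13, 10, 4, 5, 11, 14, 8]⟩,
⟨5, 2, 6, 3, 3, 0, [0, 1, 2, 3, 9, 10, 4, 7, 13, 14, 8, 5, 11, 12, 6]⟩,
⟨4, 4, 7, 3, 3, 7, [0, 1, 2, 3, 10, 13, 6, 9, 16, 15, 8, 5, 12, 11, 4, 7, 14]⟩,
⟨5, 3, 7, 3, 3, 7, [0, 1, 2, 3, 10, 11, 4, 7, 14, 15, 8, 5, 12, 13, 6, 9, 16]⟩,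
⟨4, 5, 8, 3, 3, 7, [0, 1, 2, 3, 11, 14, 6, 9, 17, 16, 8, 5, 13, 12, 4, 7, 15, 18, 10]⟩,
⟨5, 4, 8, 1, 7, 0, [0, 1, 9, 12, 4, 5, 13, 10, 2, 3, 11, 14, 6, 7, 15, 18, 17, 16, 8]⟩,
⟨4, 6, 9, 3, 3, 9, [0, 1, 2, 3, 12, 15, 6, 9, 18, 19, 10, 7, 16, 13, 4, 5, 14, 17, 8, 11, 20]⟩,
⟨5, 5, 9, 1, 3, 7, [0, 1, 10, 11, 2, 3, 12, 13, 4, 7, 16, 19, 20, 17, 8, 5, 14, 15, 6, 9, 18]⟩,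
⟨4, 7, 10, 3, 3, 7, [0, 1, 2, 3, 13, 16, 6, 9, 19, 22, 12, 11, 21, 18, 8, 5, 15, 14, 4, 7, 17, 20,
    10]⟩,
⟨5, 6, 10, 3, 3, 7, [0, 1, 2, 3, 13, 14, 4, 7, 17, 20, 10, 11, 21, 18, 8, 5, 15, 16, 6, 9, 19, 22,
    12]⟩,
⟨4, 8, 11, 3, 3, 7, [0, 1, 2, 3, 14, 17, 6, 9, 20, 23, 12, 11, 22, 19, 8, 5, 16, 15, 4, 7, 18, 21,
    10, 13, 24]⟩,
⟨5, 7, 11, 3, 7, 11, [0, 1, 4, 15, 16, 5, 2, 3, 14, 17, 6, 7, 18, 21, 10, 13, 24, 23, 12, 9, 20,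
    19, 8, 11, 22]⟩,
⟨4, 9, 12, 3, 3, 9, [0, 1, 2, 3, 15, 18, 6, 9, 21, 24, 12, 13, 25, 22, 10, 7, 19, 16, 4, 5, 17,
    20, 8, 11, 23, 26, 14]⟩,
⟨5, 8, 12, 3, 7, 11, [0, 1, 4, 16, 17, 5, 2, 3, 15, 18, 6, 7, 19, 22, 10, 13, 25, 24, 12, 9, 21,
    20, 8, 11, 23, 26, 14]⟩,
⟨5, 10, 14, 1, 3, 11, [0, 1, 15, 16, 2, 3, 17, 18, 4, 7, 21, 24, 10, 13, 27, 30, 29, 26, 12, 9,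
    23, 20, 6, 5, 19, 22, 8, 11, 25, 28, 14]⟩]

/-- Seeds with two sites and `y + 1` edges of length `y`. -/
def doubleSeeds1 : List DoubleSeed := [
⟨4, 1, 4, 1, 4, 0, [0, 1, 5, 9, 10, 11, 8, 4, 3, 7, 6, 2]⟩,
⟨5, 0, 4, 3, 6, 0, [0, 1, 2, 3, 7, 11, 10, 6, 5, 9, 8, 4]⟩,
⟨4, 2, 5, 3, 7, 0, [0, 1, 4, 9, 10, 5, 2, 3, 8, 13, 12, 7, 6, 11]⟩,
⟨5, 1, 5, 2, 6, 0, [0, 1, 4, 9, 10, 5, 6, 11, 12, 13, 8, 3, 2, 7]⟩,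
⟨6, 0, 5, 3, 5, 0, [0, 1, 2, 3, 8, 13, 12, 7, 6, 11, 10, 5, 4, 9]⟩,
⟨4, 3, 6, 4, 8, 0, [0, 1, 2, 5, 11, 12, 6, 3, 9, 15, 14, 8, 7, 13, 10, 4]⟩,
⟨5, 2, 6, 1, 6, 0, [0, 1, 7, 13, 14, 15, 12, 6, 5, 11, 8, 2, 3, 9, 10, 4]⟩,
⟨4, 4, 7, 2, 8, 0, [0, 1, 4, 11, 14, 7, 8, 15, 16, 17, 10, 3, 6, 13, 12, 5, 2, 9]⟩,
⟨5, 3, 7, 2, 8, 0, [0, 1, 2, 9, 12, 5, 4, 11, 14, 7, 8, 15, 16, 17, 10, 3, 6, 13]⟩,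
⟨4, 5, 8, 4, 10, 0, [0, 1, 4, 12, 15, 7, 6, 14, 17, 9, 10, 18, 19, 11, 3, 2, 5, 13, 16, 8]⟩,
⟨5, 4, 8, 2, 8, 0, [0, 1, 9, 17, 18, 19, 16, 8, 7, 15, 12, 4, 3, 11, 14, 6, 5, 13, 10, 2]⟩,
⟨4, 6, 9, 2, 8, 0, [0, 1, 4, 13, 16, 7, 8, 17, 20, 19, 10, 9, 18, 21, 12, 3, 6, 15, 14, 5, 2, 11]⟩,
⟨5, 5, 9, 3, 5, 9, [0, 1, 2, 3, 12, 21, 18, 9, 6, 15, 16, 7, 10, 19, 20, 11, 8, 17, 14, 5, 4, 13]⟩,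
⟨4, 7, 10, 1, 4, 8, [0, 1, 11, 21, 18, 8, 5, 15, 16, 6, 9, 19, 22, 23, 20, 10, 7, 17, 14, 4, 3,
    13, 12, 2]⟩,
⟨5, 6, 10, 3, 6, 10, [0, 1, 4, 14, 15, 5, 6, 16, 19, 9, 12, 22, 21, 11, 8, 18, 17, 7, 10, 20, 23,
    13, 3, 2]⟩,
⟨4, 8, 11, 1, 9, 0, [0, 1, 12, 15, 4, 7, 18, 17, 6, 3, 14, 25, 22, 11, 10, 21, 24, 23, 20, 9, 8,
    19, 16, 5, 2, 13]⟩,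
⟨5, 7, 11, 4, 7, 11, [0, 1, 4, 15, 16, 5, 2, 3, 14, 25, 22, 11, 8, 19, 20, 9, 12, 23, 24, 13, 10,
    21, 18, 7, 6, 17]⟩,
⟨4, 9, 12, 4, 8, 12, [0, 1, 4, 16, 19, 7, 8, 20, 23, 11, 14, 26, 25, 13, 10, 22, 21, 9, 12, 24,
    27, 15, 3, 6, 18, 17, 5, 2]⟩,
⟨5, 8, 12, 2, 6, 10, [0, 1, 13, 25, 22, 10, 7, 19, 20, 8, 11, 23, 26, 27, 24, 12, 9, 21, 18, 6, 5,
    17, 14, 2, 3, 15, 16, 4]⟩,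
⟨4, 10, 13, 1, 5, 11, [0, 1, 14, 17, 4, 5, 18, 21, 8, 11, 24, 27, 28, 25, 12, 9, 22, 19, 6, 7, 20,
    23, 10, 13, 26, 29, 16, 3, 2, 15]⟩,
⟨5, 9, 13, 4, 5, 11, [0, 1, 2, 3, 16, 29, 26, 13, 10, 23, 20, 7, 6, 19, 22, 9, 12, 25, 28, 15, 14,
    27, 24, 11, 8, 21, 18, 5, 4, 17]⟩,
⟨4, 11, 14, 4, 4, 10, [0, 1, 15, 29, 26, 12, 9, 23, 20, 6, 5, 19, 22, 8, 11, 25, 28, 14, 17, 31,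
    30, 16, 13, 27, 24, 10, 7, 21, 18, 4, 3, 2]⟩,
⟨5, 10, 14, 2, 8, 12, [0, 1, 15, 29, 26, 12, 9, 23, 24, 10, 13, 27, 30, 31, 28, 14, 11, 25, 22, 8,
    7, 21, 18, 4, 5, 19, 16, 2, 3, 17, 20, 6]⟩,
⟨4, 12, 15, 2, 8, 14, [0, 1, 4, 19, 22, 7, 8, 23, 26, 11, 14, 29, 32, 31, 16, 13, 28, 25, 10, 9,
    24, 27, 12, 15, 30, 33, 18, 3, 6, 21, 20, 5, 2, 17]⟩,
⟨4, 14, 17, 1, 9, 15, [0, 1, 18, 21, 4, 7, 24, 23, 6, 3, 20, 37, 34, 17, 14, 31, 28, 11, 10, 27,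
    30, 13, 16, 33, 36, 35, 32, 15, 12, 29, 26, 9, 8, 25, 22, 5, 2, 19]⟩]


/-! ### The tables reach all parameters -/

theorem manyOnesSeeds_ready {e : ℕ} (he : e < 3) {i j : ℕ} (hij : 4 ≤ i + j ∧ 1 ≤ j) :
    ∃ C, 1 ≤ C ∧ Ready [(1, 0), (3, C)] (i + j) (i + j + 2) (3 + e) (i + j + i) := by
  have hok : ∀ i j, 4 ≤ i + j ∧ 1 ≤ j →
      4 ≤ reduceBelow (2 * 1) 8 i + reduceBelow (2 * 1) 8 j ∧ 1 ≤ reduceBelow (2 * 1) 8 j := by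
    intro i j h
    simp only [reduceBelow]
    split_ifs <;> omega
  have hα : ∀ y k, 3 < y → y + 2 * 1 * k + 2 = y + 2 + if (1 : ℕ) = 1 then 2 * k else 0 := by
    intro y k _
    rw [if_pos rfl]
    omega
  -- One table for each residue of the number of threes modulo `3`, which the cut of width `3`
  -- cannot change.
  interval_cases e
  · exact exists_ready_of_seeds (S := 8) (α := fun y => y + 2) (β := fun _ => 3) (.inl rfl)
      (by norm_num) hα (by simp) (ok := fun i j => 4 ≤ i + j ∧ 1 ≤ j) (l := manyOnesSeeds0)
      (by decide +kernel) (by decide +kernel) hok hij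
  · exact exists_ready_of_seeds (S := 8) (α := fun y => y + 2) (β := fun _ => 4) (.inl rfl)
      (by norm_num) hα (by simp) (ok := fun i j => 4 ≤ i + j ∧ 1 ≤ j) (l := manyOnesSeeds1)
      (by decide +kernel) (by decide +kernel) hok hij
  · exact exists_ready_of_seeds (S := 8) (α := fun y => y + 2) (β := fun _ => 5) (.inl rfl)
      (by norm_num) hα (by simp) (ok := fun i j => 4 ≤ i + j ∧ 1 ≤ j) (l := manyOnesSeeds2)
      (by decide +kernel) (by decide +kernel) hok hij

/-- The case of sites of width `3`: the number of edges of length `1` does not depend on `y`. -/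
theorem exists_ready_of_seeds_three {S a e₀ e₁ : ℕ} (hS : 6 ≤ S) (he₀ : e₀ ≤ 4)
    {ok : ℕ → ℕ → Prop} {l : List Seed}
    (hl : ∀ σ ∈ l, σ.Valid 3 a (σ.h + σ.w - e₀ + e₁))
    (hc : ∀ i < S, ∀ j < S, ok i j → ∃ σ ∈ l,
      Covers 6 6 S S σ.h σ.w (σ.Grows true) (σ.Grows false) i j)
    (hok : ∀ i j, ok i j → ok (reduceBelow 6 S i) (reduceBelow 6 S j)) {i j : ℕ} (hij : ok i j) :
    ∃ C, 1 ≤ C ∧ Ready [(1, 0), (3, C)] (i + j) a (i + j - e₀ + e₁) (i + j + i) :=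
  exists_ready_of_seeds (s := 3) (S := S) (α := fun _ => a) (β := fun y => y - e₀ + e₁)
    -- As `e₀ ≤ 4 ≤ y`, adding `6 * k` to `y` commutes with the truncated subtraction of `e₀`.
    (.inr rfl) hS (by simp) (by intro y k hy; simp; omega) hl hc hok hij

/-- Values `y < 7` are left out: there seven ones already put `a` in the range `a ≥ y + 1`. -/
theorem eightOnesSeeds_ready {e : ℕ} (he : e < 3) {i j : ℕ} (hij : 7 ≤ i + j ∧ 1 ≤ j) :
    ∃ C, 1 ≤ C ∧ Ready [(1, 0), (3, C)] (i + j) 8 (i + j - 4 + (3 + e)) (i + j + i) := by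
  have hok : ∀ i j, 7 ≤ i + j ∧ 1 ≤ j →
      7 ≤ reduceBelow 6 16 i + reduceBelow 6 16 j ∧ 1 ≤ reduceBelow 6 16 j := by
    intro i j h
    simp only [reduceBelow]
    split_ifs <;> omega
  interval_cases e
  · exact exists_ready_of_seeds_three (S := 16) (by norm_num) le_rfl
      (ok := fun i j => 7 ≤ i + j ∧ 1 ≤ j) (l := eightOnesSeeds0)
      (by decide +kernel) (by decide +kernel) hok hij
  · exact exists_ready_of_seeds_three (S := 16) (by norm_num) le_rfl
      (ok := fun i j => 7 ≤ i + j ∧ 1 ≤ j) (l := eightOnesSeeds1)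
      (by decide +kernel) (by decide +kernel) hok hij
  · exact exists_ready_of_seeds_three (S := 16) (by norm_num) le_rfl
      (ok := fun i j => 7 ≤ i + j ∧ 1 ≤ j) (l := eightOnesSeeds2)
      (by decide +kernel) (by decide +kernel) hok hij

/-- Here `i` is the residue `0` or `1` of `c` and is never reduced, so only columns with two
vertices are needed. -/
theorem fiveOnesSeeds_ready {e : ℕ} (he : e < 3) {i j : ℕ} (hij : 4 ≤ i + j ∧ 1 ≤ j ∧ i < 2) :
    ∃ C, 1 ≤ C ∧ Ready [(1, 0), (3, C)] (i + j) 5 (i + j - 0 + e) (i + j + i) := by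
  have hok : ∀ i j, 4 ≤ i + j ∧ 1 ≤ j ∧ i < 2 →
      4 ≤ reduceBelow 6 16 i + reduceBelow 6 16 j ∧ 1 ≤ reduceBelow 6 16 j ∧
        reduceBelow 6 16 i < 2 := by
    intro i j h
    simp only [reduceBelow]
    split_ifs <;> omega
  interval_cases e
  · exact exists_ready_of_seeds_three (S := 16) (by norm_num) (by norm_num)
      (ok := fun i j => 4 ≤ i + j ∧ 1 ≤ j ∧ i < 2) (l := fiveOnesSeeds0)
      (by decide +kernel) (by decide +kernel) hok hij
  · exact exists_ready_of_seeds_three (S := 16) (by norm_num) (by norm_num)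
      (ok := fun i j => 4 ≤ i + j ∧ 1 ≤ j ∧ i < 2) (l := fiveOnesSeeds1)
      (by decide +kernel) (by decide +kernel) hok hij
  · exact exists_ready_of_seeds_three (S := 16) (by norm_num) (by norm_num)
      (ok := fun i j => 4 ≤ i + j ∧ 1 ≤ j ∧ i < 2) (l := fiveOnesSeeds2)
      (by decide +kernel) (by decide +kernel) hok hij

/-- Reduction by the period `6` respects the divisibility of `i + j` by `3`. -/
theorem threeOnesSeeds_ready {e : ℕ} (he : e < 3) {i j : ℕ}
    (hij : 4 ≤ i + j ∧ 1 ≤ j ∧ (i + j) % 3 = 0) :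
    ∃ C, 1 ≤ C ∧ Ready [(1, 0), (3, C)] (i + j) 3 (i + j - 0 + (3 + e)) (i + j + i) := by
  have hok : ∀ i j, 4 ≤ i + j ∧ 1 ≤ j ∧ (i + j) % 3 = 0 →
      4 ≤ reduceBelow 6 20 i + reduceBelow 6 20 j ∧ 1 ≤ reduceBelow 6 20 j ∧
        (reduceBelow 6 20 i + reduceBelow 6 20 j) % 3 = 0 := by
    intro i j h
    simp only [reduceBelow]
    split_ifs <;> omega
  interval_cases e
  · exact exists_ready_of_seeds_three (S := 20) (by norm_num) (by norm_num)
      (ok := fun i j => 4 ≤ i + j ∧ 1 ≤ j ∧ (i + j) % 3 = 0) (l := threeOnesSeeds0)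
      (by decide +kernel) (by decide +kernel) hok hij
  · exact exists_ready_of_seeds_three (S := 20) (by norm_num) (by norm_num)
      (ok := fun i j => 4 ≤ i + j ∧ 1 ≤ j ∧ (i + j) % 3 = 0) (l := threeOnesSeeds1)
      (by decide +kernel) (by decide +kernel) hok hij
  · exact exists_ready_of_seeds_three (S := 20) (by norm_num) (by norm_num)
      (ok := fun i j => 4 ≤ i + j ∧ 1 ≤ j ∧ (i + j) % 3 = 0) (l := threeOnesSeeds2)
      (by decide +kernel) (by decide +kernel) hok hij

theorem doubleSeeds_ready {ε : ℕ} (hε : ε < 2) {y a b : ℕ} (hab : 4 ≤ a ∧ 5 ≤ a + b)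
    (hy : y + 1 = a + b) : Ready [(1, 0)] y (a + 1) b (y + ε) := by
  have hok : ∀ i j, 4 ≤ i ∧ 5 ≤ i + j →
      4 ≤ reduceBelow 2 12 i ∧ 5 ≤ reduceBelow 2 12 i + reduceBelow 6 18 j := by
    intro i j h
    simp only [reduceBelow]
    split_ifs <;> omega
  interval_cases ε
  · exact ready_of_doubleSeeds (S := 12) (T := 18) (by norm_num) (by norm_num)
      (ok := fun i j => 4 ≤ i ∧ 5 ≤ i + j) (l := doubleSeeds0)
      (by decide +kernel) (by decide +kernel) hok hab hy
  · exact ready_of_doubleSeeds (S := 12) (T := 18) (by norm_num) (by norm_num)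
      (ok := fun i j => 4 ≤ i ∧ 5 ≤ i + j) (l := doubleSeeds1)
      (by decide +kernel) (by decide +kernel) hok hab hy

/-! ### The four cases -/

section Realizations

variable {v a b c y : ℕ}

/-- Reduce the number of edges of length `y` modulo `y` and the number of edges of length `3`
modulo `3`. -/
theorem hasLinearRealization_of_ready (hy : 3 < y) (hv : a + b + c + 1 = v) {a₀ b₀ : ℕ}
    (ha₀ : a₀ ≠ 0) (ha : a₀ ≤ a) (hb : b₀ ≤ b)
    (h : ∀ e < 3, ∃ C, 1 ≤ C ∧
      Ready [(1, 0), (3, C)] y (a₀ + 1) (b₀ + (3 + e)) (y + c % y)) :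
    HasLinearRealization v (tripleMultiset a 3 b y c) := by
  obtain ⟨C, hC, hr⟩ := h ((b - b₀) % 3) (Nat.mod_lt _ (by norm_num))
  have hb' := Nat.mod_add_div (b - b₀) 3
  have hc := Nat.mod_add_div c y
  rw [mul_comm] at hc
  have e1 : b₀ + (3 + (b - b₀) % 3) = b₀ + (b - b₀) % 3 + 3 := by ring
  rw [e1, add_comm y] at hr
  have key := hr.hasLinearRealization hC hy (a - a₀) ((b - b₀) / 3) (c / y) v ha₀
    (by rw [hc]; omega)
  rwa [hc, show a₀ + (a - a₀) = a by omega,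
    show b₀ + (b - b₀) % 3 + (b - b₀) / 3 * 3 = b by omega] at key

theorem hasLinearRealization_of_lt_ones (hy : 3 < y) (hv : a + b + c + 1 = v) (ha : y + 1 ≤ a) :
    HasLinearRealization v (tripleMultiset a 3 b y c) := by
  have hm : c % y < y := Nat.mod_lt _ (by omega)
  refine hasLinearRealization_of_ready hy hv (a₀ := y + 1) (b₀ := 0) (by omega) ha (by omega)
    fun e he => ?_
  -- The residue of `c` plays the part of `h`, and `w` is its complement in `y`, which is positive.
  have := manyOnesSeeds_ready he (i := c % y) (j := y - c % y) (by omega)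
  rwa [show c % y + (y - c % y) = y by omega, ← zero_add (3 + e)] at this

theorem hasLinearRealization_of_seven_ones (hy : 3 < y) (hv : a + b + c + 1 = v) (ha : 7 ≤ a)
    (hb : y - 4 ≤ b) : HasLinearRealization v (tripleMultiset a 3 b y c) := by
  rcases le_or_gt (y + 1) a with h | h
  · exact hasLinearRealization_of_lt_ones hy hv h
  -- What remains is `7 ≤ a ≤ y`, so that `y` is large enough for the seeds with eight ones.
  have hm : c % y < y := Nat.mod_lt _ (by omega)
  refine hasLinearRealization_of_ready hy hv (a₀ := 7) (b₀ := y - 4) (by omega) ha hb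
    fun e he => ?_
  have := eightOnesSeeds_ready he (i := c % y) (j := y - c % y) (by omega)
  rwa [show c % y + (y - c % y) = y by omega] at this

theorem hasLinearRealization_of_three_dvd (hy : 3 < y) (hv : a + b + c + 1 = v) (h3 : y % 3 = 0)
    (ha : 2 ≤ a) (hb : y ≤ b) : HasLinearRealization v (tripleMultiset a 3 b y c) := by
  have hm : c % y < y := Nat.mod_lt _ (by omega)
  refine hasLinearRealization_of_ready hy hv (a₀ := 2) (b₀ := y) (by omega) ha hb
    fun e he => ?_
  have := threeOnesSeeds_ready he (i := c % y) (j := y - c % y) (by omega)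
  rwa [show c % y + (y - c % y) = y by omega] at this

theorem hasLinearRealization_of_mod_lt_two (hy : 3 < y) (hv : a + b + c + 1 = v) (ha : 4 ≤ a)
    (hab : y + 1 ≤ a + b) (hc : c % y < 2) :
    HasLinearRealization v (tripleMultiset a 3 b y c) := by
  -- With at least `y - 3` threes, four ones suffice. With fewer, `y + 1 - b ≥ 5` ones make up the
  -- total `y + 1`, and `b` is kept exact.
  rcases le_or_gt (y - 3) b with hb | hb
  · refine hasLinearRealization_of_ready hy hv (a₀ := 4) (b₀ := y - 3) (by omega) ha hb
      fun e he => ?_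
    have := fiveOnesSeeds_ready he (i := c % y) (j := y - c % y) (by omega)
    rwa [show c % y + (y - c % y) = y by omega, show y - 0 + e = y - 3 + (3 + e) by omega] at this
  · have hm := Nat.mod_add_div c y
    rw [mul_comm] at hm
    have h1 : 4 ≤ y + 1 - b ∧ 5 ≤ y + 1 - b + b := by omega
    have hr := doubleSeeds_ready hc h1 (y := y) (by omega)
    rw [add_comm y (c % y)] at hr
    have key := hr.hasLinearRealization_flat (by omega) (a - (y + 1 - b)) (c / y) v (by omega)
      (by rw [hm]; omega)
    rwa [hm, show y + 1 - b + (a - (y + 1 - b)) = a by omega] at key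

end Realizations

end BHR

theorem mainTheorem4 (v a b c y q r : ℕ) (hy : 3 < y)
    (hL : BHR.Admissible v (BHR.tripleMultiset a 3 b y c))
    (hv : v = 3 * q + r) (hr : r < 3) :
    (y + 1 ≤ a →
      BHR.HasLinearRealization v (BHR.tripleMultiset a 3 b y c)) ∧
    (7 ≤ a → y - 4 ≤ b →
      BHR.HasLinearRealization v (BHR.tripleMultiset a 3 b y c)) ∧
    (4 ≤ a → y + 1 ≤ a + b → (c ≡ 0 [MOD y] ∨ c ≡ 1 [MOD y]) →
      BHR.HasLinearRealization v (BHR.tripleMultiset a 3 b y c)) ∧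
    (∀ t : ℕ, 2 ≤ a → y = 3 * t → 3 * t + 6 ≤ v →
      ((Even r ∧ 3 * t ≤ b) ∨ (Odd r ∧ 3 * t + 1 ≤ b)) →
      BHR.HasLinearRealization v (BHR.tripleMultiset a 3 b y c)) := by
  have hsize : a + b + c + 1 = v := by
    rw [← BHR.card_tripleMultiset a 3 b y c]
    exact hL.size
  refine ⟨BHR.hasLinearRealization_of_lt_ones hy hsize,
    BHR.hasLinearRealization_of_seven_ones hy hsize, fun ha hab hc => ?_, fun t ha ht _ hb => ?_⟩
  · refine BHR.hasLinearRealization_of_mod_lt_two hy hsize ha hab ?_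
    rcases hc with hc | hc
    · rw [show c % y = 0 from Eq.trans hc (Nat.zero_mod y)]
      norm_num
    · rw [show c % y = 1 from Eq.trans hc (Nat.mod_eq_of_lt (by omega))]
      norm_num
  -- Either parity of `r` gives `y ≤ b`.
  · exact BHR.hasLinearRealization_of_three_dvd hy hsize (by omega) ha (by omega)
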